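/- Fix an integer $k\ge 2$. An ordered factorisation of $\pi\in\mathfrak S_n$ into $k$-cycles is a tuple $(\sigma_1,\dots,\sigma_j)$ of $k$-cycles in $\mathfrak S_n$ with $\sigma_1\cdots\sigma_j=\pi$. It is transitive if the subgroup generated by $\sigma_1,\dots,\sigma_j$ acts transitively on $\{1,\dots,n\}$, and a transitive one is minimal if $j$ is the least possible for $\pi$. For a partition $\alpha\vdash n$ with $l(\alpha)$ parts let $\mathcal C_\alpha\subset\mathfrak S_n$ be the class of permutations of cycle type $\alpha$, let $c_k(\alpha)$ be the number of minimal transitive ordered factorisations into $k$-cycles of a fixed $\pi\in\mathcal C_\alpha$, and let $\mu_k(\alpha)=\frac{n+l(\alpha)-2}{k-1}$. Let $u,z,p_1,p_2,\dots$ be indeterminates, $p_\alpha=p_{\alpha_1}p_{\alpha_2}\cdots$, and for $m\ge1$ $$F_k^{(m)}=\sum_{\substack{n\ge1\\ k-1\mid n+m-2}}\ \sum_{\substack{\alpha\vdash n\\ l(\alpha)=m}} c_k(\alpha)\,|\mathcal C_\alpha|\,p_\alpha\,\frac{u^{\mu_k(\alpha)}}{\mu_k(\alpha)!}\,\frac{z^n}{n!},\qquad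 \Phi=\sum_{m\ge1}F_k^{(m)},$$ as formal power series in $z$ whose coefficients are polynomials over $\mathbb Q$ in $u,p_1,p_2,\dots$. Let $\mathcal B^{(k)}$ be the (finite) set of plane trees with $k$ edges whose vertices are properly coloured black and white, up to isomorphism (preserving the colours and the cyclic order of the edges around every vertex). For each $\mathfrak t\in\mathcal B^{(k)}$ fix a labelling of its edges by $1,\dots,k$; given $\mathbf i=(i_1,\dots,i_k)$ with all $i_j\ge1$, let $\omega(v)$ be the sum of the $i_j$ over the edges $j$ incident with the vertex $v$. Let $\mathrm{aut}(\mathfrak t)$ be the group of automorphisms of $\mathfrak t$, acting on its edges (so it is cyclic of order $k$ when $\mathfrak t$ is a single black vertex joined to $k$ white ones). Theorem. The series $\Phi$ satisfies $$\sum_{\mathbf i\ge\mathbf 1}\ \sum_{\mathfrak t\in\mathcal B^{(k)}}\frac1{|\mathrm{aut}(\mathfrak t)|}\left(\prod_{v\ \text{black}}p_{\omega(v)}\ \prod_{w\ \text{white}}\omega(w)\frac{\partial\Phi}{\partial p_{\omega(w)}}\right)=\frac{\partial\Phi}{\partial u},$$ where the products are over the vertices of $\mathfrak t$, and for each $n$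 only finitely many $\mathbf i$ contribute to the coefficient of $z^n$ on the left. -/

import Mathlib

namespace CycleFactorisation

open Equiv

/-! ### Cycles of permutations and conjugacy classes -/

/-- The set of cycles of a permutation (fixed points count as cycles of length one). -/
abbrev Cycles {E : Type} (π : Perm E) : Type := Quotient (Perm.SameCycle.setoid π)

/-- The number of cycles of a permutation, fixed points included. -/
noncomputable def numCycles {E : Type} (π : Perm E) : ℕ := Nat.card (Cycles π)

/-- The conjugacy class of the symmetric group on `n` points that is indexed by the partition `α`:
the permutations whose cycle lengths, fixed points included, are the parts of `α`. -/
def conjClass {n : ℕ} (α : n.Partition) : Finset (Perm (Fin n)) :=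
  Finset.univ.filter fun π => π.partition.parts = α.parts

theorem conjClass_nonempty {n : ℕ} (α : n.Partition) : (conjClass α).Nonempty := by
  have hle : (α.parts.filter (fun a => 2 ≤ a)).sum ≤ Fintype.card (Fin n) := by
    rw [Fintype.card_fin]
    have h := congrArg Multiset.sum (Multiset.filter_add_not (fun a => 2 ≤ a) α.parts)
    rw [Multiset.sum_add, α.parts_sum] at h
    omega
  obtain ⟨π, hπ⟩ := (Perm.exists_with_cycleType_iff (α := Fin n)
    (m := α.parts.filter (fun a => 2 ≤ a))).2
    ⟨hle, fun a ha => (Multiset.mem_filter.1 ha).2⟩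
  refine ⟨π, Finset.mem_filter.2 ⟨Finset.mem_univ _, ?_⟩⟩
  have hsplit : α.parts = α.parts.filter (fun a => 2 ≤ a) +
      α.parts.filter (fun a => ¬ 2 ≤ a) := (Multiset.filter_add_not _ _).symm
  have hone : α.parts.filter (fun a => ¬ 2 ≤ a) =
      Multiset.replicate (α.parts.filter (fun a => ¬ 2 ≤ a)).card 1 := by
    rw [Multiset.eq_replicate_card]
    intro a ha
    have h1 := α.parts_pos (Multiset.mem_filter.1 ha).1
    have h2 := (Multiset.mem_filter.1 ha).2
    omega
  have hsum : (α.parts.filter (fun a => 2 ≤ a)).sum +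
      (α.parts.filter (fun a => ¬ 2 ≤ a)).card = n := by
    have h := congrArg Multiset.sum hsplit
    rw [hone, Multiset.sum_add, Multiset.sum_replicate, α.parts_sum] at h
    simp only [smul_eq_mul, mul_one] at h
    exact h.symm
  rw [Perm.parts_partition, ← Perm.sum_cycleType, hπ, Fintype.card_fin]
  conv_rhs => rw [hsplit, hone]
  congr 2
  omega

/-- An arbitrary but fixed element of the conjugacy class indexed by `α`. -/
noncomputable def fixedPerm {n : ℕ} (α : n.Partition) : Perm (Fin n) :=
  (conjClass_nonempty α).choose

/-! ### Minimal transitive ordered factorisations into `k`-cycles -/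

/-- `σ = (σ₁, …, σⱼ)` is a transitive ordered factorisation of `π` into `k`-cycles. -/
structure IsTransFactorisation (k : ℕ) {n : ℕ} (π : Perm (Fin n)) (σ : List (Perm (Fin n))) :
    Prop where
  isCycle : ∀ s ∈ σ, s.IsCycle ∧ s.support.card = k
  prod_eq : σ.prod = π
  transitive : MulAction.IsPretransitive (Subgroup.closure {s | s ∈ σ}) (Fin n)

/-- A transitive ordered factorisation of `π` into `k`-cycles with the least possible number of
factors. -/
def IsMinTransFactorisation (k : ℕ) {n : ℕ} (π : Perm (Fin n)) (σ : List (Perm (Fin n))) : Prop :=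
  IsTransFactorisation k π σ ∧ ∀ τ, IsTransFactorisation k π τ → σ.length ≤ τ.length

/-- `c_k(α)`: the number of minimal transitive ordered factorisations into `k`-cycles of a fixed
permutation in the conjugacy class indexed by `α`. -/
noncomputable def c (k : ℕ) {n : ℕ} (α : n.Partition) : ℕ :=
  Set.ncard {σ | IsMinTransFactorisation k (fixedPerm α) σ}

/-- `μ_k(α) = (n + l(α) - 2) / (k - 1)`; only used when the division is exact, `n ≥ 1` and
`k ≥ 2`. -/
def mu (k : ℕ) {n : ℕ} (α : n.Partition) : ℕ := (n + α.parts.card - 2) / (k - 1)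

/-! ### The generating series -/

/-- The indeterminates `u, p₁, p₂, …` (the indeterminate `p 0` never occurs). -/
inductive Var : Type
  | u : Var
  | p (j : ℕ) : Var

/-- Polynomials over `ℚ` in `u, p₁, p₂, …`. -/
abbrev Coeffs : Type := MvPolynomial Var ℚ

/-- Formal power series in `z` whose coefficients are polynomials in `u, p₁, p₂, …`. -/
abbrev Series : Type := PowerSeries Coeffs

/-- `p_α = p_{α₁} p_{α₂} ⋯`. -/
noncomputable def pProd {n : ℕ} (α : n.Partition) : Coeffs :=
  (α.parts.map fun j => (MvPolynomial.X (Var.p j) : Coeffs)).prod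

/-- The series `F_k^{(m)}`, for `m ≥ 1`. -/
noncomputable def F (k m : ℕ) : Series :=
  PowerSeries.mk fun n =>
    if 1 ≤ n ∧ (k - 1) ∣ (n + m - 2) then
      ∑ α : n.Partition with α.parts.card = m,
        MvPolynomial.C
            (((c k α : ℚ) * ((conjClass α).card : ℚ)) /
              (((mu k α).factorial : ℚ) * (n.factorial : ℚ))) *
          pProd α * MvPolynomial.X Var.u ^ mu k α
    else 0

/-- `g` is the sum of the (possibly infinite) family `f` of formal power series: for every `n`, only
finitely many members of the family contribute to the coefficient of `z ^ n`, and their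
contributions add up to the coefficient of `z ^ n` in `g`. -/
def HasFormalSum {ι : Type} (f : ι → Series) (g : Series) : Prop :=
  ∀ n : ℕ, (Function.support fun i => PowerSeries.coeff n (f i)).Finite ∧
    ∑ᶠ i, PowerSeries.coeff n (f i) = PowerSeries.coeff n g

/-- The series `Φ = ∑_{m ≥ 1} F_k^{(m)}`; the terms with `m > n` do not contribute to the
coefficient of `z ^ n`. -/
noncomputable def Phi (k : ℕ) : Series :=
  PowerSeries.mk fun n => ∑ m ∈ Finset.Icc 1 n, PowerSeries.coeff n (F k m)

theorem coeff_F_eq_zero {k m n : ℕ} (h : n < m) : PowerSeries.coeff n (F k m) = 0 := by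
  rw [F, PowerSeries.coeff_mk]
  split_ifs
  · apply Finset.sum_eq_zero
    intro α hα
    exfalso
    have h1 : α.parts.card = m := (Finset.mem_filter.1 hα).2
    have h2 : α.parts.card • 1 ≤ α.parts.sum :=
      Multiset.card_nsmul_le_sum fun a ha => α.parts_pos ha
    rw [α.parts_sum, h1] at h2
    simp at h2
    omega
  · rfl

theorem hasFormalSum_Phi (k : ℕ) : HasFormalSum (fun m : ℕ+ => F k m) (Phi k) := by
  intro n
  have hsub : (Function.support fun m : ℕ+ => PowerSeries.coeff n (F k m)) ⊆
      (((Finset.range n).image Nat.succPNat : Finset ℕ+) : Set ℕ+) := by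
    intro m hm
    have hle : (m : ℕ) ≤ n := by
      by_contra hlt
      exact hm (coeff_F_eq_zero (not_le.1 hlt))
    have hpos := m.pos
    simp only [Finset.coe_image, Set.mem_image, Finset.coe_range, Set.mem_Iio]
    exact ⟨m - 1, by omega, PNat.eq (by rw [Nat.succPNat_coe]; omega)⟩
  refine ⟨(Finset.finite_toSet _).subset hsub, ?_⟩
  rw [finsum_eq_sum_of_support_subset _ hsub, Finset.sum_image, Phi, PowerSeries.coeff_mk]
  · simp only [Nat.succPNat_coe, Nat.succ_eq_add_one]
    rw [Finset.range_eq_Ico,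
      Finset.sum_Ico_add' (fun j => PowerSeries.coeff n (F k j)) 0 n 1]
    rfl
  · intro x _ y _ hxy
    exact Nat.succPNat_injective hxy

/-- The partial derivative with respect to one of the indeterminates `u, p₁, p₂, …`. -/
noncomputable def partialDeriv (x : Var) (f : Series) : Series :=
  PowerSeries.mk fun n => MvPolynomial.pderiv x (PowerSeries.coeff n f)

/-! ### Plane two-coloured trees -/

/-- A plane tree with `k` edges (labelled by `Fin k`) and vertices properly coloured black and
white, given by its rotation system. The permutation `black` sends every edge to the next edge in
anticlockwise order around its black end, and `white` does the same at the white ends; so the black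
(white) vertices are the cycles of `black` (of `white`), and an edge joins the two cycles that it
lies on. The graph is a tree when it is connected and has one more vertex than it has edges. -/
structure LabelledPlaneTree (k : ℕ) where
  black : Perm (Fin k)
  white : Perm (Fin k)
  connected : MulAction.IsPretransitive (Subgroup.closure {black, white}) (Fin k)
  card_vertices : numCycles black + numCycles white = k + 1

/-- Isomorphism of plane two-coloured trees: a relabelling of the edges that respects the cyclic
order of the edges at each vertex (and the colours). -/
instance planeTreeSetoid (k : ℕ) : Setoid (LabelledPlaneTree k) where
  r s t := ∃ g : Perm (Fin k), g * s.black * g⁻¹ = t.black ∧ g * s.white * g⁻¹ = t.white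
  iseqv :=
    { refl := fun _ => ⟨1, by simp⟩
      symm := by
        rintro s t ⟨g, h1, h2⟩
        exact ⟨g⁻¹, by rw [← h1]; group, by rw [← h2]; group⟩
      trans := by
        rintro r s t ⟨g, h1, h2⟩ ⟨h, h3, h4⟩
        exact ⟨h * g, by rw [← h3, ← h1]; group, by rw [← h4, ← h2]; group⟩ }

/-- The set of (isomorphism classes of) plane two-coloured trees with `k` edges. -/
abbrev PlaneTree (k : ℕ) : Type := Quotient (planeTreeSetoid k)

instance finite_labelledPlaneTree (k : ℕ) : Finite (LabelledPlaneTree k) := by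
  refine Finite.of_injective
    (fun t : LabelledPlaneTree k => ((t.black, t.white) : Perm (Fin k) × Perm (Fin k))) ?_
  rintro ⟨b, w, h1, h2⟩ ⟨b', w', h3, h4⟩ h
  simp only [Prod.mk.injEq] at h
  obtain ⟨rfl, rfl⟩ := h
  rfl

noncomputable instance fintypePlaneTree (k : ℕ) : Fintype (PlaneTree k) := Fintype.ofFinite _

/-- The automorphism group of a plane two-coloured tree, acting on its edges. -/
def LabelledPlaneTree.aut {k : ℕ} (t : LabelledPlaneTree k) : Subgroup (Perm (Fin k)) :=
  Subgroup.centralizer {t.black, t.white}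

noncomputable instance fintypeCycles {k : ℕ} (π : Perm (Fin k)) : Fintype (Cycles π) :=
  Fintype.ofFinite _

/-- `ω(v)`: the sum of the indices `i` of the edges incident with the vertex `v`. -/
noncomputable def omega {k : ℕ} {π : Perm (Fin k)} (i : Fin k → ℕ+) (v : Cycles π) : ℕ :=
  open scoped Classical in ∑ e : Fin k with (Quotient.mk _ e : Cycles π) = v, (i e : ℕ)

/-- The product of `p_{ω(v)}` over the black vertices `v`, times the product of
`ω(w) ∂Ψ/∂p_{ω(w)}` over the white vertices `w`. -/
noncomputable def treeTerm {k : ℕ} (Ψ : Series) (t : LabelledPlaneTree k) (i : Fin k → ℕ+) :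
    Series :=
  (∏ v : Cycles t.black, PowerSeries.C (MvPolynomial.X (Var.p (omega i v)) : Coeffs)) *
    ∏ w : Cycles t.white, (omega i w : ℚ) • partialDeriv (Var.p (omega i w)) Ψ

end CycleFactorisation

/-!
Call a list of `k`-cycles planar if it generates a transitive group and attains equality in the
Riemann–Hurwitz inequality (`riemann_hurwitz`). A permutation of at least `k` points has a planar
factorisation of every length that this equality allows (`exists_planar_factorisation`), so the
minimal transitive factorisations counted by `c` are the planar ones (`isMinTransFactorisation_iff`).
Hence the coefficient of `u ^ j z ^ n` in `Φ` is
`1 / (n! j!)` times the sum, over all planar lists of `j` cycles of length `k` on `n` points, of the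
monomial recording the cycle type of the product (`coeff_toUSeries_Phi`).

The derivative `∂/∂u` removes the first factor `σ` of a planar list. Let `π'` be the product of the
other factors, `ι` an enumeration of the support of `σ` along which `σ` is the cycle `c`, `r` the
first-return permutation of `π'` to the support, and `i` the tuple of return times. The cycles of
`π'` that meet the support correspond to the cycles of `r`, those of `σ π'` to the cycles of `c r`,
and a cycle has length `ω(v)`, the sum of the return times along it (`FirstReturn`). Counting cycles
shows that the list is planar exactly when the black permutation `b = c r` and the white permutation
`w = r⁻¹`, whose product is the full cycle `c`, form a plane tree, and the other factors split into
planar lists on disjoint blocks of points, one block for each white vertex and containing the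
corresponding cycle of `π'` (`isPlanar_cons_iff`, `isForest_iff_exists`). The black vertices thus
contribute `p_{ω(v)}`. A block contributes a planar list with a cycle of length `ω(w)` removed from
its weight and a point marked on that cycle, which is what `ω ∂/∂p_ω` produces
(`smul_pderiv_planarSum`), since marking one point fixes the others through the return times
(`sum_markings`). Distributing the points and the factors over the blocks is the product rule for
exponential generating functions (`sum_prod_filter_ofFn`, `sum_prod_card_fiber`).

Enumerating the support makes every plane tree appear with all its edge labellings, of which there
are `k! / |aut|` (`card_labelledPlaneTree`), while the `k!` is the number of pairs of a full cycle
and an enumeration that give the same `k`-cycle (`factorial_smul_sum_kCycle`).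
-/

namespace CycleFactorisation

open Equiv

/-! ### Orbit partitions and the Riemann–Hurwitz inequality -/

/-- The partition of the ground set into the cycles of a permutation. -/
abbrev cycleSetoid {E : Type} (π : Perm E) : Setoid E := Perm.SameCycle.setoid π

/-- The number of classes of an equivalence relation. -/
noncomputable def classCount {E : Type} (r : Setoid E) : ℕ := Nat.card (Quotient r)

/-- The partition of the ground set into the orbits of the group generated by a list of
permutations, as a supremum of cycle partitions. -/
def orb {E : Type} (L : List (Perm E)) : Setoid E := L.foldr (fun s r => cycleSetoid s ⊔ r) ⊥

@[simp] theorem orb_nil {E : Type} : orb ([] : List (Perm E)) = ⊥ := rfl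

@[simp] theorem orb_cons {E : Type} (s : Perm E) (L : List (Perm E)) :
    orb (s :: L) = cycleSetoid s ⊔ orb L := rfl

theorem cycleSetoid_le_iff {E : Type} {π : Perm E} {r : Setoid E} :
    cycleSetoid π ≤ r ↔ ∀ x, r x (π x) := by
  constructor
  · intro h x
    exact h (⟨1, by simp⟩ : π.SameCycle x (π x))
  · rintro h x y ⟨m, rfl⟩
    induction m using Int.induction_on with
    | zero => exact r.refl _
    | succ m ih =>
      rw [add_comm, zpow_add, Perm.mul_apply, zpow_one]
      exact r.trans ih (h _)
    | pred m ih =>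
      have h1 := h ((π ^ (-(m : ℤ) - 1)) x)
      rw [← Perm.mul_apply, ← zpow_one_add] at h1
      refine r.trans ih (r.symm ?_)
      convert h1 using 3
      ring

theorem cycleSetoid_apply {E : Type} (π : Perm E) (x : E) : cycleSetoid π x (π x) :=
  cycleSetoid_le_iff.1 le_rfl x

theorem cycleSetoid_one {E : Type} : cycleSetoid (1 : Perm E) = ⊥ :=
  le_bot_iff.1 (cycleSetoid_le_iff.2 fun x => (⊥ : Setoid E).refl x)

theorem cycleSetoid_inv {E : Type} (π : Perm E) : cycleSetoid π⁻¹ = cycleSetoid π := by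
  ext x y
  exact Perm.sameCycle_inv

theorem cycleSetoid_mul_le {E : Type} (g h : Perm E) :
    cycleSetoid (g * h) ≤ cycleSetoid g ⊔ cycleSetoid h := by
  rw [cycleSetoid_le_iff]
  intro x
  exact Setoid.trans' _ ((le_sup_right : cycleSetoid h ≤ _) (cycleSetoid_apply h x))
    ((le_sup_left : cycleSetoid g ≤ _) (cycleSetoid_apply g (h x)))

theorem orb_le_iff {E : Type} {L : List (Perm E)} {r : Setoid E} :
    orb L ≤ r ↔ ∀ s ∈ L, ∀ x, r x (s x) := by
  induction L with
  | nil => simp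
  | cons s L ih => simp [ih, cycleSetoid_le_iff]

theorem cycleSetoid_prod_le {E : Type} (L : List (Perm E)) :
    cycleSetoid L.prod ≤ orb L := by
  induction L with
  | nil => simp [cycleSetoid_one]
  | cons s L ih =>
    rw [List.prod_cons, orb_cons]
    exact (cycleSetoid_mul_le _ _).trans (sup_le_sup_left ih _)

theorem orbitRel_closure {E : Type} (L : List (Perm E)) :
    MulAction.orbitRel (Subgroup.closure {s | s ∈ L}) E = orb L := by
  apply le_antisymm
  · rintro x y ⟨⟨g, hg⟩, rfl⟩
    change orb L (g y) y
    suffices h : ∀ y : E, orb L (g y) y from h y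
    clear y
    induction hg using Subgroup.closure_induction with
    | mem s hs => exact fun y => (orb L).symm (orb_le_iff.1 le_rfl s hs y)
    | one => exact fun y => (orb L).refl _
    | mul a b _ _ ha hb => exact fun y => (orb L).trans (ha (b y)) (hb y)
    | inv a _ ha =>
      intro y
      have := ha (a⁻¹ y)
      rw [← Perm.mul_apply, mul_inv_cancel, Perm.one_apply] at this
      exact (orb L).symm this
  · rw [orb_le_iff]
    intro s hs x
    refine Setoid.symm' _ ⟨⟨s, Subgroup.subset_closure hs⟩, rfl⟩

theorem isPretransitive_closure_iff {E : Type} (L : List (Perm E)) :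
    MulAction.IsPretransitive (Subgroup.closure {s | s ∈ L}) E ↔ orb L = ⊤ := by
  rw [← orbitRel_closure, Setoid.eq_top_iff, MulAction.isPretransitive_iff]
  exact ⟨fun h x y => h y x, fun h x y => h y x⟩

theorem classCount_bot (E : Type) : classCount (⊥ : Setoid E) = Nat.card E :=
  Nat.card_congr
    ⟨fun q => Quotient.lift id (fun _ _ h => h) q, Quotient.mk _, fun q => by
      induction q using Quotient.ind; rfl, fun _ => rfl⟩

theorem classCount_top (E : Type) [Nonempty E] : classCount (⊤ : Setoid E) = 1 := by
  rw [classCount, Nat.card_eq_one_iff_unique]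
  refine ⟨⟨fun a b => ?_⟩, ⟨Quotient.mk _ (Classical.arbitrary E)⟩⟩
  induction a using Quotient.ind
  induction b using Quotient.ind
  exact Quotient.sound trivial

theorem eq_top_of_classCount_eq_one {E : Type} {r : Setoid E} (h : classCount r = 1) : r = ⊤ := by
  rw [classCount, Nat.card_eq_one_iff_unique] at h
  obtain ⟨_, _⟩ := h
  rw [Setoid.eq_top_iff]
  intro x y
  exact Quotient.exact (Subsingleton.elim _ _)

theorem classCount_pos {E : Type} [Finite E] [Nonempty E] (r : Setoid E) : 1 ≤ classCount r := by
  have : Nonempty (Quotient r) := ⟨Quotient.mk _ (Classical.arbitrary E)⟩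
  exact Nat.card_pos

theorem numCycles_eq {E : Type} (π : Perm E) : numCycles π = classCount (cycleSetoid π) := rfl

theorem numCycles_inv {E : Type} (π : Perm E) : numCycles π⁻¹ = numCycles π := by
  rw [numCycles_eq, numCycles_eq, cycleSetoid_inv]

theorem numCycles_le {E : Type} [Finite E] (π : Perm E) : numCycles π ≤ Nat.card E :=
  Nat.card_le_card_of_surjective _ Quotient.mk_surjective

theorem sup_cycleSetoid_swap_of_rel {E : Type} [DecidableEq E] {r : Setoid E} {a b : E} (h : r a b) :
    r ⊔ cycleSetoid (swap a b) = r := by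
  refine sup_eq_left.2 (cycleSetoid_le_iff.2 fun x => ?_)
  rw [swap_apply_def]
  split_ifs with h1 h2
  · exact h1 ▸ h
  · exact h2 ▸ r.symm h
  · exact r.refl x

theorem sup_swap_mul {E : Type} [DecidableEq E] (π : Perm E) (a b : E) :
    cycleSetoid (swap a b * π) ⊔ cycleSetoid (swap a b) =
      cycleSetoid π ⊔ cycleSetoid (swap a b) := by
  have key : ∀ ρ : Perm E, cycleSetoid (swap a b * ρ) ⊔ cycleSetoid (swap a b) ≤
      cycleSetoid ρ ⊔ cycleSetoid (swap a b) := fun ρ =>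
    sup_le ((cycleSetoid_mul_le _ _).trans (by rw [sup_comm])) le_sup_right
  apply le_antisymm (key π)
  simpa [← mul_assoc] using key (swap a b * π)

section Finite

variable {E : Type} [Fintype E] [DecidableEq E]

/-- Merging two distinct classes of a partition lowers the number of classes by one. -/
theorem classCount_sup_swap {r : Setoid E} {a b : E} (h : ¬ r a b) :
    classCount (r ⊔ cycleSetoid (swap a b)) + 1 = classCount r := by
  classical
  let g : Quotient r → Quotient r := fun q => if q = ⟦b⟧ then ⟦a⟧ else q
  have hab : (⟦a⟧ : Quotient r) ≠ ⟦b⟧ := fun e => h (Quotient.exact e)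
  have hker : r ⊔ cycleSetoid (swap a b) = Setoid.ker fun x => g ⟦x⟧ := by
    set s := r ⊔ cycleSetoid (swap a b) with hs
    have hr : r ≤ s := le_sup_left
    have hsab : s a b := by
      have := (le_sup_right : cycleSetoid (swap a b) ≤ s) (cycleSetoid_apply (swap a b) a)
      rwa [swap_apply_left] at this
    apply le_antisymm
    · refine sup_le (fun x y hxy => ?_) (cycleSetoid_le_iff.2 fun x => ?_)
      · rw [Setoid.ker_def, Quotient.sound hxy]
      · rw [Setoid.ker_def]
        by_cases hxa : x = a
        · simp [hxa, g]
        by_cases hxb : x = b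
        · simp [hxb, g]
        rw [swap_apply_of_ne_of_ne hxa hxb]
    · intro x y hxy
      rw [Setoid.ker_def] at hxy
      have key : ∀ x, ∃ x', s x x' ∧ g ⟦x⟧ = ⟦x'⟧ := by
        intro x
        by_cases hx : (⟦x⟧ : Quotient r) = ⟦b⟧
        · exact ⟨a, s.trans (hr (Quotient.exact hx)) (s.symm hsab), by simp [g, hx]⟩
        · exact ⟨x, s.refl _, by simp [g, hx]⟩
      obtain ⟨x', hx1, hx2⟩ := key x
      obtain ⟨y', hy1, hy2⟩ := key y
      rw [hx2, hy2] at hxy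
      exact s.trans hx1 (s.trans (hr (Quotient.exact hxy)) (s.symm hy1))
  have hrange : Set.range (fun x => g ⟦x⟧) = {⟦b⟧}ᶜ := by
    ext q
    constructor
    · rintro ⟨x, rfl⟩
      by_cases hx : (⟦x⟧ : Quotient r) = ⟦b⟧ <;> simp [g, hx, hab]
    · intro hq
      induction q using Quotient.ind with
      | _ x => exact ⟨x, if_neg hq⟩
  rw [hker, classCount, Nat.card_congr (Setoid.quotientKerEquivRange _), hrange, classCount]
  have h1 := Set.ncard_add_ncard_compl ({⟦b⟧} : Set (Quotient r))
  rw [Set.ncard_singleton, ← Nat.card_coe_set_eq] at h1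
  omega

/-- Multiplying by a transposition of points on two different cycles joins these cycles. -/
theorem sameCycle_swap_mul {π : Perm E} {a b : E} (h : ¬ π.SameCycle a b) :
    (swap a b * π).SameCycle a b := by
  by_contra hb
  set ρ := swap a b * π with hρ
  have hπ : ∀ x, π x = swap a b (ρ x) := fun x => by simp [hρ]
  have key : ∀ m : ℕ, π.SameCycle a ((ρ ^ m) a) := by
    intro m
    induction m with
    | zero => exact Perm.SameCycle.refl _ _
    | succ m ih =>
      rw [pow_succ', Perm.mul_apply]
      set x := (ρ ^ m) a with hx
      have h1 : ρ x ≠ b := fun e => hb ⟨m + 1, by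
        rw [← e, hx, ← Perm.mul_apply, ← pow_succ']; rfl⟩
      have h2 : π.SameCycle a (π x) := Perm.sameCycle_apply_right.2 ih
      by_cases h3 : ρ x = a
      · rw [h3]
      · rwa [hπ, swap_apply_of_ne_of_ne h3 h1] at h2
  obtain ⟨m, hm⟩ : ∃ m : ℕ, (ρ ^ m) a = ρ⁻¹ a := by
    have : ρ.SameCycle a (ρ⁻¹ a) := ⟨-1, by simp⟩
    obtain ⟨m, -, hm⟩ := this.exists_pow_eq'
    exact ⟨m, hm⟩
  have h1 := Perm.sameCycle_apply_right.2 (key m)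
  rw [hm, hπ, ← Perm.mul_apply ρ, mul_inv_cancel, Perm.one_apply, swap_apply_left] at h1
  exact h h1

theorem cycleSetoid_swap_mul {π : Perm E} {a b : E} (h : ¬ π.SameCycle a b) :
    cycleSetoid (swap a b * π) = cycleSetoid π ⊔ cycleSetoid (swap a b) := by
  rw [← sup_swap_mul, sup_cycleSetoid_swap_of_rel (sameCycle_swap_mul h)]

theorem numCycles_swap_mul {π : Perm E} {a b : E} (h : ¬ π.SameCycle a b) :
    numCycles (swap a b * π) + 1 = numCycles π := by
  rw [numCycles_eq, cycleSetoid_swap_mul h, classCount_sup_swap (r := cycleSetoid π) h, numCycles_eq]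

theorem numCycles_swap_mul_le (π : Perm E) (a b : E) :
    numCycles (swap a b * π) ≤ numCycles π + 1 := by
  by_cases h : π.SameCycle a b
  · by_cases h' : (swap a b * π).SameCycle a b
    · have h1 := sup_swap_mul π a b
      rw [sup_cycleSetoid_swap_of_rel (r := cycleSetoid π) h,
        sup_cycleSetoid_swap_of_rel (r := cycleSetoid (swap a b * π)) h'] at h1
      rw [numCycles_eq, h1, numCycles_eq]
      omega
    · have := numCycles_swap_mul h'
      rw [← mul_assoc, swap_mul_self, one_mul] at this
      omega
  · have := numCycles_swap_mul h
    omega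

/-- One step of the Riemann–Hurwitz inequality: multiplying by a permutation `x` raises
`numCycles - 2 * classCount` by at most the number of transpositions needed for `x`. -/
theorem numCycles_mul_le (x π : Perm E) (r : Setoid E) (hr : cycleSetoid π ≤ r) :
    numCycles (x * π) + 2 * classCount r + numCycles x ≤
      numCycles π + 2 * classCount (r ⊔ cycleSetoid x) + Nat.card E := by
  induction hn : x.support.card using Nat.strong_induction_on generalizing x with
  | _ N ih =>
    by_cases hx : x = 1
    · subst hx
      rw [one_mul, cycleSetoid_one, sup_bot_eq]
      have := numCycles_le (1 : Perm E)
      omega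
    obtain ⟨a, ha⟩ : ∃ a, x a ≠ a := by
      by_contra! h
      exact hx (Perm.ext h)
    -- Split off a transposition that detaches `a` from its cycle in `x`.
    set y := swap a (x a) * x with hy
    have hxy : x = swap a (x a) * y := by rw [hy, ← mul_assoc, swap_mul_self, one_mul]
    have hcard : y.support.card < N := hn ▸ Perm.card_support_swap_mul ha
    have hya : y a = a := by simp [hy]
    have hns : ¬ y.SameCycle a (x a) := fun h => ha (h.eq_of_left hya).symm
    have h1 := ih _ hcard y rfl
    have h2 := numCycles_swap_mul hns
    have h3 := cycleSetoid_swap_mul hns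
    rw [← hxy] at h2 h3
    rw [h3, ← sup_assoc, show x * π = swap a (x a) * (y * π) by rw [← mul_assoc, ← hxy]]
    set s := r ⊔ cycleSetoid y with hs
    -- A transposition inside a class of `s` changes the number of cycles by at most one; one between
    -- two classes merges two cycles and two classes.
    by_cases hrel : s a (x a)
    · rw [sup_cycleSetoid_swap_of_rel hrel]
      have := numCycles_swap_mul_le (y * π) a (x a)
      omega
    · have h4 := classCount_sup_swap hrel
      have h5 : ¬ (y * π).SameCycle a (x a) := fun h => hrel
        (((cycleSetoid_mul_le y π).trans (sup_le le_sup_right (hr.trans le_sup_left)) :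
          cycleSetoid (y * π) ≤ s) h)
      have := numCycles_swap_mul h5
      omega

/-- The Riemann–Hurwitz inequality for a list of permutations, not necessarily generating a
transitive group. -/
theorem riemann_hurwitz (L : List (Perm E)) :
    Nat.card E + numCycles L.prod + (L.map numCycles).sum ≤
      L.length * Nat.card E + 2 * classCount (orb L) := by
  induction L with
  | nil =>
    simp only [List.prod_nil, List.map_nil, List.sum_nil, orb_nil, List.length_nil,
      numCycles_eq, cycleSetoid_one, classCount_bot]
    omega
  | cons x L ih =>
    have h := numCycles_mul_le x L.prod (orb L) (cycleSetoid_prod_le L)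
    rw [sup_comm] at h
    simp only [List.prod_cons, List.map_cons, List.sum_cons, orb_cons, List.length_cons]
    rw [add_mul, one_mul]
    omega

end Finite

/-! ### Cycles as finite sets, and first returns -/

/-- Polynomials over `ℚ` in `p₁, p₂, …`. -/
abbrev PolyP : Type := MvPolynomial ℕ ℚ

section Cycles

variable {E : Type} [Fintype E]

open scoped Classical in
/-- The cycle of `π` through `x`, as a finite set of points. -/
noncomputable def cycleClass (π : Perm E) (x : E) : Finset E :=
  Finset.univ.filter fun y => π.SameCycle x y

open scoped Classical in
/-- The cycles of `π`, fixed points included, as finite sets of points. -/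
noncomputable def cycleSets (π : Perm E) : Finset (Finset E) :=
  Finset.univ.image (cycleClass π)

theorem mem_cycleClass {π : Perm E} {x y : E} : y ∈ cycleClass π x ↔ π.SameCycle x y := by
  simp [cycleClass]

theorem self_mem_cycleClass (π : Perm E) (x : E) : x ∈ cycleClass π x :=
  mem_cycleClass.2 (Perm.SameCycle.refl _ _)

theorem cycleClass_eq_iff {π : Perm E} {x y : E} :
    cycleClass π x = cycleClass π y ↔ π.SameCycle x y := by
  constructor
  · intro h
    rw [← mem_cycleClass, h]
    exact self_mem_cycleClass _ _
  · intro h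
    ext z
    rw [mem_cycleClass, mem_cycleClass]
    exact ⟨fun h' => h.symm.trans h', fun h' => h.trans h'⟩

theorem mem_cycleSets {π : Perm E} {C : Finset E} :
    C ∈ cycleSets π ↔ ∃ x, cycleClass π x = C := by
  simp [cycleSets]

theorem cycleClass_mem (π : Perm E) (x : E) : cycleClass π x ∈ cycleSets π :=
  mem_cycleSets.2 ⟨x, rfl⟩

theorem eq_cycleClass {π : Perm E} {C : Finset E} (hC : C ∈ cycleSets π) {x : E} (hx : x ∈ C) :
    C = cycleClass π x := by
  obtain ⟨y, rfl⟩ := mem_cycleSets.1 hC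
  exact cycleClass_eq_iff.2 (mem_cycleClass.1 hx)

theorem nonempty_of_mem_cycleSets {π : Perm E} {C : Finset E} (hC : C ∈ cycleSets π) :
    C.Nonempty := by
  obtain ⟨y, rfl⟩ := mem_cycleSets.1 hC
  exact ⟨y, self_mem_cycleClass _ _⟩

theorem card_cycleSets (π : Perm E) : (cycleSets π).card = numCycles π := by
  classical
  have h : cycleSetoid π = Setoid.ker (cycleClass π) := by
    ext x y
    rw [Setoid.ker_def, cycleClass_eq_iff]
    rfl
  rw [numCycles_eq, h, classCount, Nat.card_congr (Setoid.quotientKerEquivRange _),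
    Nat.card_coe_set_eq, ← Set.ncard_coe_finset]
  congr 1
  ext C
  simp [mem_cycleSets]

/-- The multiset of cycle lengths is the multiset of parts of the associated partition. -/
theorem map_card_cycleSets [DecidableEq E] (π : Perm E) :
    (cycleSets π).val.map Finset.card = π.partition.parts := by
  classical
  have h1 : cycleSets π =
      π.cycleFactorsFinset.image Perm.support ∪ (π.supportᶜ).image (fun x => {x}) := by
    ext C
    simp only [mem_cycleSets, Finset.mem_union, Finset.mem_image, Finset.mem_compl]
    constructor
    · rintro ⟨x, rfl⟩
      by_cases hx : x ∈ π.support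
      · refine Or.inl ⟨π.cycleOf x, Perm.cycleOf_mem_cycleFactorsFinset_iff.2 hx, ?_⟩
        ext y
        rw [mem_cycleClass, Perm.mem_support_cycleOf_iff, and_iff_left hx]
      · refine Or.inr ⟨x, hx, ?_⟩
        ext y
        rw [mem_cycleClass, Finset.mem_singleton]
        constructor
        · rintro rfl
          exact Perm.SameCycle.refl _ _
        · exact fun h => (h.eq_of_left (Perm.notMem_support.1 hx)).symm
    · rintro (⟨c, hc, rfl⟩ | ⟨x, hx, rfl⟩)
      · obtain ⟨x, hx⟩ := Perm.IsCycle.nonempty_support (Perm.mem_cycleFactorsFinset_iff.1 hc).1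
        refine ⟨x, ?_⟩
        have hc' := Perm.cycle_is_cycleOf hx hc
        have hxs : x ∈ π.support := Perm.mem_cycleFactorsFinset_support_le hc hx
        ext y
        rw [mem_cycleClass, hc', Perm.mem_support_cycleOf_iff, and_iff_left hxs]
      · refine ⟨x, ?_⟩
        ext y
        rw [mem_cycleClass, Finset.mem_singleton]
        constructor
        · exact fun h => (h.eq_of_left (Perm.notMem_support.1 hx)).symm
        · rintro rfl
          exact Perm.SameCycle.refl _ _
  have hdisj : Disjoint (π.cycleFactorsFinset.image Perm.support)
      ((π.supportᶜ).image (fun x => ({x} : Finset E))) := by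
    rw [Finset.disjoint_left]
    intro C h2 h3
    obtain ⟨c, hc, rfl⟩ := Finset.mem_image.1 h2
    obtain ⟨x, -, hx⟩ := Finset.mem_image.1 h3
    have := (Perm.mem_cycleFactorsFinset_iff.1 hc).1.two_le_card_support
    rw [← hx] at this
    simp at this
  rw [h1, ← Finset.disjUnion_eq_union _ _ hdisj, Finset.disjUnion_val, Multiset.map_add,
    Perm.parts_partition, Perm.cycleType_def]
  congr 1
  · rw [Finset.image_val_of_injOn, Multiset.map_map]
    intro c hc d hd hcd
    obtain ⟨x, hx⟩ := Perm.IsCycle.nonempty_support (Perm.mem_cycleFactorsFinset_iff.1 hc).1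
    rw [Perm.cycle_is_cycleOf hx hc]
    exact (Perm.cycle_is_cycleOf (hcd ▸ hx : x ∈ d.support) hd).symm
  · rw [Finset.image_val_of_injOn (fun x _ y _ h => Finset.singleton_injective h),
      Multiset.map_map]
    simp only [Function.comp_def, Finset.card_singleton, Multiset.map_const']
    rw [← Finset.card_def, Finset.card_compl]

theorem card_parts_partition [DecidableEq E] (π : Perm E) :
    π.partition.parts.card = numCycles π := by
  rw [← map_card_cycleSets, Multiset.card_map, ← card_cycleSets, Finset.card_def]

theorem numCycles_of_isCycle [DecidableEq E] {π : Perm E} (h : π.IsCycle) :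
    numCycles π + π.support.card = Nat.card E + 1 := by
  rw [← card_parts_partition, Perm.parts_partition, h.cycleType, Nat.card_eq_fintype_card]
  have := π.support.card_le_univ
  simp
  omega

/-- The product of `p_j` over the lengths `j` of all cycles. -/
noncomputable def cycleWeight (π : Perm E) : PolyP :=
  ∏ C ∈ cycleSets π, MvPolynomial.X C.card

open scoped Classical in
/-- The product of `p_j` over the lengths `j` of the cycles that avoid the set `S`. -/
noncomputable def restWeight (π : Perm E) (S : Finset E) : PolyP :=
  ∏ C ∈ (cycleSets π).filter (fun C => Disjoint C S), MvPolynomial.X C.card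

theorem mem_cycleSets_mul {π σ : Perm E} {S : Finset E} (hσ : ∀ x ∉ S, σ x = x) {C : Finset E}
    (hC : C ∈ cycleSets π) (hCS : Disjoint C S) : C ∈ cycleSets (σ * π) := by
  obtain ⟨x, rfl⟩ := mem_cycleSets.1 hC
  have key : ∀ m : ℕ, ((σ * π) ^ m) x = (π ^ m) x := by
    intro m
    induction m with
    | zero => rfl
    | succ m ih =>
      rw [pow_succ', pow_succ', Perm.mul_apply, Perm.mul_apply, Perm.mul_apply, ih]
      refine hσ _ (Finset.disjoint_left.1 hCS (mem_cycleClass.2 ?_))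
      rw [Perm.sameCycle_apply_right]
      exact ⟨m, rfl⟩
  refine mem_cycleSets.2 ⟨x, ?_⟩
  ext y
  rw [mem_cycleClass, mem_cycleClass]
  constructor
  · intro h
    obtain ⟨m, hm⟩ := h.exists_nat_pow_eq
    exact ⟨m, by rw [← hm, key]; rfl⟩
  · intro h
    obtain ⟨m, hm⟩ := h.exists_nat_pow_eq
    exact ⟨m, by rw [← hm, ← key]; rfl⟩

open scoped Classical in
theorem filter_cycleSets_mul {π σ : Perm E} {S : Finset E} (hσ : ∀ x ∉ S, σ x = x) :
    (cycleSets (σ * π)).filter (fun C => Disjoint C S) =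
      (cycleSets π).filter (fun C => Disjoint C S) := by
  have hσ' : ∀ x ∉ S, σ⁻¹ x = x := fun x hx => by
    rw [Perm.inv_eq_iff_eq, hσ x hx]
  ext C
  simp only [Finset.mem_filter]
  constructor
  · rintro ⟨h1, h2⟩
    refine ⟨?_, h2⟩
    have := mem_cycleSets_mul hσ' h1 h2
    rwa [inv_mul_cancel_left] at this
  · rintro ⟨h1, h2⟩
    exact ⟨mem_cycleSets_mul hσ h1 h2, h2⟩

end Cycles

/-- `r` is the first-return permutation of `π` on the points marked by `ι`, and the marked point
`ι e` returns after `i e` steps. -/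
structure FirstReturn {k : ℕ} {E : Type} (π : Perm E) (ι : Fin k ↪ E) (r : Perm (Fin k))
    (i : Fin k → ℕ+) : Prop where
  pow_apply : ∀ e, (π ^ (i e : ℕ)) (ι e) = ι (r e)
  not_mem : ∀ e m, 0 < m → m < (i e : ℕ) → (π ^ m) (ι e) ∉ Set.range ι

namespace FirstReturn

variable {k : ℕ} {E : Type} {π : Perm E} {ι : Fin k ↪ E} {r : Perm (Fin k)} {i : Fin k → ℕ+}

theorem pow_sub_apply {x y : E} {m m' : ℕ} (hm : m ≤ m') (h : (π ^ m) x = (π ^ m') y) :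
    x = (π ^ (m' - m)) y := by
  apply (π ^ m).injective
  rw [h, ← Perm.mul_apply, ← pow_add, Nat.add_sub_cancel' hm]

theorem tower_injective (h : FirstReturn π ι r i) {e e' : Fin k} {m m' : ℕ} (hm : m < i e)
    (hm' : m' < i e') (heq : (π ^ m) (ι e) = (π ^ m') (ι e')) : e = e' ∧ m = m' := by
  wlog hle : m ≤ m' generalizing e e' m m'
  · obtain ⟨h1, h2⟩ := this hm' hm heq.symm (by omega)
    exact ⟨h1.symm, h2.symm⟩
  have h1 := pow_sub_apply hle heq
  rcases Nat.eq_zero_or_pos (m' - m) with h2 | h2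
  · rw [h2] at h1
    exact ⟨ι.injective h1, by omega⟩
  · exact absurd ⟨e, h1⟩ (h.not_mem e' (m' - m) h2 (by omega))

theorem sameCycle_map (h : FirstReturn π ι r i) {e e' : Fin k} (he : r.SameCycle e e') :
    π.SameCycle (ι e) (ι e') := by
  have : cycleSetoid r ≤ Setoid.comap ι (cycleSetoid π) := cycleSetoid_le_iff.2 fun x =>
    ⟨(i x : ℕ), h.pow_apply x⟩
  exact this he

theorem exists_tower [Finite E] (h : FirstReturn π ι r i) {e : Fin k} {x : E}
    (hx : π.SameCycle (ι e) x) : ∃ e', r.SameCycle e e' ∧ ∃ m < (i e' : ℕ), x = (π ^ m) (ι e') := by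
  obtain ⟨N, rfl⟩ := hx.exists_nat_pow_eq
  clear hx
  induction N with
  | zero => exact ⟨e, Perm.SameCycle.refl _ _, 0, (i e).pos, rfl⟩
  | succ N ih =>
    obtain ⟨e', he', m, hm, hN⟩ := ih
    rw [pow_succ', Perm.mul_apply, hN, ← Perm.mul_apply, ← pow_succ']
    rcases Nat.lt_or_ge (m + 1) (i e') with h1 | h1
    · exact ⟨e', he', m + 1, h1, rfl⟩
    · refine ⟨r e', Perm.sameCycle_apply_right.2 he', 0, (i _).pos, ?_⟩
      rw [show m + 1 = i e' by omega, h.pow_apply]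
      rfl

theorem sameCycle_iff [Finite E] (h : FirstReturn π ι r i) {e e' : Fin k} :
    π.SameCycle (ι e) (ι e') ↔ r.SameCycle e e' := by
  refine ⟨fun he => ?_, h.sameCycle_map⟩
  obtain ⟨e'', h1, m, hm, h2⟩ := h.exists_tower he
  obtain ⟨rfl, -⟩ := h.tower_injective (m := 0) (i e').pos hm h2
  exact h1

open scoped Classical in
theorem card_cycleClass [Fintype E] (h : FirstReturn π ι r i) (e : Fin k) :
    (cycleClass π (ι e)).card = ∑ e' with r.SameCycle e e', (i e' : ℕ) := by
  have h1 : cycleClass π (ι e) =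
      ((Finset.univ.filter (fun e' => r.SameCycle e e')).sigma
        (fun e' => Finset.range (i e'))).image (fun q => (π ^ q.2) (ι q.1)) := by
    ext x
    simp only [mem_cycleClass, Finset.mem_image, Finset.mem_sigma, Finset.mem_filter,
      Finset.mem_univ, true_and, Finset.mem_range, Sigma.exists]
    constructor
    · intro hx
      obtain ⟨e', h1, m, hm, h2⟩ := h.exists_tower hx
      exact ⟨e', m, ⟨h1, hm⟩, h2.symm⟩
    · rintro ⟨e', m, ⟨h1, hm⟩, rfl⟩
      exact (h.sameCycle_map h1).trans ⟨m, rfl⟩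
  rw [h1, Finset.card_image_of_injOn, Finset.card_sigma]
  · simp
  · rintro ⟨e1, m1⟩ h1 ⟨e2, m2⟩ h2 heq
    simp only [Finset.coe_sigma, Set.mem_sigma_iff, Finset.coe_range, Set.mem_Iio] at h1 h2
    obtain ⟨rfl, rfl⟩ := h.tower_injective h1.2 h2.2 heq
    rfl

theorem card_cycleClass_eq_omega [Fintype E] (h : FirstReturn π ι r i) (e : Fin k) :
    (cycleClass π (ι e)).card = omega i (⟦e⟧ : Cycles r) := by
  classical
  rw [h.card_cycleClass, omega]
  refine Finset.sum_congr ?_ fun _ _ => rfl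
  ext e'
  simp only [Finset.mem_filter, Finset.mem_univ, true_and]
  rw [Quotient.eq]
  exact ⟨fun h => h.symm, fun h => h.symm⟩

theorem exists_firstReturn [Finite E] (π : Perm E) (ι : Fin k ↪ E) :
    ∃ r i, FirstReturn π ι r i := by
  classical
  have hex : ∀ e, ∃ m : ℕ, 0 < m ∧ (π ^ m) (ι e) ∈ Set.range ι := fun e =>
    ⟨orderOf π, orderOf_pos π, by rw [pow_orderOf_eq_one]; exact ⟨e, rfl⟩⟩
  let i : Fin k → ℕ+ := fun e => ⟨Nat.find (hex e), (Nat.find_spec (hex e)).1⟩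
  have hi : ∀ e, ∃ e', (π ^ (i e : ℕ)) (ι e) = ι e' := fun e => by
    obtain ⟨e', he'⟩ := (Nat.find_spec (hex e)).2
    exact ⟨e', he'.symm⟩
  choose r hr using hi
  have hnot : ∀ e m, 0 < m → m < (i e : ℕ) → (π ^ m) (ι e) ∉ Set.range ι :=
    fun e m h1 h2 h3 => Nat.find_min (hex e) h2 ⟨h1, h3⟩
  have hinj : Function.Injective r := by
    intro e e' he
    wlog hle : (i e : ℕ) ≤ i e' generalizing e e'
    · exact (this he.symm (by omega)).symm
    have h1 := pow_sub_apply hle ((hr e).trans ((congrArg ι he).trans (hr e').symm))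
    rcases Nat.eq_zero_or_pos ((i e' : ℕ) - i e) with h2 | h2
    · rw [h2] at h1
      exact ι.injective h1
    · exact absurd ⟨e, h1⟩ (hnot e' _ h2 (Nat.sub_lt (i e').pos (i e).pos))
  exact ⟨Equiv.ofBijective r (Finite.injective_iff_bijective.1 hinj), i, hr, hnot⟩

theorem unique {r' : Perm (Fin k)} {i' : Fin k → ℕ+} (h : FirstReturn π ι r i)
    (h' : FirstReturn π ι r' i') : r = r' ∧ i = i' := by
  have key : ∀ {r r' : Perm (Fin k)} {i i' : Fin k → ℕ+}, FirstReturn π ι r i →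
      FirstReturn π ι r' i' → ∀ e, (i e : ℕ) ≤ i' e := by
    intro r r' i i' h h' e
    by_contra! hlt
    exact h.not_mem e _ (i' e).pos hlt ⟨r' e, (h'.pow_apply e).symm⟩
  have hi : i = i' := funext fun e => PNat.eq (le_antisymm (key h h' e) (key h' h e))
  subst hi
  exact ⟨Perm.ext fun e => ι.injective (by rw [← h.pow_apply, h'.pow_apply]), rfl⟩

section Fintype

variable [Fintype E]

open scoped Classical in
theorem filter_not_disjoint (h : FirstReturn π ι r i) :
    (cycleSets π).filter (fun C => ¬ Disjoint C (Finset.univ.map ι)) =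
      Finset.univ.image (fun v : Cycles r => cycleClass π (ι v.out)) := by
  ext C
  simp only [Finset.mem_filter, Finset.mem_image, Finset.mem_univ, true_and]
  constructor
  · rintro ⟨hC, hd⟩
    rw [Finset.not_disjoint_iff] at hd
    obtain ⟨x, hx, hx'⟩ := hd
    obtain ⟨e, -, rfl⟩ := Finset.mem_map.1 hx'
    refine ⟨⟦e⟧, ?_⟩
    rw [eq_cycleClass hC hx, cycleClass_eq_iff, h.sameCycle_iff]
    exact Quotient.mk_out (s := cycleSetoid r) e
  · rintro ⟨v, rfl⟩
    refine ⟨cycleClass_mem _ _, Finset.not_disjoint_iff.2 ⟨_, self_mem_cycleClass _ _, by simp⟩⟩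

theorem cycleClass_out_injective (h : FirstReturn π ι r i) :
    Function.Injective (fun v : Cycles r => cycleClass π (ι v.out)) := by
  intro v v' hv
  rw [cycleClass_eq_iff, h.sameCycle_iff] at hv
  rw [← Quotient.out_eq v, ← Quotient.out_eq v']
  exact Quotient.sound hv

theorem cycleWeight_eq (h : FirstReturn π ι r i) :
    cycleWeight π = (∏ v : Cycles r, MvPolynomial.X (omega i v)) *
      restWeight π (Finset.univ.map ι) := by
  classical
  rw [cycleWeight, restWeight,
    ← Finset.prod_filter_mul_prod_filter_not _ (fun C => Disjoint C (Finset.univ.map ι)), mul_comm,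
    h.filter_not_disjoint, Finset.prod_image h.cycleClass_out_injective.injOn]
  congr 1
  refine Finset.prod_congr rfl fun v _ => ?_
  rw [h.card_cycleClass_eq_omega, Quotient.out_eq]

open scoped Classical in
theorem numCycles_eq_add (h : FirstReturn π ι r i) :
    numCycles π = numCycles r +
      ((cycleSets π).filter (fun C => Disjoint C (Finset.univ.map ι))).card := by
  rw [← card_cycleSets π,
    ← Finset.card_filter_add_card_filter_not (fun C => Disjoint C (Finset.univ.map ι)), add_comm,
    h.filter_not_disjoint, Finset.card_image_of_injective _ h.cycleClass_out_injective,
    Finset.card_univ, numCycles, Nat.card_eq_fintype_card]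

end Fintype

variable [DecidableEq E]

/-- Composing with a permutation of the marked points composes the first-return permutation and
keeps the return times. -/
theorem viaFintypeEmbedding_mul (h : FirstReturn π ι r i) (c : Perm (Fin k)) :
    FirstReturn (c.viaFintypeEmbedding ι * π) ι (c * r) i := by
  have key : ∀ e m, m < (i e : ℕ) →
      ((c.viaFintypeEmbedding ι * π) ^ m) (ι e) = (π ^ m) (ι e) := by
    intro e m hm
    induction m with
    | zero => rfl
    | succ m ih =>
      rw [pow_succ', Perm.mul_apply, ih (by omega), Perm.mul_apply, ← Perm.mul_apply π, ← pow_succ']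
      exact Perm.viaFintypeEmbedding_apply_notMem_range _ _ (h.not_mem e _ (by omega) hm)
  constructor
  · intro e
    obtain ⟨m, hm⟩ : ∃ m, (i e : ℕ) = m + 1 := Nat.exists_eq_succ_of_ne_zero (i e).ne_zero
    have h1 := h.pow_apply e
    rw [hm] at h1 ⊢
    rw [pow_succ', Perm.mul_apply, key e m (by omega), Perm.mul_apply, ← Perm.mul_apply π,
      ← pow_succ', h1, Perm.viaFintypeEmbedding_apply_image, Perm.mul_apply]
  · intro e m h1 h2
    rw [key e m h2]
    exact h.not_mem e m h1 h2

theorem viaFintypeEmbedding_apply_of_notMem (c : Perm (Fin k)) (ι : Fin k ↪ E) :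
    ∀ x ∉ (Finset.univ.map ι : Finset E), c.viaFintypeEmbedding ι x = x := fun x hx =>
  Perm.viaFintypeEmbedding_apply_notMem_range _ _ fun ⟨e, he⟩ => hx (by simp [← he])

variable [Fintype E]

theorem numCycles_mul (h : FirstReturn π ι r i) (c : Perm (Fin k)) :
    numCycles (c.viaFintypeEmbedding ι * π) + numCycles r = numCycles π + numCycles (c * r) := by
  classical
  rw [h.numCycles_eq_add, (h.viaFintypeEmbedding_mul c).numCycles_eq_add,
    filter_cycleSets_mul (viaFintypeEmbedding_apply_of_notMem c ι)]
  omega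

theorem cycleWeight_mul (h : FirstReturn π ι r i) (c : Perm (Fin k)) :
    cycleWeight (c.viaFintypeEmbedding ι * π) =
      (∏ v : Cycles (c * r), MvPolynomial.X (omega i v)) *
        restWeight π (Finset.univ.map ι) := by
  classical
  rw [(h.viaFintypeEmbedding_mul c).cycleWeight_eq, restWeight,
    filter_cycleSets_mul (viaFintypeEmbedding_apply_of_notMem c ι), restWeight]

end FirstReturn

/-! ### Existence of planar factorisations -/

/-- `s` is a `k`-cycle. -/
def IsKCycle (k : ℕ) {E : Type} [Fintype E] [DecidableEq E] (s : Perm E) : Prop :=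
  s.IsCycle ∧ s.support.card = k

/-- `σ` permutes the points of `S` in a single cycle and fixes all other points. -/
def CyclicOn {E : Type} (σ : Perm E) (S : Finset E) : Prop :=
  (∀ x ∉ S, σ x = x) ∧ ∀ u ∈ S, ∀ v ∈ S, σ.SameCycle u v

theorem CyclicOn.inv {E : Type} {σ : Perm E} {S : Finset E} (h : CyclicOn σ S) :
    CyclicOn σ⁻¹ S :=
  ⟨fun x hx => by rw [Perm.inv_eq_iff_eq, h.1 x hx],
    fun u hu v hv => Perm.sameCycle_inv.2 (h.2 u hu v hv)⟩

section

variable {E : Type} [Fintype E] [DecidableEq E]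

theorem CyclicOn.isKCycle {σ : Perm E} {S : Finset E} (h : CyclicOn σ S) (hS : 2 ≤ S.card) :
    IsKCycle S.card σ := by
  have hne : ∀ x ∈ S, σ x ≠ x := by
    intro x hx hfix
    obtain ⟨y, hy, hyx⟩ := Finset.exists_mem_ne (by omega : 1 < S.card) x
    exact hyx ((h.2 x hx y hy).eq_of_left hfix).symm
  have hsupp : σ.support = S := by
    ext x
    rw [Perm.mem_support]
    exact ⟨fun hx => by_contra fun hxS => hx (h.1 x hxS), hne x⟩
  obtain ⟨x, hx⟩ := Finset.card_pos.1 (by omega : 0 < S.card)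
  refine ⟨⟨x, hne x hx, fun y hy => h.2 x hx y ?_⟩, by rw [hsupp]⟩
  rw [← hsupp, Perm.mem_support]
  exact hy

theorem CyclicOn.swap_mul {σ : Perm E} {S : Finset E} (h : CyclicOn σ S) {x y : E} (hx : x ∉ S)
    (hy : y ∈ S) : CyclicOn (swap x y * σ) (insert x S) := by
  have hns : ¬ σ.SameCycle x y := fun hs => hx (by
    rw [hs.eq_of_left (h.1 x hx)]
    exact hy)
  have hc := cycleSetoid_swap_mul hns
  have h1 : cycleSetoid σ ≤ cycleSetoid (swap x y * σ) := hc ▸ le_sup_left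
  have h2 := sameCycle_swap_mul hns
  refine ⟨fun z hz => ?_, ?_⟩
  · rw [Finset.mem_insert, not_or] at hz
    rw [Perm.mul_apply, h.1 z hz.2, swap_apply_of_ne_of_ne hz.1]
    rintro rfl
    exact hz.2 hy
  · have key : ∀ u ∈ insert x S, (swap x y * σ).SameCycle u y := by
      intro u hu
      rcases Finset.mem_insert.1 hu with rfl | hu
      · exact h2
      · exact h1 (h.2 u hu y hy)
    exact fun u hu v hv => (key u hu).trans (key v hv).symm

theorem isKCycle_viaFintypeEmbedding {k m : ℕ} {c : Perm (Fin m)} (h : IsKCycle k c)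
    (ι : Fin m ↪ E) : IsKCycle k (c.viaFintypeEmbedding ι) := by
  refine ⟨h.1.extendDomain _, ?_⟩
  rw [← h.2]
  exact Perm.card_support_extend_domain _

theorem isKCycle_inv {k : ℕ} {s : Perm E} (h : IsKCycle k s) : IsKCycle k s⁻¹ :=
  ⟨h.1.inv, by rw [Perm.support_inv, h.2]⟩

omit [Fintype E] in
/-- Removing the point before `y` from its cycle. -/
theorem sameCycle_swap_mul_of_apply_eq {π : Perm E} {x y : E} (hxy : π x = y)
    {z w : E} (hz : z ≠ x) (hw : w ≠ x) (h : π.SameCycle z w) :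
    (swap x y * π).SameCycle z w := by
  let g : E → E := fun z => if z = x then y else z
  have key : cycleSetoid π ≤ Setoid.comap g (cycleSetoid (swap x y * π)) := by
    refine cycleSetoid_le_iff.2 fun z => ?_
    change (swap x y * π).SameCycle (g z) (g (π z))
    by_cases hzx : z = x
    · subst hzx
      have h1 : g (π z) = y := by
        simp only [g, hxy]
        split_ifs <;> rfl
      have h2 : g z = y := by simp [g]
      rw [h1, h2]
    · have h1 : g z = z := by simp [g, hzx]
      have h2 : g (π z) = (swap x y * π) z := by
        rw [Perm.mul_apply, swap_apply_def]
        simp only [g]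
        split_ifs with h3 h4
        · rfl
        · exact absurd (π.injective (h4.trans hxy.symm)) hzx
        · rfl
      rw [h1, h2]
      exact cycleSetoid_apply _ _
  have := key h
  change (swap x y * π).SameCycle (g z) (g w) at this
  simpa [g, hz, hw] using this

/-- A permutation of `D` with transversal `X` of its cycles is the product of two cycles, of any
prescribed lengths `a` and `b` allowed by counting, whose supports meet in `X`. -/
theorem exists_mul_cyclicOn (π : Perm E) (D X : Finset E) (a b : ℕ) (hπ : ∀ x ∉ D, π x = x)
    (hX : X ⊆ D) (hex : ∀ x ∈ D, ∃ y ∈ X, π.SameCycle x y)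
    (huniq : ∀ y ∈ X, ∀ y' ∈ X, π.SameCycle y y' → y = y') (ha : X.card ≤ a) (hb : X.card ≤ b)
    (hab : a + b = D.card + X.card) :
    ∃ S T : Finset E, ∃ σ ζ : Perm E, S.card = a ∧ T.card = b ∧ S ∩ T = X ∧ S ∪ T = D ∧
      CyclicOn σ S ∧ CyclicOn ζ T ∧ σ * ζ = π := by
  induction hN : D.card generalizing π D a b with
  | zero =>
    have hD : D = ∅ := Finset.card_eq_zero.1 hN
    subst hD
    have hX' : X = ∅ := Finset.subset_empty.1 hX
    subst hX'
    simp only [Finset.card_empty] at hab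
    exact ⟨∅, ∅, 1, 1, by simp; omega, by simp; omega, by simp, by simp,
      ⟨by simp, by simp⟩, ⟨by simp, by simp⟩, Perm.ext fun x => by simp [hπ x]⟩
  | succ N ih =>
    -- If `X = D`, then `π = 1` and a full cycle on `D` times its inverse will do.
    by_cases hDX : D ⊆ X
    · have hDX := hDX.antisymm hX
      subst hDX
      obtain ⟨σ, hσ, hσ'⟩ := D.exists_cycleOn
      have hπ1 : π = 1 := by
        ext x
        by_cases hx : x ∈ D
        · by_contra hne
          have hx' : π x ∈ D := by
            by_contra hx'
            exact hx' (by rwa [π.injective (hπ _ hx')])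
          exact hne (huniq x hx _ hx' (cycleSetoid_apply π x)).symm
        · exact hπ x hx
      have hcyc : CyclicOn σ D :=
        ⟨fun x hx => by_contra fun hne => hx (hσ' (Perm.mem_support.2 hne)),
          fun u hu v hv => hσ.2 hu hv⟩
      exact ⟨D, D, σ, σ⁻¹, by omega, by omega, by simp, by simp, hcyc, hcyc.inv, by simp [hπ1]⟩
    · obtain ⟨x₀, hx₀D, hx₀X⟩ := Finset.not_subset.1 hDX
      obtain ⟨y, hyX, hxy⟩ := hex x₀ hx₀D
      have hlt : X.card < D.card := Finset.card_lt_card ⟨hX, hDX⟩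
      -- The case `X.card < a`; the other case follows by passing to the inverse permutation.
      have main : ∀ (π : Perm E) (a b : ℕ), (∀ x ∉ D, π x = x) →
          (∀ x ∈ D, ∃ y ∈ X, π.SameCycle x y) →
          (∀ y ∈ X, ∀ y' ∈ X, π.SameCycle y y' → y = y') → π.SameCycle x₀ y →
          X.card < a → X.card ≤ b → a + b = D.card + X.card →
          ∃ S T : Finset E, ∃ σ ζ : Perm E, S.card = a ∧ T.card = b ∧ S ∩ T = X ∧ S ∪ T = D ∧
            CyclicOn σ S ∧ CyclicOn ζ T ∧ σ * ζ = π := by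
        intro π a b hπ hex huniq hxy ha hb hab
        -- Delete the point `x` preceding `y` from its cycle, and insert it before `y` in the first
        -- factor.
        set x := π⁻¹ y with hx
        have hxy' : π x = y := by simp [hx]
        have hsame : π.SameCycle x y := hxy' ▸ cycleSetoid_apply π x
        have hne : x ≠ y := by
          intro h
          rw [h] at hxy'
          exact hx₀X (by rwa [hxy.eq_of_right hxy'])
        have hxX : x ∉ X := fun h => hne (huniq x h y hyX hsame)
        have hxD : x ∈ D := by
          by_contra h
          have := hπ x h
          rw [hxy'] at this
          exact hne this.symm
        have hyD := hX hyX
        have h1x : (swap x y * π) x = x := by simp [hxy']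
        have hns : ¬ (swap x y * π).SameCycle x y := fun h => hne (h.eq_of_left h1x)
        have hc := cycleSetoid_swap_mul hns
        rw [← mul_assoc, swap_mul_self, one_mul] at hc
        have hle : cycleSetoid (swap x y * π) ≤ cycleSetoid π := hc ▸ le_sup_left
        have hcard := Finset.card_erase_of_mem hxD
        have i1 : ∀ z ∉ D.erase x, (swap x y * π) z = z := by
          intro z hz
          by_cases hzx : z = x
          · rw [hzx, h1x]
          · have hzD : z ∉ D := fun h => hz (Finset.mem_erase.2 ⟨hzx, h⟩)
            rw [Perm.mul_apply, hπ z hzD, swap_apply_of_ne_of_ne hzx]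
            rintro rfl
            exact hzD hyD
        have i2 : X ⊆ D.erase x :=
          fun z hz => Finset.mem_erase.2 ⟨fun h => hxX (h ▸ hz), hX hz⟩
        have i3 : ∀ z ∈ D.erase x, ∃ y' ∈ X, (swap x y * π).SameCycle z y' := by
          intro z hz
          obtain ⟨hzx, hzD⟩ := Finset.mem_erase.1 hz
          obtain ⟨y', hy', hzy'⟩ := hex z hzD
          exact ⟨y', hy', sameCycle_swap_mul_of_apply_eq hxy' hzx (fun h => hxX (h ▸ hy')) hzy'⟩
        obtain ⟨S, T, σ, ζ, hS, hT, hST, hST', hσ, hζ, hmul⟩ := ih (swap x y * π) (D.erase x)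
          (a - 1) b i1 i2 i3 (fun y₁ h₁ y₂ h₂ h => huniq y₁ h₁ y₂ h₂ (hle h)) (by omega) hb
          (by omega) (by omega)
        have hyS : y ∈ S := (Finset.mem_inter.1 (hST ▸ hyX : y ∈ S ∩ T)).1
        have hxS : x ∉ S := fun h => by
          have := Finset.mem_union_left T h
          rw [hST'] at this
          simp at this
        have hxT : x ∉ T := fun h => by
          have := Finset.mem_union_right S h
          rw [hST'] at this
          simp at this
        refine ⟨insert x S, T, swap x y * σ, ζ, ?_, hT, ?_, ?_, hσ.swap_mul hxS hyS, hζ, ?_⟩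
        · rw [Finset.card_insert_of_notMem hxS, hS]
          omega
        · rw [Finset.insert_inter_of_notMem hxT, hST]
        · rw [Finset.insert_union, hST', Finset.insert_erase hxD]
        · rw [mul_assoc, hmul, ← mul_assoc, swap_mul_self, one_mul]
      by_cases hXa : X.card < a
      · exact main π a b hπ hex huniq hxy hXa hb (by omega)
      · obtain ⟨T, S, ζ, σ, hT, hS, h1, h2, hζ, hσ, hmul⟩ := main π⁻¹ b a
          (fun x hx => by rw [Perm.inv_eq_iff_eq, hπ x hx])
          (fun x hx => by simpa only [Perm.sameCycle_inv] using hex x hx)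
          (by simpa only [Perm.sameCycle_inv] using huniq) (Perm.sameCycle_inv.2 hxy)
          (by omega) ha (by omega)
        refine ⟨S, T, σ⁻¹, ζ⁻¹, hS, hT, by rw [Finset.inter_comm, h1],
          by rw [Finset.union_comm, h2], hσ.inv, hζ.inv, ?_⟩
        rw [← mul_inv_rev, hmul, inv_inv]

/-- A cycle on `1 + q (k - 1)` points is a product of `q` cycles of length `k`: split off one
`k`-cycle at a time, each sharing one point with the rest. -/
theorem exists_list_of_cyclicOn {k : ℕ} (hk : 2 ≤ k) (q : ℕ) (D : Finset E) (ζ : Perm E)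
    (hζ : CyclicOn ζ D) (hD : D.card = 1 + q * (k - 1)) :
    ∃ L : List (Perm E), L.length = q ∧ (∀ s ∈ L, IsKCycle k s) ∧ L.prod = ζ ∧
      ∀ u ∈ D, ∀ v ∈ D, orb L u v := by
  induction q generalizing D ζ with
  | zero =>
    obtain ⟨x, rfl⟩ := Finset.card_eq_one.1 (by simpa using hD)
    refine ⟨[], rfl, by simp, ?_, ?_⟩
    · refine (Perm.ext fun y => ?_ : ζ = 1).symm
      by_cases hy : y = x
      · subst hy
        by_contra hne
        exact hne (ζ.injective (hζ.1 (ζ y) (by simpa using hne)))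
      · exact hζ.1 y (by simpa using hy)
    · intro u hu v hv
      rw [Finset.mem_singleton] at hu hv
      rw [hu, hv]
  | succ q ih =>
    rw [add_mul, one_mul] at hD
    obtain ⟨x, hx⟩ := Finset.card_pos.1 (by omega : 0 < D.card)
    obtain ⟨S, T, σ, ζ', hS, hT, hST, hST', hσ, hζ', hmul⟩ :=
      exists_mul_cyclicOn ζ D {x} k (1 + q * (k - 1)) hζ.1 (by simpa using hx)
        (fun y hy => ⟨x, by simp, hζ.2 y hy x hx⟩) (by simp) (by simp; omega) (by simp)
        (by simp; omega)
    obtain ⟨L, hL1, hL2, hL3, hL4⟩ := ih T ζ' hζ' hT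
    have hxST := Finset.mem_inter.1 (hST ▸ Finset.mem_singleton_self x : x ∈ S ∩ T)
    refine ⟨σ :: L, by simp [hL1], ?_, by simp [hL3, hmul], ?_⟩
    · intro s hs
      rcases List.mem_cons.1 hs with rfl | hs
      · exact hS ▸ hσ.isKCycle (by omega)
      · exact hL2 s hs
    · have key : ∀ u ∈ D, orb (σ :: L) u x := by
        intro u hu
        rw [← hST', Finset.mem_union] at hu
        rcases hu with hu | hu
        · exact (le_sup_left : cycleSetoid σ ≤ orb (σ :: L)) (hσ.2 u hu x hxST.1)
        · exact (le_sup_right : orb L ≤ orb (σ :: L)) (hL4 u hu x hxST.2)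
      exact fun u hu v hv => Setoid.trans' _ (key u hu) (Setoid.symm' _ (key v hv))

omit [Fintype E] [DecidableEq E] in
theorem cycleSetoid_out_eq {π : Perm E} {v v' : Cycles π} (h : π.SameCycle v.out v'.out) :
    v = v' := by
  rw [← Quotient.out_eq v, ← Quotient.out_eq v']
  exact Quotient.sound h

/-- Whenever the Riemann–Hurwitz count allows it, a permutation of at least `k` points has a
transitive factorisation of genus zero into `k`-cycles. -/
theorem exists_planar_factorisation {k : ℕ} (hk : 2 ≤ k) (hE : k ≤ Nat.card E) (μ : ℕ)
    (π : Perm E) (hμ : (k - 1) * μ + 2 = Nat.card E + numCycles π) :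
    ∃ L : List (Perm E), L.length = μ ∧ (∀ s ∈ L, IsKCycle k s) ∧ L.prod = π ∧ orb L = ⊤ := by
  classical
  have : Nonempty E := (Nat.card_pos_iff.1 (by omega : 0 < Nat.card E)).1
  induction μ generalizing π with
  | zero =>
    have := classCount_pos (cycleSetoid π)
    rw [numCycles_eq] at hμ
    omega
  | succ μ ih =>
    rw [mul_add, mul_one] at hμ
    have hcard : Fintype.card (Cycles π) = numCycles π := by
      rw [numCycles, Nat.card_eq_fintype_card]
    rcases Nat.lt_or_ge k (numCycles π) with hl | hl
    · -- Merge `k` of the cycles into one.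
      obtain ⟨j⟩ : Nonempty (Fin k ↪ Cycles π) :=
        Function.Embedding.nonempty_of_card_le (by simp [hcard]; omega)
      let ι : Fin k ↪ E := ⟨fun e => (j e).out, fun e e' h => j.injective (by
        rw [← Quotient.out_eq (j e), ← Quotient.out_eq (j e')]
        exact congrArg _ h)⟩
      obtain ⟨r, i, h⟩ := FirstReturn.exists_firstReturn π ι
      have hr : r = 1 := by
        ext e
        have h1 : π.SameCycle (ι e) (ι (r e)) := h.sameCycle_iff.2 (cycleSetoid_apply r e)
        have h2 := j.injective (cycleSetoid_out_eq h1)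
        rw [Perm.one_apply, ← h2]
      obtain ⟨m, rfl⟩ : ∃ m, k = m + 2 := ⟨k - 2, by omega⟩
      have hc : IsKCycle (m + 2) (finRotate (m + 2)) :=
        ⟨isCycle_finRotate, by rw [support_finRotate]; simp⟩
      have h1 := numCycles_of_isCycle hc.1
      rw [hc.2, Nat.card_fin] at h1
      have h2 := h.numCycles_mul (finRotate (m + 2))
      have h3 : numCycles (1 : Perm (Fin (m + 2))) = m + 2 := by
        rw [numCycles_eq, cycleSetoid_one, classCount_bot, Nat.card_fin]
      rw [hr, mul_one, h3] at h2
      obtain ⟨L, hL1, hL2, hL3, hL4⟩ := ih _ (by omega :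
        (m + 2 - 1) * μ + 2 = Nat.card E +
          numCycles ((finRotate (m + 2)).viaFintypeEmbedding ι * π))
      refine ⟨((finRotate (m + 2)).viaFintypeEmbedding ι)⁻¹ :: L, by simp [hL1], ?_,
        by rw [List.prod_cons, hL3, inv_mul_cancel_left], by rw [orb_cons, hL4, sup_top_eq]⟩
      intro s hs
      rcases List.mem_cons.1 hs with rfl | hs
      · exact isKCycle_inv (isKCycle_viaFintypeEmbedding hc ι)
      · exact hL2 s hs
    · -- At most `k` cycles: split off a `k`-cycle that meets each of them, leaving a single cycle
      -- of the right length.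
      let X : Finset E := Finset.univ.image fun v : Cycles π => v.out
      have hXc : X.card = numCycles π := by
        rw [Finset.card_image_of_injective _ (fun v v' h => cycleSetoid_out_eq (by rw [h])),
          Finset.card_univ, hcard]
      have hout : ∀ x, π.SameCycle x (⟦x⟧ : Cycles π).out := fun x =>
        (Quotient.mk_out (s := cycleSetoid π) x).symm
      obtain ⟨S, T, σ, ζ, hS, hT, hST, hST', hσ, hζ, hmul⟩ :=
        exists_mul_cyclicOn π Finset.univ X k (1 + μ * (k - 1)) (by simp) (by simp)
          (fun x _ => ⟨(⟦x⟧ : Cycles π).out, by simp [X], hout x⟩)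
          (by
            intro y hy y' hy' h
            obtain ⟨v, -, rfl⟩ := Finset.mem_image.1 hy
            obtain ⟨v', -, rfl⟩ := Finset.mem_image.1 hy'
            rw [cycleSetoid_out_eq h])
          (by omega) (by rw [mul_comm μ]; omega)
          (by rw [Finset.card_univ, ← Nat.card_eq_fintype_card, mul_comm μ]; omega)
      obtain ⟨L, hL1, hL2, hL3, hL4⟩ := exists_list_of_cyclicOn hk μ T ζ hζ hT
      obtain ⟨x, hx⟩ : X.Nonempty := by
        rw [← Finset.card_pos, hXc]
        exact classCount_pos (cycleSetoid π)
      have hxST := Finset.mem_inter.1 (hST ▸ hx : x ∈ S ∩ T)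
      refine ⟨σ :: L, by simp [hL1], ?_, by simp [hL3, hmul], ?_⟩
      · intro s hs
        rcases List.mem_cons.1 hs with rfl | hs
        · exact hS ▸ hσ.isKCycle (by omega)
        · exact hL2 s hs
      · have key : ∀ u, orb (σ :: L) u x := by
          intro u
          have hu : u ∈ S ∪ T := hST' ▸ Finset.mem_univ u
          rcases Finset.mem_union.1 hu with hu | hu
          · exact (le_sup_left : cycleSetoid σ ≤ orb (σ :: L)) (hσ.2 u hu x hxST.1)
          · exact (le_sup_right : orb L ≤ orb (σ :: L)) (hL4 u hu x hxST.2)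
        rw [Setoid.eq_top_iff]
        exact fun u v => Setoid.trans' _ (key u) (Setoid.symm' _ (key v))

end

/-! ### The series as a sum over planar factorisations -/

section

variable {E : Type} [Fintype E] [DecidableEq E]

/-- The type of `k`-cycles. -/
abbrev KCycle (k : ℕ) (E : Type) [Fintype E] [DecidableEq E] : Type :=
  {s : Perm E // IsKCycle k s}

noncomputable instance (k : ℕ) (E : Type) [Fintype E] [DecidableEq E] : Fintype (KCycle k E) :=
  Fintype.ofFinite _

/-- A list of `k`-cycles is planar if it generates a transitive group and the covering that it
encodes has genus zero. -/
def IsPlanar (k : ℕ) {E : Type} (L : List (Perm E)) : Prop :=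
  orb L = ⊤ ∧ (k - 1) * L.length + 2 = Nat.card E + numCycles L.prod

theorem riemann_hurwitz_kCycles {k : ℕ} (hk : 2 ≤ k) {L : List (Perm E)}
    (hL : ∀ s ∈ L, IsKCycle k s) :
    Nat.card E + numCycles L.prod ≤ (k - 1) * L.length + 2 * classCount (orb L) := by
  have h := riemann_hurwitz L
  have h2 : (L.map numCycles).sum + (k - 1) * L.length = L.length * Nat.card E := by
    clear h
    induction L with
    | nil => simp
    | cons s L ih =>
      have h1 := numCycles_of_isCycle (hL s (by simp)).1
      rw [(hL s (by simp)).2] at h1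
      have h3 := ih fun t ht => hL t (by simp [ht])
      rw [List.map_cons, List.sum_cons, List.length_cons, mul_add, add_mul]
      omega
  omega

theorem isTransFactorisation_iff {k n : ℕ} {π : Perm (Fin n)} {σ : List (Perm (Fin n))} :
    IsTransFactorisation k π σ ↔ (∀ s ∈ σ, IsKCycle k s) ∧ σ.prod = π ∧ orb σ = ⊤ :=
  ⟨fun h => ⟨h.1, h.2, (isPretransitive_closure_iff σ).1 h.3⟩,
    fun h => ⟨h.1, h.2.1, (isPretransitive_closure_iff σ).2 h.2.2⟩⟩

/-- If the Riemann–Hurwitz count is solvable, then the minimal transitive factorisations are those of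
genus zero. -/
theorem isMinTransFactorisation_iff {k n j : ℕ} (hk : 2 ≤ k) (hn : 1 ≤ n) {π : Perm (Fin n)}
    (hj : (k - 1) * j + 2 = n + numCycles π) {σ : List (Perm (Fin n))} :
    IsMinTransFactorisation k π σ ↔ IsTransFactorisation k π σ ∧ σ.length = j := by
  have : Nonempty (Fin n) := ⟨⟨0, hn⟩⟩
  have hge : ∀ τ, IsTransFactorisation k π τ → j ≤ τ.length := by
    intro τ hτ
    rw [isTransFactorisation_iff] at hτ
    have h := riemann_hurwitz_kCycles hk hτ.1
    rw [hτ.2.1, hτ.2.2, classCount_top, Nat.card_fin] at h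
    have : (k - 1) * j ≤ (k - 1) * τ.length := by omega
    exact Nat.le_of_mul_le_mul_left this (by omega)
  constructor
  · rintro ⟨h1, h2⟩
    refine ⟨h1, le_antisymm ?_ (hge σ h1)⟩
    have h1' := isTransFactorisation_iff.1 h1
    rcases σ with _ | ⟨s, σ⟩
    · simp
    · -- The existence of any factor at all shows that there are at least `k` points.
      have hkn : k ≤ Nat.card (Fin n) := by
        rw [← (h1'.1 s (by simp)).2, Nat.card_eq_fintype_card]
        exact Finset.card_le_univ _
      obtain ⟨L, hL1, hL2, hL3, hL4⟩ := exists_planar_factorisation hk hkn j π (by simpa using hj)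
      exact hL1 ▸ h2 L (isTransFactorisation_iff.2 ⟨hL2, hL3, hL4⟩)
  · rintro ⟨h1, h2⟩
    exact ⟨h1, fun τ hτ => h2 ▸ hge τ hτ⟩

/-- The list of permutations underlying a word in `k`-cycles. -/
def word {k j : ℕ} (L : Fin j → KCycle k E) : List (Perm E) := List.ofFn fun a => (L a).1

theorem isKCycle_of_mem_word {k j : ℕ} {L : Fin j → KCycle k E} {s : Perm E} (hs : s ∈ word L) :
    IsKCycle k s := by
  obtain ⟨a, rfl⟩ := List.mem_ofFn.1 hs
  exact (L a).2

theorem length_word {k j : ℕ} (L : Fin j → KCycle k E) : (word L).length = j := by simp [word]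

theorem orb_map_conj {E E' : Type} (g : E ≃ E') (L : List (Perm E)) :
    orb (L.map g.permCongr) = ⊤ ↔ orb L = ⊤ := by
  have key : ∀ {E E' : Type} (g : E ≃ E') (L : List (Perm E)), orb L = ⊤ →
      orb (L.map g.permCongr) = ⊤ := by
    intro E E' g L h
    have h1 : orb L ≤ Setoid.comap g (orb (L.map g.permCongr)) := by
      rw [orb_le_iff]
      intro s hs x
      have := orb_le_iff.1 (le_refl (orb (L.map g.permCongr))) (g.permCongr s)
        (List.mem_map_of_mem hs) (g x)
      rw [Setoid.comap_rel]
      simpa [Equiv.permCongr_apply] using this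
    rw [Setoid.eq_top_iff]
    intro x y
    have := h1 (Setoid.eq_top_iff.1 h (g.symm x) (g.symm y))
    rw [Setoid.comap_rel] at this
    simpa using this
  refine ⟨fun h => ?_, key g L⟩
  have h2 := key g.symm _ h
  rw [List.map_map] at h2
  convert h2
  conv_lhs => rw [← List.map_id L]
  congr 1
  ext s x
  simp

theorem prod_map_permCongr {E E' : Type} (g : E ≃ E') (L : List (Perm E)) :
    (L.map g.permCongr).prod = g.permCongr L.prod :=
  (map_list_prod g.permCongrHom L).symm

theorem isKCycle_permCongr {E' : Type} [Fintype E'] [DecidableEq E'] (g : E ≃ E') {k : ℕ}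
    {s : Perm E} : IsKCycle k (g.permCongr s) ↔ IsKCycle k s := by
  have key : ∀ {E E' : Type} [Fintype E] [DecidableEq E] [Fintype E'] [DecidableEq E'] (g : E ≃ E')
      {s : Perm E}, IsKCycle k s → IsKCycle k (g.permCongr s) := by
    intro E E' _ _ _ _ g s hs
    have h1 : g.permCongr s = s.extendDomain (p := fun _ => True)
        (g.trans (Equiv.Set.univ E').symm) := by
      ext x
      rw [Perm.extendDomain_apply_subtype _ _ trivial]
      rfl
    rw [h1]
    exact ⟨hs.1.extendDomain _, by rw [Perm.card_support_extend_domain, hs.2]⟩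
  refine ⟨fun h => ?_, key g⟩
  have := key g.symm h
  convert this
  ext x
  simp

open scoped Classical in
/-- The number of planar factorisations of `π` into `j` `k`-cycles. -/
noncomputable def planarCount (k j : ℕ) (π : Perm E) : ℕ :=
  (Finset.univ.filter fun L : Fin j → KCycle k E => IsPlanar k (word L) ∧ (word L).prod = π).card

theorem planarCount_eq_zero {k j : ℕ} {π : Perm E}
    (h : (k - 1) * j + 2 ≠ Nat.card E + numCycles π) : planarCount k j π = 0 := by
  classical
  rw [planarCount, Finset.card_eq_zero, Finset.filter_eq_empty_iff]
  rintro L - ⟨h1, h2⟩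
  apply h
  rw [← h2, ← h1.2, length_word]

theorem planarCount_eq_ncard {k j : ℕ} {π : Perm E}
    (hj : (k - 1) * j + 2 = Nat.card E + numCycles π) :
    planarCount k j π = Set.ncard {σ : List (Perm E) |
      ((∀ s ∈ σ, IsKCycle k s) ∧ σ.prod = π ∧ orb σ = ⊤) ∧ σ.length = j} := by
  classical
  rw [planarCount, ← Set.ncard_coe_finset]
  refine Set.ncard_congr (fun L _ => word L) ?_ ?_ ?_
  · intro L hL
    simp only [Finset.coe_filter, Finset.mem_univ, true_and, Set.mem_ofPred_eq] at hL
    exact ⟨⟨fun s hs => isKCycle_of_mem_word hs, hL.2, hL.1.1⟩, length_word L⟩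
  · intro L L' _ _ h
    have := List.ofFn_injective h
    funext a
    exact Subtype.ext (congrFun this a)
  · rintro σ ⟨⟨h1, h2, h3⟩, rfl⟩
    refine ⟨fun a => ⟨σ.get a, h1 _ (List.get_mem _ _)⟩, ?_, ?_⟩
    · simp only [Finset.coe_filter, Finset.mem_univ, true_and, Set.mem_ofPred_eq]
      have : word (fun a => (⟨σ.get a, h1 _ (List.get_mem _ _)⟩ : KCycle k E)) = σ :=
        List.ofFn_get σ
      rw [this]
      exact ⟨⟨h3, by rw [hj, h2]⟩, h2⟩
    · exact List.ofFn_get σ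

theorem mem_conjClass {n : ℕ} {α : n.Partition} {π : Perm (Fin n)} :
    π ∈ conjClass α ↔ π.partition.parts = α.parts := by
  simp [conjClass]

theorem fixedPerm_mem {n : ℕ} (α : n.Partition) : fixedPerm α ∈ conjClass α :=
  (conjClass_nonempty α).choose_spec

/-- `c_k(α)` may be counted at any permutation of the class, since conjugation preserves planarity. -/
theorem c_eq_planarCount {k n j : ℕ} (hk : 2 ≤ k) (hn : 1 ≤ n) {α : n.Partition}
    (hj : (k - 1) * j + 2 = n + α.parts.card) {π : Perm (Fin n)} (hπ : π ∈ conjClass α) :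
    c k α = planarCount k j π := by
  have h0 := mem_conjClass.1 (fixedPerm_mem α)
  have h1 := mem_conjClass.1 hπ
  have hconj : IsConj (fixedPerm α) π :=
    Perm.partition_eq_of_isConj.2 (Nat.Partition.ext (h0.trans h1.symm))
  obtain ⟨g, hg⟩ := isConj_iff.1 hconj
  have hg' : ∀ s : Perm (Fin n), Equiv.permCongr g s = g * s * g⁻¹ := fun s => rfl
  have hc0 : numCycles (fixedPerm α) = α.parts.card := by rw [← card_parts_partition, h0]
  have hc1 : numCycles π = α.parts.card := by rw [← card_parts_partition, h1]
  rw [planarCount_eq_ncard (by rw [Nat.card_fin, hc1, hj]), c]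
  have hset : {σ | IsMinTransFactorisation k (fixedPerm α) σ} = {σ : List (Perm (Fin n)) |
      ((∀ s ∈ σ, IsKCycle k s) ∧ σ.prod = fixedPerm α ∧ orb σ = ⊤) ∧ σ.length = j} := by
    ext σ
    rw [Set.mem_ofPred_eq, isMinTransFactorisation_iff hk hn (by rw [hc0, hj]),
      isTransFactorisation_iff]
    rfl
  rw [hset]
  refine Set.ncard_congr (fun σ _ => σ.map (Equiv.permCongr g)) ?_ ?_ ?_
  · rintro σ ⟨⟨h2, h3, h4⟩, h5⟩
    refine ⟨⟨?_, ?_, (orb_map_conj g σ).2 h4⟩, by simp [h5]⟩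
    · intro s hs
      obtain ⟨t, ht, rfl⟩ := List.mem_map.1 hs
      exact (isKCycle_permCongr g).2 (h2 t ht)
    · rw [prod_map_permCongr, h3, hg', hg]
  · intro σ σ' _ _ h
    exact List.map_injective_iff.2 (Equiv.injective _) h
  · rintro σ ⟨⟨h2, h3, h4⟩, h5⟩
    have hσ : (σ.map (Equiv.permCongr g).symm).map (Equiv.permCongr g) = σ := by
      rw [List.map_map, Equiv.self_comp_symm, List.map_id]
    refine ⟨σ.map (Equiv.permCongr g).symm, ⟨⟨?_, ?_, ?_⟩, by simp [h5]⟩, hσ⟩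
    · intro s hs
      obtain ⟨t, ht, rfl⟩ := List.mem_map.1 hs
      rw [← isKCycle_permCongr (E := Fin n) g, Equiv.apply_symm_apply]
      exact h2 t ht
    · apply (Equiv.permCongr g).injective
      rw [← prod_map_permCongr, hσ, h3, hg', hg]
    · rw [← orb_map_conj g, hσ, h4]

open scoped Classical in
/-- The planar factorisations with `j` factors on the ground set `E`, weighted by the cycle type
of the product. -/
noncomputable def planarSum (k : ℕ) (E : Type) [Fintype E] [DecidableEq E] (j : ℕ) : PolyP :=
  ∑ L : Fin j → KCycle k E, if IsPlanar k (word L) then cycleWeight (word L).prod else 0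

theorem planarSum_eq (k j : ℕ) :
    planarSum k E j = ∑ π : Perm E, (planarCount k j π : PolyP) * cycleWeight π := by
  classical
  rw [planarSum, ← Finset.sum_fiberwise (s := Finset.univ)
    (g := fun L : Fin j → KCycle k E => (word L).prod)]
  refine Finset.sum_congr rfl fun π _ => ?_
  rw [planarCount, ← nsmul_eq_mul, ← Finset.sum_const, Finset.sum_filter, Finset.sum_filter]
  refine Finset.sum_congr rfl fun L _ => ?_
  by_cases h1 : (word L).prod = π
  · simp [h1]
  · simp [h1]

end

/-- The partition of `n` into the cycle lengths of a permutation. -/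
def cyclePartition {n : ℕ} (π : Perm (Fin n)) : n.Partition where
  parts := π.partition.parts
  parts_pos := π.partition.parts_pos
  parts_sum := by rw [π.partition.parts_sum, Fintype.card_fin]

theorem conjClass_eq {n : ℕ} (α : n.Partition) :
    conjClass α = Finset.univ.filter fun π => cyclePartition π = α := by
  ext π
  rw [mem_conjClass, Finset.mem_filter, Nat.Partition.ext_iff]
  simp [cyclePartition]

/-- The product `p_α`, as a polynomial in the `p_j` alone. -/
noncomputable def partWeight {n : ℕ} (α : n.Partition) : PolyP :=
  (α.parts.map fun j => (MvPolynomial.X j : PolyP)).prod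

theorem cycleWeight_eq_partWeight {n : ℕ} {α : n.Partition} {π : Perm (Fin n)}
    (hπ : π ∈ conjClass α) : cycleWeight π = partWeight α := by
  rw [partWeight, ← mem_conjClass.1 hπ, ← map_card_cycleSets, Multiset.map_map]
  rfl

theorem planarSum_fin (k j n : ℕ) (hk : 2 ≤ k) :
    planarSum k (Fin n) j = ∑ α : n.Partition,
      if (k - 1) * j + 2 = n + α.parts.card then
        ((c k α * (conjClass α).card : ℕ) : PolyP) * partWeight α else 0 := by
  classical
  rw [planarSum_eq, ← Finset.sum_fiberwise (s := Finset.univ)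
    (g := fun π : Perm (Fin n) => cyclePartition π)]
  refine Finset.sum_congr rfl fun α _ => ?_
  rw [← conjClass_eq]
  have hcyc : ∀ π ∈ conjClass α, numCycles π = α.parts.card := fun π hπ => by
    rw [← card_parts_partition, mem_conjClass.1 hπ]
  split_ifs with h
  · have hn : 1 ≤ n := by
      by_contra hn
      have h2 : α.parts.card • 1 ≤ α.parts.sum :=
        Multiset.card_nsmul_le_sum fun a ha => α.parts_pos ha
      rw [α.parts_sum, smul_eq_mul] at h2
      omega
    rw [mul_comm (c k α), Nat.cast_mul, mul_assoc, ← nsmul_eq_mul, ← Finset.sum_const]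
    refine Finset.sum_congr rfl fun π hπ => ?_
    rw [c_eq_planarCount hk hn h hπ, cycleWeight_eq_partWeight hπ]
  · refine Finset.sum_eq_zero fun π hπ => ?_
    rw [planarCount_eq_zero, Nat.cast_zero, zero_mul]
    rwa [Nat.card_fin, hcyc π hπ]

/-- Polynomials in `u, p₁, p₂, …` viewed as power series in `u` over the polynomials in
`p₁, p₂, …`. -/
noncomputable def toUSeries : Coeffs →ₐ[ℚ] PowerSeries PolyP :=
  MvPolynomial.aeval fun x => match x with
    | Var.u => PowerSeries.X
    | Var.p j => PowerSeries.C (MvPolynomial.X j)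

@[simp] theorem toUSeries_u : toUSeries (MvPolynomial.X Var.u) = PowerSeries.X := by
  simp [toUSeries]

@[simp] theorem toUSeries_p (j : ℕ) :
    toUSeries (MvPolynomial.X (Var.p j)) = PowerSeries.C (MvPolynomial.X j) := by
  simp [toUSeries]

theorem toUSeries_pProd {n : ℕ} (α : n.Partition) :
    toUSeries (pProd α) = PowerSeries.C (partWeight α) := by
  rw [pProd, partWeight, map_multiset_prod, map_multiset_prod, Multiset.map_map, Multiset.map_map]
  simp

theorem coeff_Phi (k n : ℕ) :
    PowerSeries.coeff n (Phi k) = ∑ α : n.Partition,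
      if 1 ≤ n ∧ (k - 1) ∣ (n + α.parts.card - 2) then
        MvPolynomial.C
            (((c k α : ℚ) * ((conjClass α).card : ℚ)) /
              (((mu k α).factorial : ℚ) * (n.factorial : ℚ))) *
          pProd α * MvPolynomial.X Var.u ^ mu k α
      else 0 := by
  rw [Phi, PowerSeries.coeff_mk]
  rcases Nat.eq_zero_or_pos n with rfl | hn
  · simp
  have hcard : ∀ α : n.Partition, α.parts.card ∈ Finset.Icc 1 n := by
    intro α
    have h2 : α.parts.card • 1 ≤ α.parts.sum :=
      Multiset.card_nsmul_le_sum fun a ha => α.parts_pos ha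
    rw [α.parts_sum, smul_eq_mul, mul_one] at h2
    refine Finset.mem_Icc.2 ⟨Multiset.card_pos.2 fun h => ?_, h2⟩
    have h3 := α.parts_sum
    rw [h, Multiset.sum_zero] at h3
    omega
  rw [← Finset.sum_fiberwise_of_maps_to (fun α _ => hcard α)]
  refine Finset.sum_congr rfl fun m _ => ?_
  rw [F, PowerSeries.coeff_mk]
  split_ifs with h
  · refine Finset.sum_congr rfl fun α hα => ?_
    rw [(Finset.mem_filter.1 hα).2, if_pos h]
  · refine (Finset.sum_eq_zero fun α hα => ?_).symm
    rw [(Finset.mem_filter.1 hα).2, if_neg h]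

/-- The coefficient of `zⁿ uʲ` in `Φ` enumerates planar factorisations. -/
theorem coeff_toUSeries_Phi {k : ℕ} (hk : 2 ≤ k) (n j : ℕ) :
    PowerSeries.coeff j (toUSeries (PowerSeries.coeff n (Phi k))) =
      (1 / ((n.factorial : ℚ) * (j.factorial : ℚ))) • planarSum k (Fin n) j := by
  rw [coeff_Phi, map_sum, map_sum, planarSum_fin _ _ _ hk, Finset.smul_sum]
  refine Finset.sum_congr rfl fun α _ => ?_
  have hC : ∀ q : ℚ, toUSeries (MvPolynomial.C q) = PowerSeries.C (MvPolynomial.C q) := fun q => by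
    rw [← MvPolynomial.algebraMap_eq, AlgHom.commutes, IsScalarTower.algebraMap_apply ℚ PolyP]
    rfl
  have hcard : 1 ≤ n → 1 ≤ α.parts.card := fun hn => by
    refine Multiset.card_pos.2 fun h => ?_
    have h3 := α.parts_sum
    rw [h, Multiset.sum_zero] at h3
    omega
  by_cases h : (k - 1) * j + 2 = n + α.parts.card
  · have hn : 1 ≤ n := by
      by_contra hn
      have h2 : α.parts.card • 1 ≤ α.parts.sum :=
        Multiset.card_nsmul_le_sum fun a ha => α.parts_pos ha
      rw [α.parts_sum, smul_eq_mul] at h2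
      omega
    have hmul : n + α.parts.card - 2 = (k - 1) * j := by omega
    have hmu : mu k α = j := by
      rw [mu, hmul, Nat.mul_div_cancel_left _ (by omega)]
    rw [if_pos h, if_pos ⟨hn, hmul ▸ dvd_mul_right _ _⟩, hmu, map_mul toUSeries, map_mul toUSeries, map_pow, hC,
      toUSeries_pProd, toUSeries_u, PowerSeries.coeff_mul_X_pow', if_pos le_rfl, Nat.sub_self,
      ← map_mul PowerSeries.C, PowerSeries.coeff_zero_C, MvPolynomial.smul_eq_C_mul, ← mul_assoc]
    congr 1
    rw [← map_natCast (MvPolynomial.C (σ := ℕ) (R := ℚ)), ← map_mul]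
    congr 1
    push_cast
    field_simp
  · rw [if_neg h, smul_zero]
    split_ifs with h2
    · obtain ⟨hn, h2⟩ := h2
      have hmu : mu k α ≠ j := by
        rintro rfl
        have := Nat.mul_div_cancel' h2
        have := hcard hn
        rw [mu] at h
        omega
      rw [map_mul toUSeries, map_mul toUSeries, map_pow, hC, toUSeries_pProd, toUSeries_u, ← map_mul PowerSeries.C,
        PowerSeries.coeff_C_mul, PowerSeries.coeff_X_pow, if_neg hmu.symm, mul_zero]
    · simp

/-! ### Products of exponential generating functions -/

theorem derivation_prod {S A ι : Type} [CommSemiring S] [CommRing A] [Algebra S A]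
    [DecidableEq ι] (D : Derivation S A A) (s : Finset ι) (f : ι → A) :
    D (∏ i ∈ s, f i) = ∑ i ∈ s, D (f i) * ∏ i' ∈ s.erase i, f i' := by
  induction s using Finset.induction_on with
  | empty => simp
  | insert a s ha ih =>
    rw [Finset.prod_insert ha, Derivation.leibniz, ih, Finset.sum_insert ha,
      Finset.erase_insert ha, smul_eq_mul, smul_eq_mul, add_comm, Finset.mul_sum, mul_comm]
    congr 1
    refine Finset.sum_congr rfl fun i hi => ?_
    have hia : a ≠ i := fun h => ha (h ▸ hi)
    rw [Finset.erase_insert_of_ne hia, Finset.prod_insert (by simp [ha])]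
    ring

section

variable {X W R : Type} [Fintype X] [Fintype W] [DecidableEq W] [CommRing R] [Algebra ℚ R]

/-- The exponential generating function of the sums of `φ` over the words, of any length, in the
letters with tag `w`. -/
noncomputable def wordSeries (tag : X → W) (w : W) (φ : List X → R) : PowerSeries R :=
  PowerSeries.mk fun j =>
    (1 / (j.factorial : ℚ)) • ∑ L : Fin j → {x // tag x = w}, φ (List.ofFn fun a => (L a).1)

theorem sum_fin_succ_fun {R : Type} [AddCommMonoid R] {Y : Type} [Fintype Y] (j : ℕ)
    (g : (Fin (j + 1) → Y) → R) :
    ∑ L, g L = ∑ x : Y, ∑ L : Fin j → Y, g (Fin.cons x L) := by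
  rw [← Fintype.sum_prod_type', ← (Fin.consEquiv fun _ => Y).sum_comp]
  rfl

omit [Fintype W] in
theorem derivative_wordSeries (tag : X → W) (w : W) (φ : List X → R) :
    PowerSeries.derivative R (wordSeries tag w φ) =
      ∑ x : {x // tag x = w}, wordSeries tag w fun l => φ (x.1 :: l) := by
  ext j
  rw [PowerSeries.coeff_derivative, map_sum, wordSeries, PowerSeries.coeff_mk, sum_fin_succ_fun]
  simp only [wordSeries, PowerSeries.coeff_mk]
  rw [← Finset.smul_sum]
  simp only [List.ofFn_succ, Fin.cons_zero, Fin.cons_succ]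
  have h : ((j : R) + 1) = algebraMap ℚ R (j + 1) := by simp
  rw [h, mul_comm, ← Algebra.smul_def, smul_smul]
  congr 1
  rw [Nat.factorial_succ]
  push_cast
  field_simp

/-- The exponential formula for words: reading a word letter by letter splits it into its subwords
with given tag, which are shuffled independently. -/
theorem sum_prod_filter_ofFn (tag : X → W) (J : ℕ) (φ : W → List X → R) :
    ∑ L : Fin J → X, ∏ w, φ w ((List.ofFn L).filter fun x => tag x = w) =
      (J.factorial : ℚ) • PowerSeries.coeff J (∏ w, wordSeries tag w (φ w)) := by
  -- Removing the first letter is differentiation, so the claim is a product rule.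
  induction J generalizing φ with
  | zero =>
    rw [PowerSeries.coeff_zero_eq_constantCoeff, map_prod]
    simp [wordSeries, ← PowerSeries.coeff_zero_eq_constantCoeff_apply]
  | succ J ih =>
    have h1 : ((J + 1).factorial : ℚ) • PowerSeries.coeff (J + 1) (∏ w, wordSeries tag w (φ w)) =
        (J.factorial : ℚ) • PowerSeries.coeff J
          (PowerSeries.derivative R (∏ w, wordSeries tag w (φ w))) := by
      have h : ((J : R) + 1) = algebraMap ℚ R (J + 1) := by simp
      rw [PowerSeries.coeff_derivative, h, mul_comm, ← Algebra.smul_def, smul_smul]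
      congr 1
      rw [Nat.factorial_succ]
      push_cast
      ring
    have h2 : PowerSeries.derivative R (∏ w, wordSeries tag w (φ w)) =
        ∑ x : X, ∏ w, wordSeries tag w fun l => φ w (if tag x = w then x :: l else l) := by
      rw [derivation_prod, ← (Equiv.sigmaFiberEquiv tag).sum_comp, Fintype.sum_sigma]
      refine Finset.sum_congr rfl fun w _ => ?_
      rw [derivative_wordSeries, Finset.sum_mul]
      refine Finset.sum_congr rfl fun x _ => ?_
      rw [← Finset.mul_prod_erase _ _ (Finset.mem_univ w)]
      have hx : tag ((Equiv.sigmaFiberEquiv tag) ⟨w, x⟩) = w := x.2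
      congr 1
      · simp only [hx, if_true]
        rfl
      · refine Finset.prod_congr rfl fun w' hw' => ?_
        have : ¬ w = w' := (Finset.ne_of_mem_erase hw').symm
        simp only [hx, if_neg this]
    rw [h1, h2, map_sum, Finset.smul_sum, sum_fin_succ_fun]
    refine Finset.sum_congr rfl fun x _ => ?_
    rw [← ih]
    refine Finset.sum_congr rfl fun L _ => Finset.prod_congr rfl fun w _ => ?_
    rw [List.ofFn_succ, List.filter_cons]
    simp

/-- The exponential formula for set partitions with blocks named by `W`. -/
theorem sum_prod_card_fiber (n : ℕ) (A : W → ℕ → R) :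
    ∑ f : Fin n → W, ∏ w, A w (Fintype.card {a // f a = w}) =
      (n.factorial : ℚ) • PowerSeries.coeff n
        (∏ w, PowerSeries.mk fun m => (1 / (m.factorial : ℚ)) • A w m) := by
  -- Words over the alphabet `W`, each letter being its own tag.
  have h := sum_prod_filter_ofFn (R := R) (id : W → W) n (fun w l => A w l.length)
  have h1 : ∀ w : W, wordSeries (id : W → W) w (fun l => A w l.length) =
      PowerSeries.mk fun m => (1 / (m.factorial : ℚ)) • A w m := by
    intro w
    ext m
    simp only [wordSeries, PowerSeries.coeff_mk, List.length_ofFn, Finset.sum_const]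
    have : Fintype.card (Fin m → {x : W // id x = w}) = 1 := by simp
    rw [Finset.card_univ, this, one_smul]
  simp only [h1] at h
  rw [← h]
  refine Finset.sum_congr rfl fun f _ => Finset.prod_congr rfl fun w _ => ?_
  congr 1
  rw [Fintype.card_subtype, List.ofFn_eq_map, List.filter_map, List.length_map]
  rfl

end

/-! ### Pointed planar factorisations -/

section

variable {E : Type} [Fintype E] [DecidableEq E]

theorem isKCycle_iff_cycleType {k : ℕ} {s : Perm E} : IsKCycle k s ↔ s.cycleType = {k} := by
  constructor
  · rintro ⟨h1, h2⟩
    rw [h1.cycleType, h2]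
  · intro h
    have h1 : s.IsCycle := by rw [← Perm.card_cycleType_eq_one, h, Multiset.card_singleton]
    refine ⟨h1, ?_⟩
    have h2 := h1.cycleType
    rw [h] at h2
    exact (Multiset.singleton_inj.1 h2).symm

omit [DecidableEq E] in
theorem restWeight_singleton [DecidableEq (Finset E)] (π : Perm E) (x : E) :
    restWeight π {x} = ∏ C ∈ (cycleSets π).erase (cycleClass π x), MvPolynomial.X C.card := by
  classical
  rw [restWeight]
  refine Finset.prod_congr ?_ fun _ _ => rfl
  ext C
  rw [Finset.mem_filter, Finset.mem_erase, Finset.disjoint_singleton_right, and_comm]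
  refine and_congr_left fun hC => ⟨?_, ?_⟩
  · rintro hx rfl
    exact hx (self_mem_cycleClass π x)
  · exact fun hne hx => hne (eq_cycleClass hC hx)

omit [DecidableEq E] in
/-- Differentiating with respect to `p_ω` marks a point on a cycle of length `ω` and removes the
cycle. -/
theorem smul_pderiv_cycleWeight (π : Perm E) (ω : ℕ) :
    (ω : ℚ) • MvPolynomial.pderiv ω (cycleWeight π) =
      ∑ x, if (cycleClass π x).card = ω then restWeight π {x} else 0 := by
  classical
  rw [← Finset.sum_fiberwise_of_maps_to (t := cycleSets π) (g := cycleClass π)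
    (fun x _ => cycleClass_mem π x), cycleWeight, derivation_prod, Finset.smul_sum]
  refine Finset.sum_congr rfl fun C hC => ?_
  have h1 : (Finset.univ.filter fun x => cycleClass π x = C) = C := by
    ext x
    simp only [Finset.mem_filter, Finset.mem_univ, true_and]
    constructor
    · rintro rfl
      exact self_mem_cycleClass π x
    · exact fun hx => (eq_cycleClass hC hx).symm
  have h2 : ∀ x ∈ C, (if (cycleClass π x).card = ω then restWeight π {x} else 0) =
      if C.card = ω then
        ∏ C' ∈ (cycleSets π).erase C, (MvPolynomial.X C'.card : PolyP) else 0 := by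
    intro x hx
    rw [restWeight_singleton, ← eq_cycleClass hC hx]
  rw [h1, Finset.sum_congr rfl h2, Finset.sum_const, MvPolynomial.pderiv_X]
  by_cases h : C.card = ω
  · subst h
    simp [Nat.cast_smul_eq_nsmul]
  · simp [h]

open scoped Classical in
/-- The weight of a planar list of `k`-cycles with a marked point on a cycle of length `ω` of its
product; this cycle does not contribute to the weight. -/
noncomputable def pointedWeight (k ω : ℕ) (L : List (Perm E)) : PolyP :=
  if IsPlanar k L then
    ∑ x, if (cycleClass L.prod x).card = ω then restWeight L.prod {x} else 0
  else 0

/-- The planar factorisations with `j` factors and a marked point on a cycle of length `ω`. -/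
noncomputable def pointedSum (k ω : ℕ) (E : Type) [Fintype E] [DecidableEq E] (j : ℕ) : PolyP :=
  ∑ L : Fin j → KCycle k E, pointedWeight k ω (word L)

theorem smul_pderiv_planarSum (k ω j : ℕ) :
    (ω : ℚ) • MvPolynomial.pderiv ω (planarSum k E j) = pointedSum k ω E j := by
  rw [planarSum, pointedSum, map_sum, Finset.smul_sum]
  refine Finset.sum_congr rfl fun L _ => ?_
  rw [pointedWeight]
  split_ifs
  · exact smul_pderiv_cycleWeight _ _
  · simp

variable {E' : Type} [Fintype E'] [DecidableEq E']

omit [DecidableEq E] [DecidableEq E'] in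
theorem cycleClass_permCongr (g : E ≃ E') (π : Perm E) (x : E) :
    cycleClass (g.permCongr π) (g x) = (cycleClass π x).map g.toEmbedding := by
  have key : ∀ {E E' : Type} (g : E ≃ E') (π : Perm E) (x y : E), π.SameCycle x y →
      (g.permCongr π).SameCycle (g x) (g y) := by
    intro E E' g π x y h
    have : cycleSetoid π ≤ Setoid.comap g (cycleSetoid (g.permCongr π)) :=
      cycleSetoid_le_iff.2 fun x => by
        rw [Setoid.comap_rel]
        have := cycleSetoid_apply (g.permCongr π) (g x)
        simpa [Equiv.permCongr_apply] using this
    exact this h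
  ext y
  rw [mem_cycleClass, Finset.mem_map_equiv, mem_cycleClass]
  constructor
  · intro h
    have := key g.symm _ _ _ h
    have h2 : g.symm.permCongr (g.permCongr π) = π := by
      ext x
      simp
    rwa [h2, Equiv.symm_apply_apply] at this
  · intro h
    have := key g _ _ _ h
    rwa [Equiv.apply_symm_apply] at this

omit [DecidableEq E] [DecidableEq E'] in
theorem cycleSets_permCongr (g : E ≃ E') (π : Perm E) :
    cycleSets (g.permCongr π) =
      (cycleSets π).map ⟨Finset.map g.toEmbedding, Finset.map_injective _⟩ := by
  ext C
  simp only [mem_cycleSets, Finset.mem_map, Function.Embedding.coeFn_mk]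
  constructor
  · rintro ⟨x, rfl⟩
    refine ⟨_, ⟨g.symm x, rfl⟩, ?_⟩
    rw [← cycleClass_permCongr, Equiv.apply_symm_apply]
  · rintro ⟨_, ⟨x, rfl⟩, rfl⟩
    exact ⟨g x, cycleClass_permCongr _ _ _⟩

omit [DecidableEq E] [DecidableEq E'] in
theorem restWeight_permCongr (g : E ≃ E') (π : Perm E) (x : E) :
    restWeight (g.permCongr π) {g x} = restWeight π {x} := by
  classical
  rw [restWeight, restWeight, Finset.prod_filter, Finset.prod_filter, cycleSets_permCongr,
    Finset.prod_map]
  refine Finset.prod_congr rfl fun C _ => ?_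
  simp

omit [DecidableEq E] [DecidableEq E'] in
theorem isPlanar_map_permCongr (g : E ≃ E') (k : ℕ) (L : List (Perm E)) :
    IsPlanar k (L.map g.permCongr) ↔ IsPlanar k L := by
  rw [IsPlanar, IsPlanar, orb_map_conj, prod_map_permCongr, List.length_map,
    ← card_cycleSets (g.permCongr _), cycleSets_permCongr, Finset.card_map, card_cycleSets,
    Nat.card_congr g]

omit [DecidableEq E] [DecidableEq E'] in
theorem pointedWeight_map_permCongr (g : E ≃ E') (k ω : ℕ) (L : List (Perm E)) :
    pointedWeight k ω (L.map g.permCongr) = pointedWeight k ω L := by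
  classical
  rw [pointedWeight, pointedWeight]
  refine if_congr (isPlanar_map_permCongr g k L) ?_ rfl
  rw [← g.sum_comp]
  refine Finset.sum_congr rfl fun x _ => ?_
  rw [prod_map_permCongr, cycleClass_permCongr, Finset.card_map, restWeight_permCongr]

theorem pointedSum_congr (g : E ≃ E') (k ω j : ℕ) :
    pointedSum k ω E j = pointedSum k ω E' j := by
  let e : KCycle k E ≃ KCycle k E' :=
    g.permCongr.subtypeEquiv fun s => (isKCycle_permCongr g).symm
  rw [pointedSum, pointedSum, ← (Equiv.arrowCongr (Equiv.refl (Fin j)) e).sum_comp]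
  refine Finset.sum_congr rfl fun L _ => ?_
  rw [← pointedWeight_map_permCongr g]
  congr 1
  simp only [word, List.map_ofFn]
  rfl

end

/-! ### Labelling the points of a cycle -/

section

variable {E : Type} [Fintype E] [DecidableEq E] {k : ℕ}

theorem support_viaFintypeEmbedding {c : Perm (Fin k)} (hc : IsKCycle k c) (ι : Fin k ↪ E) :
    (c.viaFintypeEmbedding ι).support = Finset.univ.map ι := by
  have hc' : c.support = Finset.univ :=
    Finset.eq_univ_of_card _ (by rw [hc.2, Fintype.card_fin])
  ext x
  rw [Perm.mem_support]
  constructor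
  · intro h
    by_contra hx
    exact h (FirstReturn.viaFintypeEmbedding_apply_of_notMem c ι x hx)
  · intro hx
    obtain ⟨e, -, rfl⟩ := Finset.mem_map.1 hx
    rw [Perm.viaFintypeEmbedding_apply_image]
    exact fun h => Perm.mem_support.1 (hc' ▸ Finset.mem_univ e) (ι.injective h)

theorem isKCycle_of_viaFintypeEmbedding {m : ℕ} {c : Perm (Fin k)} {ι : Fin k ↪ E}
    (h : IsKCycle m (c.viaFintypeEmbedding ι)) : IsKCycle m c := by
  rw [isKCycle_iff_cycleType] at h ⊢
  rw [← h, Perm.viaFintypeEmbedding, Perm.cycleType_extendDomain]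

open scoped Classical in
/-- A `k`-cycle has `k!` labellings of its points. -/
theorem card_labellings (σ : KCycle k E) :
    (Finset.univ.filter fun q : KCycle k (Fin k) × (Fin k ↪ E) =>
      q.1.1.viaFintypeEmbedding q.2 = σ.1).card = k.factorial := by
  have hmem : ∀ q : KCycle k (Fin k) × (Fin k ↪ E), q.1.1.viaFintypeEmbedding q.2 = σ.1 →
      Finset.univ.map q.2 = σ.1.support := fun q hq => by
    rw [← hq, support_viaFintypeEmbedding q.1.2]
  have hcard : Fintype.card (Fin k) = Fintype.card {x // x ∈ σ.1.support} := by
    rw [Fintype.card_fin, Fintype.card_coe, σ.2.2]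
  let Φ : {q : KCycle k (Fin k) × (Fin k ↪ E) // q.1.1.viaFintypeEmbedding q.2 = σ.1} →
      (Fin k ≃ {x // x ∈ σ.1.support}) := fun q =>
    Equiv.ofBijective (fun e => ⟨q.1.2 e, hmem q.1 q.2 ▸ Finset.mem_map_of_mem _ (Finset.mem_univ e)⟩)
      ((Fintype.bijective_iff_injective_and_card _).2
        ⟨fun e e' h => q.1.2.injective (congrArg Subtype.val h), hcard⟩)
  have hΦ : Function.Bijective Φ := by
    constructor
    · rintro ⟨⟨c, ι⟩, h⟩ ⟨⟨c', ι'⟩, h'⟩ heq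
      have hι : ι = ι' := by
        ext e
        exact congrArg Subtype.val (DFunLike.congr_fun heq e)
      subst hι
      have hcc : c = c' := by
        refine Subtype.ext (Perm.ext fun e => ι.injective ?_)
        rw [← Perm.viaFintypeEmbedding_apply_image, ← Perm.viaFintypeEmbedding_apply_image]
        exact (congrArg (· (ι e)) h).trans (congrArg (· (ι e)) h').symm
      subst hcc
      rfl
    · intro j
      let ι : Fin k ↪ E := j.toEmbedding.trans (Function.Embedding.subtype _)
      let c : Perm (Fin k) := j.symm.permCongr
        (σ.1.subtypePerm (p := fun x => x ∈ σ.1.support) fun x => Perm.apply_mem_support)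
      have hc : c.viaFintypeEmbedding ι = σ.1 := by
        ext x
        by_cases hx : x ∈ σ.1.support
        · have hx' : x = ι (j.symm ⟨x, hx⟩) := by simp [ι]
          rw [hx', Perm.viaFintypeEmbedding_apply_image]
          simp [ι, c, Equiv.permCongr_apply]
        · rw [Perm.viaFintypeEmbedding_apply_notMem_range, Perm.notMem_support.1 hx]
          rintro ⟨e, rfl⟩
          exact hx (j e).2
      refine ⟨⟨(⟨c, isKCycle_of_viaFintypeEmbedding (hc ▸ σ.2 :
        IsKCycle k (c.viaFintypeEmbedding ι))⟩, ι), hc⟩, ?_⟩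
      ext e
      rfl
  rw [← Fintype.card_subtype, Fintype.card_of_bijective hΦ, Fintype.card_equiv (Fintype.equivOfCardEq
    hcard), Fintype.card_fin]

/-- A sum over `k`-cycles as a sum over their labellings. -/
theorem factorial_smul_sum_kCycle {M : Type} [AddCommMonoid M] (h : Perm E → M) :
    k.factorial • ∑ σ : KCycle k E, h σ.1 =
      ∑ c : KCycle k (Fin k), ∑ ι : Fin k ↪ E, h (c.1.viaFintypeEmbedding ι) := by
  classical
  rw [← Fintype.sum_prod_type' (f := fun (c : KCycle k (Fin k)) (ι : Fin k ↪ E) =>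
      h (c.1.viaFintypeEmbedding ι)),
    ← Finset.sum_fiberwise (s := Finset.univ)
      (g := fun q : KCycle k (Fin k) × (Fin k ↪ E) =>
        (⟨q.1.1.viaFintypeEmbedding q.2, isKCycle_viaFintypeEmbedding q.1.2 q.2⟩ : KCycle k E)),
    Finset.smul_sum]
  refine Finset.sum_congr rfl fun σ _ => ?_
  rw [← card_labellings σ, ← Finset.sum_const]
  refine Finset.sum_congr ?_ fun q hq => ?_
  · ext q
    simp [Subtype.ext_iff]
  · rw [← congrArg Subtype.val (Finset.mem_filter.1 hq).2]

end

/-! ### The plane tree of the first factor -/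

section Trees

variable {k : ℕ}

theorem numCycles_eq_one_of_isKCycle {c : Perm (Fin k)} (hc : IsKCycle k c) : numCycles c = 1 := by
  have := numCycles_of_isCycle hc.1
  rw [hc.2, Nat.card_fin] at this
  omega

theorem isKCycle_of_numCycles_eq_one (hk : 2 ≤ k) {c : Perm (Fin k)} (hc : numCycles c = 1) :
    IsKCycle k c := by
  have h := eq_top_of_classCount_eq_one hc
  have h2 : CyclicOn c Finset.univ := ⟨by simp, fun u _ v _ => Setoid.eq_top_iff.1 h u v⟩
  have := h2.isKCycle (by simpa using hk)
  simpa using this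

/-- The genus of a factorisation of a full cycle into two factors is nonnegative. -/
theorem numCycles_add_numCycles_le {b w : Perm (Fin k)} (h : IsKCycle k (b * w)) :
    numCycles b + numCycles w ≤ k + 1 := by
  have h1 := numCycles_eq_one_of_isKCycle h
  have hne : Nonempty (Fin k) := by
    obtain ⟨x, -⟩ := h.1
    exact ⟨x⟩
  have htop : orb [b, w] = ⊤ := by
    refine top_le_iff.1 ((eq_top_of_classCount_eq_one h1).symm.le.trans ?_)
    simpa using cycleSetoid_prod_le [b, w]
  have := riemann_hurwitz [b, w]
  rw [htop, classCount_top] at this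
  simp [h1] at this
  omega

namespace LabelledPlaneTree

theorem orb_eq_top (t : LabelledPlaneTree k) : orb [t.black, t.white] = ⊤ := by
  rw [← isPretransitive_closure_iff]
  convert t.connected
  all_goals
    ext s
    simp

/-- Walking around a plane tree visits every edge. -/
theorem isKCycle_mul (hk : 2 ≤ k) (t : LabelledPlaneTree k) : IsKCycle k (t.black * t.white) := by
  have : Nonempty (Fin k) := ⟨⟨0, by omega⟩⟩
  apply isKCycle_of_numCycles_eq_one hk
  have h1 := riemann_hurwitz [t.black, t.white]
  have h2 := t.card_vertices
  have h3 := classCount_pos (cycleSetoid (t.black * t.white))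
  rw [t.orb_eq_top, classCount_top] at h1
  rw [← numCycles_eq] at h3
  simp at h1
  omega

end LabelledPlaneTree

/-- Plane trees correspond to the genus-zero factorisations of full cycles into two factors. -/
theorem sum_labelledPlaneTree [Fintype (LabelledPlaneTree k)] (hk : 2 ≤ k) {M : Type}
    [AddCommMonoid M] (G : Perm (Fin k) → Perm (Fin k) → M) :
    ∑ t : LabelledPlaneTree k, G t.black t.white⁻¹ =
      ∑ c : KCycle k (Fin k), ∑ r : Perm (Fin k),
        if numCycles (c.1 * r) + numCycles r = k + 1 then G (c.1 * r) r else 0 := by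
  classical
  rw [← Fintype.sum_prod_type' (f := fun (c : KCycle k (Fin k)) (r : Perm (Fin k)) =>
    if numCycles (c.1 * r) + numCycles r = k + 1 then G (c.1 * r) r else 0),
    ← Finset.sum_filter]
  refine Finset.sum_bij (fun t _ => (⟨t.black * t.white, t.isKCycle_mul hk⟩, t.white⁻¹))
    ?_ ?_ ?_ ?_
  · intro t _
    simp only [Finset.mem_filter, Finset.mem_univ, true_and, mul_inv_cancel_right, numCycles_inv]
    exact t.card_vertices
  · intro t _ t' _ h
    have h1 := congrArg Subtype.val (Prod.ext_iff.1 h).1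
    have h2 := inv_injective (Prod.ext_iff.1 h).2
    obtain ⟨b, w, h3, h4⟩ := t
    obtain ⟨b', w', h3', h4'⟩ := t'
    simp only at h1 h2
    subst h2
    have := mul_right_cancel h1
    subst this
    rfl
  · rintro ⟨c, r⟩ h
    have h1 := (Finset.mem_filter.1 h).2
    have hconn : MulAction.IsPretransitive (Subgroup.closure {c.1 * r, r⁻¹}) (Fin k) := by
      have h2 : orb [c.1 * r, r⁻¹] = ⊤ := by
        refine top_le_iff.1 ((eq_top_of_classCount_eq_one
          (numCycles_eq_one_of_isKCycle c.2)).symm.le.trans ?_)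
        simpa using cycleSetoid_prod_le [c.1 * r, r⁻¹]
      rw [← isPretransitive_closure_iff] at h2
      convert h2
      all_goals
        ext s
        simp
    refine ⟨⟨c.1 * r, r⁻¹, hconn, by rw [numCycles_inv]; exact h1⟩, Finset.mem_univ _, ?_⟩
    simp
  · intro t _
    simp

end Trees

section

variable {E : Type} [Fintype E] [DecidableEq E] {k : ℕ}

/-- The conditions on a list `τ` of `k`-cycles under which composing with a further `k`-cycle on the
points marked by `ι` gives a planar list: the orbits of `τ` are planar and correspond to the cycles
of the first-return permutation `r`. -/
structure IsForest (k : ℕ) (ι : Fin k ↪ E) (τ : List (Perm E)) (r : Perm (Fin k)) : Prop where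
  meets : ∀ x, ∃ e, orb τ x (ι e)
  sameCycle : ∀ e e', orb τ (ι e) (ι e') → r.SameCycle e e'
  genus : (k - 1) * τ.length + 2 * numCycles r = Nat.card E + numCycles τ.prod

/-- Planarity is genus zero twice over: for the plane tree `(c r, r⁻¹)` of the first factor, and for
the orbits of the other factors. -/
theorem isPlanar_cons_iff (hk : 2 ≤ k) {ι : Fin k ↪ E} {τ : List (Perm E)}
    (hτ : ∀ s ∈ τ, IsKCycle k s) {c r : Perm (Fin k)} (hc : IsKCycle k c) {i : Fin k → ℕ+}
    (h : FirstReturn τ.prod ι r i) :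
    IsPlanar k (c.viaFintypeEmbedding ι :: τ) ↔
      numCycles (c * r) + numCycles r = k + 1 ∧ IsForest k ι τ r := by
  have hcyc := h.numCycles_mul c
  have hle : numCycles (c * r) + numCycles r ≤ k + 1 := by
    rw [← numCycles_inv r]
    exact numCycles_add_numCycles_le (by rwa [mul_inv_cancel_right])
  have hrh := riemann_hurwitz_kCycles hk hτ
  have hprod := cycleSetoid_prod_le τ
  -- The cycles of `r` map to the orbits of `τ`.
  let ψ : Cycles r → Quotient (orb τ) := Quotient.map' ι fun e e' he =>
    hprod (h.sameCycle_map he)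
  have hcard : (∀ x, ∃ e, orb τ x (ι e)) → Function.Surjective ψ := by
    intro hm q
    induction q using Quotient.ind with
    | _ x =>
      obtain ⟨e, he⟩ := hm x
      exact ⟨Quotient.mk _ e, Quotient.sound ((orb τ).symm he)⟩
  have hσ : cycleSetoid (c.viaFintypeEmbedding ι) ≤ cycleSetoid (c.viaFintypeEmbedding ι) ⊔ orb τ :=
    le_sup_left
  constructor
  · rintro ⟨h1, h2⟩
    rw [List.length_cons, List.prod_cons, mul_add, mul_one] at h2
    -- An orbit of `τ` without marked points would be an orbit of the whole list.
    have hmeets : ∀ x, ∃ e, orb τ x (ι e) := by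
      by_contra! hx
      obtain ⟨x, hx⟩ := hx
      have hle : orb (c.viaFintypeEmbedding ι :: τ) ≤ Setoid.ker (fun y => orb τ x y) := by
        rw [orb_cons]
        refine sup_le (cycleSetoid_le_iff.2 fun y => ?_) (orb_le_iff.2 fun s hs y => ?_)
        · rw [Setoid.ker_def]
          by_cases hy : y ∈ (Finset.univ.map ι : Finset E)
          · obtain ⟨e, -, rfl⟩ := Finset.mem_map.1 hy
            rw [Perm.viaFintypeEmbedding_apply_image]
            exact propext ⟨fun h => absurd h (hx _), fun h => absurd h (hx _)⟩
          · rw [FirstReturn.viaFintypeEmbedding_apply_of_notMem _ _ _ hy]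
        · rw [Setoid.ker_def]
          have := orb_le_iff.1 (le_refl (orb τ)) s hs y
          exact propext ⟨fun h => (orb τ).trans h this,
            fun h => (orb τ).trans h ((orb τ).symm this)⟩
      rw [h1] at hle
      obtain ⟨e, -⟩ := hc.1
      have h3 : Setoid.ker (fun y => orb τ x y) x (ι e) := hle trivial
      rw [Setoid.ker_def] at h3
      exact hx e (h3 ▸ (orb τ).refl x)
    -- Genus zero for the whole list forces equality in the Riemann–Hurwitz inequalities for the tree
    -- and for `τ`, and in this bound.
    have hle2 : classCount (orb τ) ≤ numCycles r :=
      Nat.card_le_card_of_surjective ψ (hcard hmeets)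
    have heq : classCount (orb τ) = numCycles r := by omega
    refine ⟨by omega, hmeets, ?_, by omega⟩
    have hbij : Function.Bijective ψ := by
      have : Fintype (Cycles r) := Fintype.ofFinite _
      have : Fintype (Quotient (orb τ)) := Fintype.ofFinite _
      rw [Fintype.bijective_iff_surjective_and_card]
      refine ⟨hcard hmeets, ?_⟩
      rw [← Nat.card_eq_fintype_card, ← Nat.card_eq_fintype_card]
      exact heq.symm
    intro e e' he
    exact Quotient.exact (hbij.1 (Quotient.sound he : ψ (Quotient.mk _ e) = ψ (Quotient.mk _ e')))
  · rintro ⟨h1, h2⟩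
    constructor
    · rw [orb_cons]
      obtain ⟨e₀, -⟩ := hc.1
      have hctop := eq_top_of_classCount_eq_one (numCycles_eq_one_of_isKCycle hc)
      have hι : cycleSetoid c ≤ Setoid.comap ι (cycleSetoid (c.viaFintypeEmbedding ι) ⊔ orb τ) :=
        cycleSetoid_le_iff.2 fun e => by
          rw [Setoid.comap_rel, ← Perm.viaFintypeEmbedding_apply_image]
          exact hσ (cycleSetoid_apply _ _)
      have key : ∀ x, (cycleSetoid (c.viaFintypeEmbedding ι) ⊔ orb τ) x (ι e₀) := by
        intro x
        obtain ⟨e, he⟩ := h2.meets x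
        exact Setoid.trans' _ ((le_sup_right : orb τ ≤ _) he)
          (hι (Setoid.eq_top_iff.1 hctop e e₀))
      rw [Setoid.eq_top_iff]
      exact fun x y => Setoid.trans' _ (key x) (Setoid.symm' _ (key y))
    · have := h2.genus
      rw [List.length_cons, List.prod_cons, mul_add, mul_one]
      omega

omit [Fintype E] [DecidableEq E] in
/-- A forest names its orbits by the cycles of the first-return permutation. -/
theorem isForest_iff_exists {ι : Fin k ↪ E} {τ : List (Perm E)} {w : Perm (Fin k)} {i : Fin k → ℕ+}
    (h : FirstReturn τ.prod ι w⁻¹ i) :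
    IsForest k ι τ w⁻¹ ↔ ∃ f : E → Cycles w, (∀ s ∈ τ, ∀ x, f (s x) = f x) ∧
      (∀ e, f (ι e) = ⟦e⟧) ∧ (∀ x y, f x = f y → orb τ x y) ∧
      (k - 1) * τ.length + 2 * numCycles w = Nat.card E + numCycles τ.prod := by
  have hprod := cycleSetoid_prod_le τ
  constructor
  · intro hF
    choose g hg using hF.meets
    have key : ∀ x e, orb τ x (ι e) → (⟦g x⟧ : Cycles w) = ⟦e⟧ := fun x e he =>
      Quotient.sound (Perm.sameCycle_inv.1
        (hF.sameCycle _ _ ((orb τ).trans ((orb τ).symm (hg x)) he)))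
    refine ⟨fun x => ⟦g x⟧, fun s hs x => ?_, fun e => key _ _ ((orb τ).refl _), ?_, ?_⟩
    · refine key _ _ ((orb τ).trans ((orb τ).symm ?_) (hg x))
      exact orb_le_iff.1 le_rfl s hs x
    · intro x y hxy
      have h1 : w.SameCycle (g x) (g y) := Quotient.exact hxy
      have h2 := hprod (h.sameCycle_map (Perm.sameCycle_inv.2 h1))
      exact (orb τ).trans (hg x) ((orb τ).trans h2 ((orb τ).symm (hg y)))
    · rw [← numCycles_inv w]
      exact hF.genus
  · rintro ⟨f, h1, h2, h3, h4⟩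
    have hle : orb τ ≤ Setoid.ker f := orb_le_iff.2 fun s hs x => (h1 s hs x).symm
    refine ⟨fun x => ?_, fun e e' he => ?_, by rw [numCycles_inv]; exact h4⟩
    · obtain ⟨e, he⟩ := Quotient.exists_rep (f x)
      exact ⟨e, h3 _ _ (by rw [h2, ← he])⟩
    · have := hle he
      rw [Setoid.ker_def, h2, h2] at this
      exact Perm.sameCycle_inv.2 (Quotient.exact this)

omit [Fintype E] [DecidableEq E] in
theorem forest_naming_unique {ι : Fin k ↪ E} {τ : List (Perm E)} {w : Perm (Fin k)}
    {f f' : E → Cycles w} (hf' : ∀ s ∈ τ, ∀ x, f' (s x) = f' x)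
    (hι : ∀ e, f (ι e) = ⟦e⟧) (hι' : ∀ e, f' (ι e) = ⟦e⟧)
    (hτ : ∀ x y, f x = f y → orb τ x y) : f = f' := by
  have hle : orb τ ≤ Setoid.ker f' := orb_le_iff.2 fun s hs x => (hf' s hs x).symm
  funext x
  obtain ⟨e, he⟩ := Quotient.exists_rep (f x)
  have h1 : orb τ x (ι e) := hτ _ _ (by rw [hι, ← he])
  have h2 := hle h1
  rw [Setoid.ker_def, hι'] at h2
  rw [h2, ← he]

end

/-! ### Restriction to the blocks of an invariant partition -/

section

variable {E W : Type} [Fintype E] [DecidableEq E] [DecidableEq W] {k : ℕ}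

open scoped Classical in
/-- The restriction of a permutation that preserves `f` to the fibre of `f` over `v` (and the
identity if the permutation does not preserve `f`). -/
noncomputable def fiberPerm {E W : Type} (f : E → W) (v : W) (s : Perm E) :
    Perm {x // f x = v} :=
  if h : ∀ x, f (s x) = f x then s.subtypePerm (p := fun x => f x = v) fun x => by rw [h] else 1

omit [Fintype E] [DecidableEq E] [DecidableEq W] in
theorem fiberPerm_apply {f : E → W} {v : W} {s : Perm E} (h : ∀ x, f (s x) = f x)
    (x : {x // f x = v}) : (fiberPerm f v s x : E) = s x := by
  simp [fiberPerm, h]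

omit [Fintype E] [DecidableEq E] [DecidableEq W] in
theorem preserves_prod {f : E → W} {L : List (Perm E)} (h : ∀ s ∈ L, ∀ x, f (s x) = f x) :
    ∀ x, f (L.prod x) = f x := by
  induction L with
  | nil => simp
  | cons s L ih =>
    intro x
    rw [List.prod_cons, Perm.mul_apply, h s (by simp), ih fun t ht => h t (by simp [ht])]

omit [Fintype E] [DecidableEq E] [DecidableEq W] in
theorem prod_map_fiberPerm {f : E → W} (v : W) {L : List (Perm E)}
    (h : ∀ s ∈ L, ∀ x, f (s x) = f x) :
    (L.map (fiberPerm f v)).prod = fiberPerm f v L.prod := by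
  induction L with
  | nil =>
    ext x
    rw [fiberPerm_apply (preserves_prod h)]
    rfl
  | cons s L ih =>
    have h' : ∀ t ∈ L, ∀ x, f (t x) = f x := fun t ht => h t (by simp [ht])
    ext x
    rw [fiberPerm_apply (preserves_prod h), List.map_cons, List.prod_cons, List.prod_cons, ih h',
      Perm.mul_apply, Perm.mul_apply, fiberPerm_apply (h s (by simp)),
      fiberPerm_apply (preserves_prod h')]

omit [Fintype E] [DecidableEq E] in
theorem orb_map_fiberPerm {f : E → W} (v : W) {L : List (Perm E)}
    (h : ∀ s ∈ L, ∀ x, f (s x) = f x) (x y : {x // f x = v}) :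
    orb (L.map (fiberPerm f v)) x y ↔ orb L x y := by
  constructor
  · have h1 : orb (L.map (fiberPerm f v)) ≤ Setoid.comap Subtype.val (orb L) := by
      rw [orb_le_iff]
      intro s' hs' x
      obtain ⟨s, hs, rfl⟩ := List.mem_map.1 hs'
      rw [Setoid.comap_rel, fiberPerm_apply (h s hs)]
      exact orb_le_iff.1 le_rfl s hs x
    exact fun hxy => h1 hxy
  · let g : E → Option (Quotient (orb (L.map (fiberPerm f v)))) := fun x =>
      if hx : f x = v then some ⟦⟨x, hx⟩⟧ else none
    have h1 : orb L ≤ Setoid.ker g := by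
      rw [orb_le_iff]
      intro s hs x
      rw [Setoid.ker_def]
      by_cases hx : f x = v
      · have hx' : f (s x) = v := by rw [h s hs, hx]
        simp only [g, dif_pos hx, dif_pos hx']
        congr 1
        refine Quotient.sound ?_
        have h2 := orb_le_iff.1 (le_refl (orb (L.map (fiberPerm f v)))) _
          (List.mem_map_of_mem hs) ⟨x, hx⟩
        convert h2
        rw [fiberPerm_apply (h s hs)]
      · have hx' : ¬ f (s x) = v := by rwa [h s hs]
        simp only [g, dif_neg hx, dif_neg hx']
    intro hxy
    have h2 := h1 hxy
    rw [Setoid.ker_def] at h2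
    simp only [g, dif_pos x.2, dif_pos y.2] at h2
    exact Quotient.exact (Option.some_injective _ h2)

omit [DecidableEq E] in
theorem map_cycleClass_fiberPerm {f : E → W} {v : W} {π : Perm E} (h : ∀ x, f (π x) = f x)
    (x : {x // f x = v}) :
    (cycleClass (fiberPerm f v π) x).map (Function.Embedding.subtype _) =
      cycleClass π (x : E) := by
  have hs : ∀ y : {x // f x = v}, (fiberPerm f v π).SameCycle x y ↔ π.SameCycle x y := by
    intro y
    rw [fiberPerm, dif_pos h, Perm.sameCycle_subtypePerm]
  ext y
  simp only [Finset.mem_map, mem_cycleClass, Function.Embedding.coe_subtype]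
  constructor
  · rintro ⟨y, hy, rfl⟩
    exact (hs y).1 hy
  · intro hy
    have hle : cycleSetoid π ≤ Setoid.ker f := cycleSetoid_le_iff.2 fun x => (h x).symm
    have h1 : f x = f y := hle hy
    exact ⟨⟨y, h1.symm.trans x.2⟩, (hs _).2 hy, rfl⟩

/-- Subsets of a fibre as subsets of the ground set. -/
def fiberFinset {E W : Type} (f : E → W) (v : W) : Finset {x // f x = v} ↪ Finset E :=
  ⟨Finset.map (Function.Embedding.subtype _), Finset.map_injective _⟩

variable [Fintype W]

theorem cycleSets_eq_biUnion {f : E → W} {π : Perm E} (h : ∀ x, f (π x) = f x) :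
    cycleSets π = Finset.univ.biUnion fun v =>
      (cycleSets (fiberPerm f v π)).map (fiberFinset f v) := by
  ext C
  simp only [Finset.mem_biUnion, Finset.mem_univ, true_and, Finset.mem_map, mem_cycleSets]
  constructor
  · rintro ⟨x, rfl⟩
    exact ⟨f x, _, ⟨⟨x, rfl⟩, rfl⟩, map_cycleClass_fiberPerm h ⟨x, rfl⟩⟩
  · rintro ⟨v, _, ⟨x, rfl⟩, rfl⟩
    exact ⟨x, (map_cycleClass_fiberPerm h x).symm⟩

omit [DecidableEq E] in
theorem pairwiseDisjoint_fiberFinset (f : E → W) (π : Perm E) :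
    (↑(Finset.univ : Finset W) : Set W).PairwiseDisjoint fun v =>
      (cycleSets (fiberPerm f v π)).map (fiberFinset f v) := by
  intro v _ v' _ hne
  rw [Function.onFun, Finset.disjoint_left]
  intro C hC hC'
  obtain ⟨D, hD, rfl⟩ := Finset.mem_map.1 hC
  obtain ⟨D', hD', heq⟩ := Finset.mem_map.1 hC'
  obtain ⟨x, hx⟩ := nonempty_of_mem_cycleSets hD
  have h1 : (x : E) ∈ fiberFinset f v D := Finset.mem_map_of_mem _ hx
  rw [← heq] at h1
  obtain ⟨y, -, hy⟩ := Finset.mem_map.1 h1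
  have hyx : (y : E) = x := hy
  exact hne (by rw [← x.2, ← y.2, hyx])

theorem numCycles_eq_sum_fiber {f : E → W} {π : Perm E} (h : ∀ x, f (π x) = f x) :
    numCycles π = ∑ v, numCycles (fiberPerm f v π) := by
  rw [← card_cycleSets, cycleSets_eq_biUnion h,
    Finset.card_biUnion fun v hv v' hv' => pairwiseDisjoint_fiberFinset f π hv hv']
  exact Finset.sum_congr rfl fun v _ => by rw [Finset.card_map, card_cycleSets]

theorem restWeight_eq_prod_fiber {f : E → W} {π : Perm E} (h : ∀ x, f (π x) = f x) {S : Finset E}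
    (p : ∀ v, {x // f x = v}) (hp : ∀ v, (p v : E) ∈ S)
    (hS : ∀ v, ∀ x ∈ S, f x = v → π.SameCycle (p v) x) :
    restWeight π S = ∏ v, restWeight (fiberPerm f v π) {p v} := by
  classical
  rw [restWeight, Finset.prod_filter, cycleSets_eq_biUnion h,
    Finset.prod_biUnion (pairwiseDisjoint_fiberFinset f π)]
  refine Finset.prod_congr rfl fun v _ => ?_
  rw [Finset.prod_map, restWeight, Finset.prod_filter]
  refine Finset.prod_congr rfl fun C hC => ?_
  have hcard : (fiberFinset f v C).card = C.card := Finset.card_map _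
  rw [hcard]
  suffices hiff : Disjoint (fiberFinset f v C) S ↔ Disjoint C {p v} by
    by_cases hd : Disjoint C {p v}
    · rw [if_pos hd, if_pos (hiff.2 hd)]
    · rw [if_neg hd, if_neg fun h => hd (hiff.1 h)]
  rw [Finset.disjoint_singleton_right, ← not_iff_not, not_not, Finset.not_disjoint_iff]
  constructor
  · rintro ⟨x, hx, hxS⟩
    obtain ⟨y, hy, rfl⟩ := Finset.mem_map.1 hx
    have h1 := hS v _ hxS y.2
    rw [eq_cycleClass hC hy, ← Finset.mem_map' (Function.Embedding.subtype _),
      map_cycleClass_fiberPerm h, mem_cycleClass]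
    exact h1.symm
  · intro hpC
    exact ⟨p v, Finset.mem_map_of_mem _ hpC, hp v⟩

/-- The `k`-cycles that preserve `f`. -/
abbrev FiberCycle (k : ℕ) (f : E → W) : Type := {s : KCycle k E // ∀ x, f (s.1 x) = f x}

noncomputable instance (f : E → W) : Fintype (FiberCycle k f) := Fintype.ofFinite _

/-- The fibre that contains the support of a cycle preserving `f`. -/
noncomputable def fiberTag {f : E → W} (s : FiberCycle k f) : W := f s.1.2.1.choose

omit [DecidableEq W] [Fintype W] in
theorem eq_fiberTag {f : E → W} (s : FiberCycle k f) {x : E} (hx : s.1.1 x ≠ x) :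
    f x = fiberTag s := by
  have h1 := s.1.2.1.choose_spec.2 hx
  have hle : cycleSetoid s.1.1 ≤ Setoid.ker f := cycleSetoid_le_iff.2 fun x => (s.2 x).symm
  exact (hle h1).symm

omit [Fintype W] [DecidableEq W] in
theorem fiberPerm_eq_one {f : E → W} (s : FiberCycle k f) {v : W} (h : fiberTag s ≠ v) :
    fiberPerm f v s.1.1 = 1 := by
  ext x
  rw [fiberPerm_apply s.2, Perm.one_apply]
  by_contra hne
  exact h ((eq_fiberTag s hne).symm.trans x.2)

omit [Fintype W] in
theorem ofSubtype_fiberPerm {f : E → W} (s : FiberCycle k f) {v : W} (h : fiberTag s = v) :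
    Perm.ofSubtype (fiberPerm f v s.1.1) = s.1.1 := by
  rw [fiberPerm, dif_pos s.2]
  exact Perm.ofSubtype_subtypePerm _ fun x hx => (eq_fiberTag s hx).trans h

omit [Fintype W] in
theorem isKCycle_fiberPerm {f : E → W} (s : FiberCycle k f) {v : W} (h : fiberTag s = v) :
    IsKCycle k (fiberPerm f v s.1.1) := by
  rw [isKCycle_iff_cycleType, ← Perm.cycleType_ofSubtype, ofSubtype_fiberPerm s h,
    ← isKCycle_iff_cycleType]
  exact s.1.2

/-- The `k`-cycles supported in a given fibre are the `k`-cycles of that fibre. -/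
noncomputable def fiberCycleEquiv (k : ℕ) (f : E → W) (v : W) :
    {s : FiberCycle k f // fiberTag s = v} ≃ KCycle k {x // f x = v} :=
  Equiv.ofBijective (fun s => ⟨fiberPerm f v s.1.1.1, isKCycle_fiberPerm s.1 s.2⟩) <| by
    constructor
    · intro s s' h
      have h1 : fiberPerm f v s.1.1.1 = fiberPerm f v s'.1.1.1 := congrArg Subtype.val h
      refine Subtype.ext (Subtype.ext (Subtype.ext ?_))
      rw [← ofSubtype_fiberPerm s.1 s.2, h1, ofSubtype_fiberPerm s'.1 s'.2]
    · intro c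
      have hc : IsKCycle k (Perm.ofSubtype c.1) := by
        rw [isKCycle_iff_cycleType, Perm.cycleType_ofSubtype, ← isKCycle_iff_cycleType]
        exact c.2
      have hf : ∀ x, f (Perm.ofSubtype c.1 x) = f x := by
        intro x
        by_cases hx : f x = v
        · rw [Perm.ofSubtype_apply_of_mem c.1 hx, hx]
          exact (c.1 ⟨x, hx⟩).2
        · rw [Perm.ofSubtype_apply_of_not_mem c.1 hx]
      let s : FiberCycle k f := ⟨⟨Perm.ofSubtype c.1, hc⟩, hf⟩
      have hs : fiberTag s = v := by
        obtain ⟨x, hx, -⟩ := hc.1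
        rw [← eq_fiberTag s hx]
        by_contra hne
        exact hx (Perm.ofSubtype_apply_of_not_mem c.1 hne)
      refine ⟨⟨s, hs⟩, Subtype.ext (Perm.ext fun x => Subtype.ext ?_)⟩
      change (fiberPerm f v (Perm.ofSubtype c.1) x : E) = c.1 x
      rw [fiberPerm_apply hf]
      exact Perm.ofSubtype_apply_coe _ _

/-- The letters of `L` supported in the fibre over `v`, as permutations of that fibre. -/
noncomputable def fiberList {f : E → W} (v : W) (L : List (FiberCycle k f)) :
    List (Perm {x // f x = v}) :=
  (L.filter fun s => fiberTag s = v).map fun s => fiberPerm f v s.1.1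

omit [Fintype W] in
theorem prod_fiberList {f : E → W} (v : W) (L : List (FiberCycle k f)) :
    (fiberList v L).prod = fiberPerm f v (L.map fun s => s.1.1).prod := by
  rw [← prod_map_fiberPerm v (by
    intro s hs
    obtain ⟨t, -, rfl⟩ := List.mem_map.1 hs
    exact t.2), fiberList]
  induction L with
  | nil => rfl
  | cons s L ih =>
    rw [List.filter_cons]
    by_cases h : fiberTag s = v
    · simp [h, ih]
    · simp [h, ih, fiberPerm_eq_one s h]

omit [Fintype W] in
theorem orb_fiberList {f : E → W} (v : W) (L : List (FiberCycle k f)) :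
    orb (fiberList v L) = orb ((L.map fun s => s.1.1).map (fiberPerm f v)) := by
  rw [fiberList]
  induction L with
  | nil => rfl
  | cons s L ih =>
    rw [List.filter_cons]
    by_cases h : fiberTag s = v
    · simp [h, ih]
    · simp [h, ih, fiberPerm_eq_one s h, cycleSetoid_one]

theorem sum_length_fiberList {f : E → W} (L : List (FiberCycle k f)) :
    ∑ v, (fiberList v L).length = L.length := by
  induction L with
  | nil => simp [fiberList]
  | cons s L ih =>
    have h : ∀ v, (fiberList v (s :: L)).length =
        (fiberList v L).length + if fiberTag s = v then 1 else 0 := by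
      intro v
      simp only [fiberList, List.filter_cons, List.length_map]
      by_cases h : fiberTag s = v <;> simp [h]
    simp [h, Finset.sum_add_distrib, ih]

/-- A product of cycles preserving `f` has blocks of genus zero if and only if the blocks have
genus zero in total. -/
theorem isPlanar_fiberList_iff (hk : 2 ≤ k) {f : E → W} (hf : Function.Surjective f)
    (L : List (FiberCycle k f)) :
    (∀ v, IsPlanar k (fiberList v L)) ↔
      (∀ x y, f x = f y → orb (L.map fun s => s.1.1) x y) ∧
        (k - 1) * L.length + 2 * Fintype.card W =
          Nat.card E + numCycles (L.map fun s => s.1.1).prod := by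
  have hpres : ∀ s ∈ L.map (fun s => s.1.1), ∀ x, f (s x) = f x := by
    intro s hs
    obtain ⟨t, -, rfl⟩ := List.mem_map.1 hs
    exact t.2
  have horb : (∀ v, orb (fiberList v L) = ⊤) ↔
      ∀ x y, f x = f y → orb (L.map fun s => s.1.1) x y := by
    simp only [orb_fiberList, Setoid.eq_top_iff, orb_map_fiberPerm _ hpres]
    exact ⟨fun h x y hxy => h (f y) ⟨x, hxy⟩ ⟨y, rfl⟩,
      fun h v x y => h _ _ (x.2.trans y.2.symm)⟩
  have hlen := sum_length_fiberList L
  have hE : ∑ v, Nat.card {x // f x = v} = Nat.card E := by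
    rw [← Nat.card_congr (Equiv.sigmaFiberEquiv f), Nat.card_sigma]
  have hcyc := numCycles_eq_sum_fiber (preserves_prod hpres)
  have hsum1 : ∑ v, ((k - 1) * (fiberList v L).length + 2) =
      (k - 1) * L.length + 2 * Fintype.card W := by
    rw [Finset.sum_add_distrib, ← Finset.mul_sum, hlen, Finset.sum_const, smul_eq_mul, mul_comm 2]
    rfl
  have hsum2 : ∑ v, (Nat.card {x // f x = v} + numCycles (fiberList v L).prod) =
      Nat.card E + numCycles (L.map fun s => s.1.1).prod := by
    rw [Finset.sum_add_distrib, hE, hcyc]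
    simp only [prod_fiberList]
  rw [← hsum1, ← hsum2, ← horb]
  constructor
  · intro h
    exact ⟨fun v => (h v).1, Finset.sum_congr rfl fun v _ => (h v).2⟩
  · rintro ⟨h1, h2⟩ v
    refine ⟨h1 v, ?_⟩
    refine ((Finset.sum_eq_sum_iff_of_le fun v _ => ?_).1 h2.symm v (Finset.mem_univ v)).symm
    obtain ⟨x, hx⟩ := hf v
    have : Nonempty {x // f x = v} := ⟨⟨x, hx⟩⟩
    have hrh := riemann_hurwitz_kCycles hk (L := fiberList v L) (by
      intro s hs
      obtain ⟨t, ht, rfl⟩ := List.mem_map.1 hs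
      exact isKCycle_fiberPerm t (by simpa using (List.mem_filter.1 ht).2))
    rw [h1 v, classCount_top] at hrh
    omega

end

/-! ### Marking points with prescribed return times -/

section

variable {k : ℕ}

/-- First-return data are realised by a tower over the marked points, in which a point climbs
from level to level and is returned from the top level. -/
theorem exists_tower (r : Perm (Fin k)) (i : Fin k → ℕ+) :
    ∃ (T : Type) (_ : Fintype T) (τ : Perm T) (ι : Fin k ↪ T), FirstReturn τ ι r i := by
  let T : Type := {q : Fin k × ℕ // q.2 < (i q.1 : ℕ)}
  have : Finite T := Finite.of_injective
    (fun q : T => (⟨q.1.1, ⟨q.1.2, q.2⟩⟩ : Σ e, Fin (i e))) fun ⟨⟨e, m⟩, h⟩ ⟨⟨e', m'⟩, h'⟩ heq => by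
      simp only [Sigma.mk.injEq] at heq
      obtain ⟨rfl, h2⟩ := heq
      have h3 := congrArg Fin.val (eq_of_heq h2)
      simp only at h3
      subst h3
      rfl
  let next : T → T := fun q =>
    if h : q.1.2 + 1 < (i q.1.1 : ℕ) then ⟨(q.1.1, q.1.2 + 1), h⟩ else ⟨(r q.1.1, 0), (i _).pos⟩
  have hnext : Function.Surjective next := by
    rintro ⟨⟨e, m⟩, h⟩
    rcases m with _ | m
    · refine ⟨⟨(r⁻¹ e, i (r⁻¹ e) - 1), Nat.sub_lt (i _).pos one_pos⟩, ?_⟩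
      have hnot : ¬ ((i (r⁻¹ e) : ℕ) - 1 + 1 < i (r⁻¹ e)) := by omega
      simp only [next, dif_neg hnot]
      exact Subtype.ext (Prod.ext (by simp) rfl)
    · exact ⟨⟨(e, m), Nat.lt_of_succ_lt h⟩, by simp only [next, dif_pos h]⟩
  let τ : Perm T := Equiv.ofBijective next (Finite.surjective_iff_bijective.1 hnext)
  let ι : Fin k ↪ T := ⟨fun e => ⟨(e, 0), (i e).pos⟩, fun e e' h => by
    simpa using congrArg Subtype.val h⟩
  have hpow : ∀ e m, (h : m < (i e : ℕ)) → (τ ^ m) (ι e) = ⟨(e, m), h⟩ := by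
    intro e m h
    induction m with
    | zero => rfl
    | succ m ih =>
      rw [pow_succ', Perm.mul_apply, ih (by omega)]
      change next _ = _
      simp only [next, dif_pos h]
  refine ⟨T, Fintype.ofFinite T, τ, ι, ⟨fun e => ?_, ?_⟩⟩
  · obtain ⟨m, hm⟩ : ∃ m, (i e : ℕ) = m + 1 := Nat.exists_eq_succ_of_ne_zero (i e).ne_zero
    rw [hm, pow_succ', Perm.mul_apply, hpow e m (by omega)]
    change next _ = _
    simp only [next, dif_neg (show ¬ m + 1 < (i e : ℕ) by omega)]
    rfl
  · rintro e m h1 h2 ⟨e', he'⟩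
    rw [hpow e m h2] at he'
    have : (0 : ℕ) = m := congrArg (fun q : T => q.1.2) he'
    omega

theorem isCycleOn_cycleClass {E : Type} [Fintype E] (π : Perm E) (x : E) :
    π.IsCycleOn (cycleClass π x) := by
  refine ⟨⟨fun y hy => ?_, π.injective.injOn, fun y hy => ⟨π⁻¹ y, ?_, by simp⟩⟩, ?_⟩
  · rw [Finset.mem_coe, mem_cycleClass] at hy ⊢
    exact Perm.sameCycle_apply_right.2 hy
  · rw [Finset.mem_coe, mem_cycleClass] at hy ⊢
    refine Perm.sameCycle_apply_right.1 ?_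
    rwa [← Perm.mul_apply, mul_inv_cancel, Perm.one_apply]
  · intro y hy z hz
    rw [Finset.mem_coe, mem_cycleClass] at hy hz
    exact hy.symm.trans hz

theorem pow_apply_eq_iff {E E' : Type} [Fintype E] [Fintype E'] {π : Perm E} {π' : Perm E'} {x : E}
    {x' : E'} (h : (cycleClass π x).card = (cycleClass π' x').card) {m m' : ℕ} :
    (π ^ m) x = (π ^ m') x ↔ (π' ^ m) x' = (π' ^ m') x' := by
  rw [(isCycleOn_cycleClass π x).pow_apply_eq_pow_apply (self_mem_cycleClass π x),
    (isCycleOn_cycleClass π' x').pow_apply_eq_pow_apply (self_mem_cycleClass π' x'), h]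

theorem omega_inv (w : Perm (Fin k)) (i : Fin k → ℕ+) (e : Fin k) :
    omega i (⟦e⟧ : Cycles w⁻¹) = omega i (⟦e⟧ : Cycles w) := by
  classical
  rw [omega, omega]
  refine Finset.sum_congr ?_ fun _ _ => rfl
  ext e'
  simp only [Finset.mem_filter, Finset.mem_univ, true_and]
  rw [Quotient.eq, Quotient.eq]
  exact Perm.sameCycle_inv

variable {E : Type} [Fintype E] [DecidableEq E]

omit [DecidableEq E] in
/-- A marking is determined, and may be prescribed, on one edge for each white vertex. -/
theorem exists_marking {w : Perm (Fin k)} {i : Fin k → ℕ+} {π : Perm E} {f : E → Cycles w}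
    (hf : ∀ x, f (π x) = f x) (p : Cycles w → E) (hp : ∀ v, f (p v) = v)
    (hcard : ∀ v, (cycleClass π (p v)).card = omega i v) :
    ∃ ι : Fin k ↪ E, FirstReturn π ι w⁻¹ i ∧ (∀ e, f (ι e) = ⟦e⟧) ∧ ∀ v, ι v.out = p v := by
  -- The cycle of `π` through `p v` is as long as that of the tower through `ι₀ v.out`, so the marked
  -- points of the tower can be copied to it.
  obtain ⟨T, _, τ, ι₀, h₀⟩ := exists_tower w⁻¹ i
  have hsame : ∀ e, ∃ m : ℕ, (τ ^ m) (ι₀ (⟦e⟧ : Cycles w).out) = ι₀ e := by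
    intro e
    have h1 : w.SameCycle (⟦e⟧ : Cycles w).out e := Quotient.mk_out (s := cycleSetoid w) e
    exact (h₀.sameCycle_map (Perm.sameCycle_inv.2 h1)).exists_nat_pow_eq
  choose m hm using hsame
  have hcard' : ∀ v : Cycles w, (cycleClass τ (ι₀ v.out)).card = (cycleClass π (p v)).card := by
    intro v
    rw [h₀.card_cycleClass_eq_omega, omega_inv, Quotient.out_eq, hcard]
  have hfpow : ∀ (N : ℕ) x, f ((π ^ N) x) = f x := by
    intro N x
    induction N with
    | zero => rfl
    | succ N ih => rw [pow_succ', Perm.mul_apply, hf, ih]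
  -- Powers of `π` on the chosen points move like powers of the tower on the base points.
  have key : ∀ (v : Cycles w) (N N' : ℕ),
      (τ ^ N) (ι₀ v.out) = (τ ^ N') (ι₀ v.out) ↔ (π ^ N) (p v) = (π ^ N') (p v) :=
    fun v N N' => pow_apply_eq_iff (hcard' v)
  have hfι : ∀ e, f ((π ^ m e) (p ⟦e⟧)) = ⟦e⟧ := fun e => by rw [hfpow, hp]
  have hreturn : ∀ (N : ℕ) (e e' : Fin k), (⟦e⟧ : Cycles w) = ⟦e'⟧ →
      ((π ^ N) ((π ^ m e) (p ⟦e⟧)) = (π ^ m e') (p ⟦e'⟧) ↔ (τ ^ N) (ι₀ e) = ι₀ e') := by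
    intro N e e' hee
    rw [← hm e, ← hm e', ← hee, ← Perm.mul_apply, ← Perm.mul_apply, ← pow_add, ← pow_add, key]
  let ι : Fin k ↪ E := ⟨fun e => (π ^ m e) (p ⟦e⟧), fun e e' h => by
    have hee : (⟦e⟧ : Cycles w) = ⟦e'⟧ := by
      rw [← hfι e, ← hfι e']
      exact congrArg f h
    exact ι₀.injective ((hreturn 0 e e' hee).1 h)⟩
  refine ⟨ι, ⟨fun e => ?_, ?_⟩, hfι, fun v => ?_⟩
  · have hee : (⟦e⟧ : Cycles w) = ⟦w⁻¹ e⟧ :=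
      Quotient.sound (Perm.sameCycle_inv.1 (cycleSetoid_apply w⁻¹ e))
    exact (hreturn _ e _ hee).2 (h₀.pow_apply e)
  · rintro e N h1 h2 ⟨e', he'⟩
    have hee : (⟦e⟧ : Cycles w) = ⟦e'⟧ := by
      rw [← hfι e, ← hfι e']
      have := congrArg f he'
      rw [hfpow] at this
      exact this.symm
    exact h₀.not_mem e N h1 h2 ⟨e', ((hreturn N e e' hee).1 he'.symm).symm⟩
  · have h1 := hm v.out
    have h2 := (key v (m v.out) 0).1 (by rwa [Quotient.out_eq] at h1)
    change (π ^ m v.out) (p ⟦v.out⟧) = p v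
    rw [Quotient.out_eq]
    exact h2

omit [Fintype E] [DecidableEq E] in
theorem marking_unique {w : Perm (Fin k)} {i : Fin k → ℕ+} {π : Perm E} {ι ι' : Fin k ↪ E}
    (h : FirstReturn π ι w⁻¹ i) (h' : FirstReturn π ι' w⁻¹ i)
    (heq : ∀ v : Cycles w, ι v.out = ι' v.out) : ι = ι' := by
  ext e
  have h1 : w.SameCycle (⟦e⟧ : Cycles w).out e := Quotient.mk_out (s := cycleSetoid w) e
  obtain ⟨m, hm⟩ := (Perm.sameCycle_inv.2 h1).exists_nat_pow_eq
  rw [← hm]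
  clear hm
  induction m with
  | zero => exact heq _
  | succ m ih => rw [pow_succ', Perm.mul_apply, ← h.pow_apply, ← h'.pow_apply, ih]

open scoped Classical in
/-- Marking points with return times `i` amounts to marking, for each white vertex `v`, one point on
a cycle of length `ω(v)`. -/
theorem sum_markings {w : Perm (Fin k)} {i : Fin k → ℕ+} {π : Perm E} {f : E → Cycles w}
    (hf : ∀ x, f (π x) = f x) :
    ∑ ι : Fin k ↪ E, (if FirstReturn π ι w⁻¹ i ∧ ∀ e, f (ι e) = ⟦e⟧ then
      restWeight π (Finset.univ.map ι) else 0) =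
    ∏ v : Cycles w, ∑ x : {x // f x = v},
      if (cycleClass (fiberPerm f v π) x).card = omega i v then
        restWeight (fiberPerm f v π) {x} else 0 := by
  rw [Finset.prod_univ_sum, Fintype.piFinset_univ]
  simp only [Finset.prod_ite_zero, Finset.mem_univ, true_implies]
  have hsize : ∀ v, ∀ x : {x // f x = v},
      (cycleClass (fiberPerm f v π) x).card = (cycleClass π (x : E)).card := fun v x => by
    rw [← map_cycleClass_fiberPerm hf, Finset.card_map]
  simp only [hsize]
  rw [← Finset.sum_filter, ← Finset.sum_filter]
  have hout : ∀ {ι : Fin k ↪ E}, (∀ e, f (ι e) = ⟦e⟧) → ∀ v : Cycles w, f (ι v.out) = v :=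
    fun h v => by rw [h, Quotient.out_eq]
  refine Finset.sum_bij (fun ι hι v => ⟨ι v.out, hout (Finset.mem_filter.1 hι).2.2 v⟩)
    ?_ ?_ ?_ ?_
  · intro ι hι
    obtain ⟨h1, h2⟩ := (Finset.mem_filter.1 hι).2
    refine Finset.mem_filter.2 ⟨Finset.mem_univ _, fun v => ?_⟩
    rw [h1.card_cycleClass_eq_omega, omega_inv, Quotient.out_eq]
  · intro ι hι ι' hι' heq
    refine marking_unique (Finset.mem_filter.1 hι).2.1 (Finset.mem_filter.1 hι').2.1 fun v => ?_
    exact congrArg Subtype.val (congrFun heq v)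
  · intro p hp
    obtain ⟨ι, h1, h2, h3⟩ := exists_marking hf (fun v => (p v : E)) (fun v => (p v).2)
      (Finset.mem_filter.1 hp).2
    exact ⟨ι, Finset.mem_filter.2 ⟨Finset.mem_univ _, h1, h2⟩,
      funext fun v => Subtype.ext (h3 v)⟩
  · intro ι hι
    obtain ⟨h1, h2⟩ := (Finset.mem_filter.1 hι).2
    refine restWeight_eq_prod_fiber hf (fun v => ⟨ι v.out, hout h2 v⟩) (fun v => by simp) ?_
    intro v x hx hxv
    obtain ⟨e, -, rfl⟩ := Finset.mem_map.1 hx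
    apply h1.sameCycle_map
    rw [h2] at hxv
    rw [← hxv]
    exact Perm.sameCycle_inv.2 (Quotient.mk_out (s := cycleSetoid w) e)

end

/-! ### Removing the first factor of a planar factorisation -/

section

variable {k : ℕ}

theorem sum_ite_forall {Y M : Type} [Fintype Y] [AddCommMonoid M] {P : Y → Prop}
    [Fintype {y // P y}] (J : ℕ) [DecidablePred fun τ : Fin J → Y => ∀ a, P (τ a)]
    (g : (Fin J → Y) → M) :
    ∑ τ : Fin J → Y, (if ∀ a, P (τ a) then g τ else 0) =
      ∑ τ : Fin J → {y // P y}, g fun a => (τ a).1 := by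
  rw [← Finset.sum_filter]
  refine (Finset.sum_bij (fun (τ : Fin J → {y // P y}) _ a => (τ a).1) ?_ ?_ ?_ ?_).symm
  · intro τ _
    exact Finset.mem_filter.2 ⟨Finset.mem_univ _, fun a => (τ a).2⟩
  · intro τ _ τ' _ h
    exact funext fun a => Subtype.ext (congrFun h a)
  · intro τ hτ
    exact ⟨fun a => ⟨τ a, (Finset.mem_filter.1 hτ).2 a⟩, Finset.mem_univ _, rfl⟩
  · intro τ _
    rfl

open scoped Classical in
/-- Forests with given return times split into pointed planar factorisations, one on each block of
a partition indexed by the white vertices. -/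
theorem sum_forests (hk : 2 ≤ k) {E : Type} [Fintype E] [DecidableEq E] (w : Perm (Fin k))
    (i : Fin k → ℕ+) (J : ℕ) :
    (∑ τ : Fin J → KCycle k E, ∑ ι : Fin k ↪ E,
      if FirstReturn (word τ).prod ι w⁻¹ i ∧ IsForest k ι (word τ) w⁻¹ then
        restWeight (word τ).prod (Finset.univ.map ι) else 0) =
    ∑ f : E → Cycles w, ∑ τ : Fin J → FiberCycle k f,
      ∏ v, pointedWeight k (omega i v) (fiberList v (List.ofFn τ)) := by
  have hterm : ∀ (τ : Fin J → KCycle k E) (ι : Fin k ↪ E),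
      (if FirstReturn (word τ).prod ι w⁻¹ i ∧ IsForest k ι (word τ) w⁻¹ then
        restWeight (word τ).prod (Finset.univ.map ι) else 0) =
      ∑ f : E → Cycles w, if ∀ a, ∀ x, f ((τ a).1 x) = f x then
        (if (∀ x y, f x = f y → orb (word τ) x y) ∧ (k - 1) * J + 2 * Fintype.card (Cycles w) =
            Nat.card E + numCycles (word τ).prod then
          (if FirstReturn (word τ).prod ι w⁻¹ i ∧ ∀ e, f (ι e) = ⟦e⟧ then
            restWeight (word τ).prod (Finset.univ.map ι) else 0) else 0) else 0 := by
    intro τ ι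
    have hmem : ∀ f : E → Cycles w,
        (∀ a, ∀ x, f ((τ a).1 x) = f x) ↔ ∀ s ∈ word τ, ∀ x, f (s x) = f x := by
      intro f
      simp [word, List.mem_ofFn]
    simp only [← ite_and]
    by_cases hFR : FirstReturn (word τ).prod ι w⁻¹ i
    swap
    · simp [hFR]
    have hiff := isForest_iff_exists hFR
    rw [length_word, numCycles, Nat.card_eq_fintype_card] at hiff
    by_cases hF : IsForest k ι (word τ) w⁻¹
    · obtain ⟨f, h1, h2, h3, h4⟩ := hiff.1 hF
      rw [if_pos ⟨hFR, hF⟩, Finset.sum_eq_single f, if_pos ⟨(hmem f).2 h1, ⟨h3, h4⟩, hFR, h2⟩]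
      · intro f' _ hne
        refine if_neg ?_
        rintro ⟨h1', -, -, h2'⟩
        exact hne (forest_naming_unique ((hmem f').1 h1') h2 h2' h3).symm
      · simp
    · rw [if_neg fun h => hF h.2, Finset.sum_eq_zero]
      intro f _
      refine if_neg ?_
      rintro ⟨h1, h2, -, h4⟩
      exact hF (hiff.2 ⟨f, (hmem f).1 h1, h4, h2.1, h2.2⟩)
  -- A forest determines the map `f` from the points to its blocks, so summing over `f` is harmless.
  simp only [hterm]
  have hswap : ∀ g : (Fin J → KCycle k E) → (Fin k ↪ E) → (E → Cycles w) → PolyP,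
      ∑ τ, ∑ ι, ∑ f, g τ ι f = ∑ f, ∑ τ, ∑ ι, g τ ι f := by
    intro g
    rw [Finset.sum_congr rfl fun τ _ => Finset.sum_comm, Finset.sum_comm]
  rw [hswap]
  refine Finset.sum_congr rfl fun f _ => ?_
  have hpull : ∀ (P : Prop) [Decidable P] (g : (Fin k ↪ E) → PolyP),
      ∑ ι, (if P then g ι else 0) = if P then ∑ ι, g ι else 0 := by
    intro P _ g
    split_ifs <;> simp
  simp only [hpull]
  rw [sum_ite_forall (P := fun s : KCycle k E => ∀ x, f (s.1 x) = f x)]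
  refine Finset.sum_congr rfl fun τ _ => ?_
  have hword : word (fun a => (τ a).1) = (List.ofFn τ).map fun s => s.1.1 := by
    simp [word, List.map_ofFn, Function.comp_def]
  have hpres : ∀ x, f ((word fun a => (τ a).1).prod x) = f x := by
    refine preserves_prod fun s hs => ?_
    rw [hword] at hs
    obtain ⟨t, -, rfl⟩ := List.mem_map.1 hs
    exact t.2
  rw [sum_markings hpres]
  simp only [pointedWeight, prod_fiberList, ← hword]
  rw [Finset.prod_ite_zero]
  by_cases hf : Function.Surjective f
  · have hiff := isPlanar_fiberList_iff hk hf (List.ofFn τ)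
    rw [← hword, List.length_ofFn] at hiff
    by_cases hp : ∀ v, IsPlanar k (fiberList v (List.ofFn τ))
    · rw [if_pos (hiff.1 hp), if_pos fun v _ => hp v]
    · rw [if_neg fun h => hp (hiff.2 h), if_neg fun h => hp fun v => h v (Finset.mem_univ v)]
  · -- If a block is empty, then both sides vanish.
    obtain ⟨v, hv⟩ := not_forall.1 hf
    have : IsEmpty {x // f x = v} := ⟨fun x => hv ⟨x, x.2⟩⟩
    rw [Finset.prod_eq_zero (Finset.mem_univ v) (by simp)]
    simp

/-- The exponential generating function in `u` of pointed planar factorisations on `m` points. -/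
noncomputable def pointedUSeries (k ω m : ℕ) : PowerSeries PolyP :=
  PowerSeries.mk fun j => (1 / (j.factorial : ℚ)) • pointedSum k ω (Fin m) j

/-- The exponential generating function of pointed planar factorisations. -/
noncomputable def pointedSeries (k ω : ℕ) : PowerSeries (PowerSeries PolyP) :=
  PowerSeries.mk fun m => (1 / (m.factorial : ℚ)) • pointedUSeries k ω m

theorem wordSeries_fiberTag {E W : Type} [Fintype E] [DecidableEq E] [DecidableEq W]
    (k ω : ℕ) (f : E → W) (v : W) :
    wordSeries (fiberTag (k := k) (f := f)) v
      (fun l => pointedWeight k ω (l.map fun s => fiberPerm f v s.1.1)) =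
      pointedUSeries k ω (Fintype.card {x // f x = v}) := by
  ext1 j
  rw [wordSeries, pointedUSeries, PowerSeries.coeff_mk, PowerSeries.coeff_mk,
    ← pointedSum_congr (Fintype.equivFin _), pointedSum,
    ← (Equiv.arrowCongr (Equiv.refl (Fin j)) (fiberCycleEquiv k f v)).sum_comp]
  congr 1
  refine Finset.sum_congr rfl fun L _ => ?_
  rw [List.map_ofFn]
  rfl

theorem sum_fiber_words {W : Type} [Fintype W] [DecidableEq W] (k n J : ℕ) (ω : W → ℕ) :
    (∑ f : Fin n → W, ∑ τ : Fin J → FiberCycle k f,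
      ∏ v, pointedWeight k (ω v) (fiberList v (List.ofFn τ))) =
    ((n.factorial : ℚ) * (J.factorial : ℚ)) •
      PowerSeries.coeff J (PowerSeries.coeff n (∏ v, pointedSeries k (ω v))) := by
  have h1 : ∀ f : Fin n → W, (∑ τ : Fin J → FiberCycle k f,
      ∏ v, pointedWeight k (ω v) (fiberList v (List.ofFn τ))) =
      (J.factorial : ℚ) • PowerSeries.coeff J
        (∏ v, pointedUSeries k (ω v) (Fintype.card {x // f x = v})) := by
    intro f
    have h := sum_prod_filter_ofFn (R := PolyP) (fiberTag (k := k) (f := f)) J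
      (fun v l => pointedWeight k (ω v) (l.map fun s => fiberPerm f v s.1.1))
    simp only [wordSeries_fiberTag] at h
    exact h
  simp only [h1]
  have h2 := sum_prod_card_fiber (R := PowerSeries PolyP) n (fun v m => pointedUSeries k (ω v) m)
  rw [← Finset.smul_sum, ← map_sum, h2, mul_comm, mul_smul]
  congr 1

theorem FirstReturn.le_card {n : ℕ} {π : Perm (Fin n)} {ι : Fin k ↪ Fin n} {r : Perm (Fin k)}
    {i : Fin k → ℕ+} (h : FirstReturn π ι r i) (e : Fin k) : (i e : ℕ) ≤ n := by
  classical
  have h1 := h.card_cycleClass e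
  have h2 : (i e : ℕ) ≤ ∑ e' with r.SameCycle e e', (i e' : ℕ) :=
    Finset.single_le_sum (f := fun e' => (i e' : ℕ)) (fun _ _ => Nat.zero_le _)
      (Finset.mem_filter.2 ⟨Finset.mem_univ _, Perm.SameCycle.refl _ _⟩)
  have h3 := Finset.card_le_univ (cycleClass π (ι e))
  rw [Fintype.card_fin] at h3
  omega

/-- The recursion for planar factorisations: the first factor, together with the cycles of the
product of the other factors, forms a plane tree. -/
theorem factorial_smul_planarSum (hk : 2 ≤ k) [Fintype (LabelledPlaneTree k)] (n J : ℕ)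
    (I : Finset (Fin k → ℕ+)) (hI : ∀ i : Fin k → ℕ+, (∀ e, (i e : ℕ) ≤ n) → i ∈ I) :
    k.factorial • planarSum k (Fin n) (J + 1) =
      ∑ t : LabelledPlaneTree k, ∑ i ∈ I,
        (∏ v : Cycles t.black, (MvPolynomial.X (omega i v) : PolyP)) *
          (((n.factorial : ℚ) * (J.factorial : ℚ)) • PowerSeries.coeff J (PowerSeries.coeff n
            (∏ v : Cycles t.white, pointedSeries k (omega i v)))) := by
  classical
  let G : Perm (Fin k) → Perm (Fin k) → PolyP := fun b r => ∑ i ∈ I,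
    (∏ v : Cycles b, (MvPolynomial.X (omega i v) : PolyP)) *
      ∑ τ : Fin J → KCycle k (Fin n), ∑ ι : Fin k ↪ Fin n,
        if FirstReturn (word τ).prod ι r i ∧ IsForest k ι (word τ) r then
          restWeight (word τ).prod (Finset.univ.map ι) else 0
  have hG : ∀ t : LabelledPlaneTree k, G t.black t.white⁻¹ = ∑ i ∈ I,
      (∏ v : Cycles t.black, (MvPolynomial.X (omega i v) : PolyP)) *
          (((n.factorial : ℚ) * (J.factorial : ℚ)) • PowerSeries.coeff J (PowerSeries.coeff n
            (∏ v : Cycles t.white, pointedSeries k (omega i v)))) := by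
    intro t
    refine Finset.sum_congr rfl fun i _ => ?_
    rw [sum_forests hk, sum_fiber_words]
  rw [← Finset.sum_congr rfl fun t _ => hG t, sum_labelledPlaneTree hk, planarSum, sum_fin_succ_fun]
  have h1 := factorial_smul_sum_kCycle (k := k) (E := Fin n) fun σ =>
    ∑ τ : Fin J → KCycle k (Fin n),
      if IsPlanar k (σ :: word τ) then cycleWeight (σ * (word τ).prod) else 0
  have h2 : ∀ (σ : KCycle k (Fin n)) (τ : Fin J → KCycle k (Fin n)),
      word (Fin.cons σ τ : Fin (J + 1) → KCycle k (Fin n)) = σ.1 :: word τ := by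
    intro σ τ
    simp [word, List.ofFn_succ]
  simp only [h2, List.prod_cons]
  rw [h1]
  refine Finset.sum_congr rfl fun c _ => ?_
  -- Each summand is spread over all first-return data, only one of which is that of the marking.
  have hterm : ∀ (ι : Fin k ↪ Fin n) (τ : Fin J → KCycle k (Fin n)),
      (if IsPlanar k (c.1.viaFintypeEmbedding ι :: word τ) then
        cycleWeight (c.1.viaFintypeEmbedding ι * (word τ).prod) else 0) =
      ∑ r : Perm (Fin k), ∑ i ∈ I, if numCycles (c.1 * r) + numCycles r = k + 1 then
        (∏ v : Cycles (c.1 * r), (MvPolynomial.X (omega i v) : PolyP)) *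
          (if FirstReturn (word τ).prod ι r i ∧ IsForest k ι (word τ) r then
            restWeight (word τ).prod (Finset.univ.map ι) else 0) else 0 := by
    intro ι τ
    obtain ⟨r, i, h⟩ := FirstReturn.exists_firstReturn (word τ).prod ι
    rw [Finset.sum_eq_single r, Finset.sum_eq_single i, h.cycleWeight_mul]
    · have hiff := isPlanar_cons_iff hk (fun s hs => isKCycle_of_mem_word hs) c.2 h
      by_cases hc : numCycles (c.1 * r) + numCycles r = k + 1
      · by_cases hF : IsForest k ι (word τ) r
        · rw [if_pos (hiff.2 ⟨hc, hF⟩), if_pos hc, if_pos ⟨h, hF⟩]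
        · rw [if_neg fun hp => hF (hiff.1 hp).2, if_pos hc, if_neg fun hp => hF hp.2, mul_zero]
      · rw [if_neg fun hp => hc (hiff.1 hp).1, if_neg hc]
    · intro i' _ hne
      rw [if_neg (fun hp => hne (hp.1.unique h).2 :
        ¬ (FirstReturn (word τ).prod ι r i' ∧ IsForest k ι (word τ) r)), mul_zero, ite_self]
    · exact fun hi => absurd (hI i h.le_card) hi
    · intro r' _ hne
      refine Finset.sum_eq_zero fun i' _ => ?_
      rw [if_neg (fun hp => hne (hp.1.unique h).1 :
        ¬ (FirstReturn (word τ).prod ι r' i' ∧ IsForest k ι (word τ) r')), mul_zero, ite_self]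
    · simp
  simp only [hterm]
  have hswap : ∀ g : (Fin k ↪ Fin n) → (Fin J → KCycle k (Fin n)) → Perm (Fin k) →
      (Fin k → ℕ+) → PolyP,
      ∑ ι, ∑ τ, ∑ r, ∑ i ∈ I, g ι τ r i = ∑ r, ∑ i ∈ I, ∑ τ, ∑ ι, g ι τ r i := by
    intro g
    rw [Finset.sum_comm, Finset.sum_congr rfl fun τ _ => Finset.sum_comm, Finset.sum_comm]
    refine Finset.sum_congr rfl fun r _ => ?_
    rw [Finset.sum_congr rfl fun τ _ => Finset.sum_comm, Finset.sum_comm]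
  rw [hswap]
  refine Finset.sum_congr rfl fun r _ => ?_
  split_ifs
  · refine Finset.sum_congr rfl fun i _ => ?_
    simp only [Finset.mul_sum]
  · simp

end

/-! ### Isomorphism classes of plane trees -/

section

variable {k : ℕ}

theorem omega_conj (g σ : Perm (Fin k)) (i : Fin k → ℕ+) (e : Fin k) :
    omega i (⟦g e⟧ : Cycles (g * σ * g⁻¹)) = omega (fun e => i (g e)) (⟦e⟧ : Cycles σ) := by
  classical
  rw [omega, omega, Finset.sum_filter, Finset.sum_filter, ← Equiv.sum_comp g]
  refine Finset.sum_congr rfl fun e' _ => ?_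
  have h : (⟦g e'⟧ : Cycles (g * σ * g⁻¹)) = ⟦g e⟧ ↔ (⟦e'⟧ : Cycles σ) = ⟦e⟧ := by
    rw [Quotient.eq, Quotient.eq]
    change (g * σ * g⁻¹).SameCycle (g e') (g e) ↔ σ.SameCycle e' e
    rw [Perm.sameCycle_conj]
    simp
  by_cases h' : (⟦e'⟧ : Cycles σ) = ⟦e⟧
  · rw [if_pos h', if_pos (h.2 h')]
  · rw [if_neg h', if_neg fun h'' => h' (h.1 h'')]

theorem prod_cycles_conj {M : Type} [CommMonoid M] (g σ : Perm (Fin k)) (i : Fin k → ℕ+)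
    (φ : ℕ → M) :
    ∏ v : Cycles (g * σ * g⁻¹), φ (omega i v) =
      ∏ v : Cycles σ, φ (omega (fun e => i (g e)) v) := by
  let e : Cycles σ ≃ Cycles (g * σ * g⁻¹) := Quotient.congr g fun a b => by
    change σ.SameCycle a b ↔ (g * σ * g⁻¹).SameCycle (g a) (g b)
    rw [Perm.sameCycle_conj]
    simp
  rw [← e.prod_comp]
  refine Finset.prod_congr rfl fun v _ => ?_
  induction v using Quotient.ind with
  | _ a => exact congrArg φ (omega_conj g σ i a)

theorem treeTerm_conj (Ψ : Series) {s t : LabelledPlaneTree k} (g : Perm (Fin k))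
    (hb : g * s.black * g⁻¹ = t.black) (hw : g * s.white * g⁻¹ = t.white) (i : Fin k → ℕ+) :
    treeTerm Ψ t i = treeTerm Ψ s fun e => i (g e) := by
  rw [treeTerm, treeTerm, ← hb, ← hw,
    prod_cycles_conj g s.black i fun j => PowerSeries.C (MvPolynomial.X (Var.p j) : Coeffs),
    prod_cycles_conj g s.white i fun j => (j : ℚ) • partialDeriv (Var.p j) Ψ]

theorem numCycles_conj (g σ : Perm (Fin k)) : numCycles (g * σ * g⁻¹) = numCycles σ := by
  have h := cycleSets_permCongr g σ
  rw [← card_cycleSets, ← card_cycleSets, show g * σ * g⁻¹ = Equiv.permCongr g σ from rfl, h,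
    Finset.card_map]

/-- Relabelling the edges of a plane tree. -/
def LabelledPlaneTree.relabel (g : Perm (Fin k)) (t : LabelledPlaneTree k) :
    LabelledPlaneTree k where
  black := g * t.black * g⁻¹
  white := g * t.white * g⁻¹
  connected := by
    have h := (orb_map_conj g _).2 t.orb_eq_top
    rw [← isPretransitive_closure_iff] at h
    convert h
    all_goals
      ext s
      simp [show ∀ s, Equiv.permCongr g s = g * s * g⁻¹ from fun _ => rfl]
  card_vertices := by rw [numCycles_conj, numCycles_conj, t.card_vertices]

theorem LabelledPlaneTree.ext {s t : LabelledPlaneTree k} (hb : s.black = t.black)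
    (hw : s.white = t.white) : s = t := by
  cases s
  cases t
  simp only at hb hw
  subst hb hw
  rfl

open scoped Classical in
/-- An isomorphism class of plane trees has `k! / |aut|` labellings. -/
theorem card_labelledPlaneTree [Fintype (LabelledPlaneTree k)] (s : LabelledPlaneTree k) :
    (Finset.univ.filter fun t : LabelledPlaneTree k => (⟦t⟧ : PlaneTree k) = ⟦s⟧).card *
      Nat.card s.aut = k.factorial := by
  -- Orbit and stabiliser of the pair of rotations under simultaneous conjugation.
  let x : Perm (Fin k) × Perm (Fin k) := (s.black, s.white)
  have h := MulAction.card_orbit_mul_card_stabilizer_eq_card_group (ConjAct (Perm (Fin k))) x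
  rw [← Nat.card_eq_fintype_card, ← Nat.card_eq_fintype_card, ← Nat.card_eq_fintype_card] at h
  have hG : Nat.card (ConjAct (Perm (Fin k))) = k.factorial := by
    rw [Nat.card_congr ConjAct.ofConjAct.toEquiv, Nat.card_eq_fintype_card, Fintype.card_perm,
      Fintype.card_fin]
  rw [← hG, ← h]
  congr 1
  · rw [← Fintype.card_subtype, ← Nat.card_eq_fintype_card]
    refine Nat.card_congr (Equiv.ofBijective (fun t => ⟨(t.1.black, t.1.white), ?_⟩) ⟨?_, ?_⟩)
    · obtain ⟨g, hb, hw⟩ := Quotient.exact t.2.symm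
      exact ⟨ConjAct.toConjAct g, Prod.ext hb hw⟩
    · intro t t' heq
      have h1 := congrArg Subtype.val heq
      exact Subtype.ext (LabelledPlaneTree.ext (Prod.ext_iff.1 h1).1 (Prod.ext_iff.1 h1).2)
    · rintro ⟨_, g, rfl⟩
      refine ⟨⟨s.relabel (ConjAct.ofConjAct g), Quotient.sound (Setoid.symm' _ ⟨_, rfl, rfl⟩)⟩, ?_⟩
      rfl
  · refine Nat.card_congr (ConjAct.toConjAct.toEquiv.subtypeEquiv fun g => ?_)
    rw [LabelledPlaneTree.aut, MulAction.mem_stabilizer_iff, Subgroup.mem_centralizer_iff]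
    constructor
    · intro hg
      have hb := hg s.black (by simp)
      have hw := hg s.white (by simp)
      refine Prod.ext ?_ ?_
      · change g * s.black * g⁻¹ = s.black
        rw [← hb, mul_inv_cancel_right]
      · change g * s.white * g⁻¹ = s.white
        rw [← hw, mul_inv_cancel_right]
    · intro hg
      have hb : g * s.black * g⁻¹ = s.black := (Prod.ext_iff.1 hg).1
      have hw : g * s.white * g⁻¹ = s.white := (Prod.ext_iff.1 hg).2
      rintro y (rfl | rfl)
      · rw [mul_inv_eq_iff_eq_mul] at hb
        exact hb.symm
      · rw [mul_inv_eq_iff_eq_mul] at hw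
        exact hw.symm

/-- A sum over plane trees weighted by `1 / |aut|` is `1 / k!` times the sum over labelled ones. -/
theorem sum_planeTree {M : Type} [AddCommGroup M] [Module ℚ M] [Fintype (LabelledPlaneTree k)]
    (H : LabelledPlaneTree k → M) (hH : ∀ s t : LabelledPlaneTree k, s ≈ t → H s = H t) :
    (k.factorial : ℚ) • ∑ T : PlaneTree k, (1 / (Nat.card T.out.aut : ℚ)) • H T.out =
      ∑ t, H t := by
  classical
  rw [← Finset.sum_fiberwise (s := Finset.univ) (g := fun t => (⟦t⟧ : PlaneTree k)),
    Finset.smul_sum]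
  refine Finset.sum_congr rfl fun T _ => ?_
  have h1 : ∀ t ∈ Finset.univ.filter (fun t : LabelledPlaneTree k => (⟦t⟧ : PlaneTree k) = T),
      H t = H T.out := fun t ht => hH _ _ (by
    have := (Finset.mem_filter.1 ht).2
    rw [← Quotient.out_eq T] at this
    exact Quotient.exact this)
  have h2 := card_labelledPlaneTree T.out
  rw [Quotient.out_eq] at h2
  rw [Finset.sum_congr rfl h1, Finset.sum_const, ← Nat.cast_smul_eq_nsmul ℚ, smul_smul, ← h2]
  congr 1
  have h3 : (Nat.card T.out.aut : ℚ) ≠ 0 := Nat.cast_ne_zero.2 Nat.card_pos.ne'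
  push_cast
  field_simp

end

/-! ### Derivatives of the series -/

/-- No information is lost, so identities in `Coeffs` can be checked on the coefficients in `u`. -/
theorem toUSeries_injective : Function.Injective toUSeries := by
  let e : Var ≃ Option ℕ :=
    { toFun := fun x => match x with
        | Var.u => none
        | Var.p j => some j
      invFun := fun x => match x with
        | none => Var.u
        | some j => Var.p j
      left_inv := fun x => by cases x <;> rfl
      right_inv := fun x => by cases x <;> rfl }
  let ψ : Coeffs ≃ₐ[ℚ] Polynomial PolyP :=
    (MvPolynomial.renameEquiv ℚ e).trans (MvPolynomial.optionEquivLeft ℚ ℕ)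
  have h : toUSeries =
      ((Polynomial.coeToPowerSeries.algHom (R := PolyP) PolyP).restrictScalars ℚ).comp ψ.toAlgHom := by
    apply MvPolynomial.algHom_ext
    intro x
    cases x with
    | u => simp [ψ, e, MvPolynomial.optionEquivLeft_X_none]
    | p j => simp [ψ, e, MvPolynomial.optionEquivLeft_X_some]
  rw [h]
  intro a b hab
  refine ψ.injective (Polynomial.coe_injective PolyP ?_)
  have h' : Polynomial.coeToPowerSeries.algHom PolyP (ψ a) =
    Polynomial.coeToPowerSeries.algHom PolyP (ψ b) := hab
  rwa [Polynomial.coeToPowerSeries.algHom_apply, Polynomial.coeToPowerSeries.algHom_apply,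
    Algebra.algebraMap_self, PowerSeries.map_id] at h'

theorem coeff_toUSeries_pderiv_u (q : Coeffs) (j : ℕ) :
    PowerSeries.coeff j (toUSeries (MvPolynomial.pderiv Var.u q)) =
      (j + 1 : ℚ) • PowerSeries.coeff (j + 1) (toUSeries q) := by
  have h : toUSeries (MvPolynomial.pderiv Var.u q) = PowerSeries.derivative PolyP (toUSeries q) := by
    induction q using MvPolynomial.induction_on with
    | C a =>
      rw [MvPolynomial.pderiv_C, map_zero, ← MvPolynomial.algebraMap_eq, AlgHom.commutes,
        IsScalarTower.algebraMap_apply ℚ PolyP]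
      exact PowerSeries.derivative_C.symm
    | add p q hp hq => simp only [map_add, hp, hq]
    | mul_X p x hp =>
      rw [Derivation.leibniz, map_add, map_mul, Derivation.leibniz, smul_eq_mul, smul_eq_mul,
        smul_eq_mul, smul_eq_mul, map_mul, map_mul, hp]
      congr 2
      cases x with
      | u => simp
      | p j => simp
  rw [h, PowerSeries.coeff_derivative, mul_comm, Algebra.smul_def]
  simp

theorem coeff_toUSeries_pderiv_p (q : Coeffs) (ω j : ℕ) :
    PowerSeries.coeff j (toUSeries (MvPolynomial.pderiv (Var.p ω) q)) =
      MvPolynomial.pderiv ω (PowerSeries.coeff j (toUSeries q)) := by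
  classical
  induction q using MvPolynomial.induction_on generalizing j with
  | C a =>
    rw [MvPolynomial.pderiv_C, map_zero, ← MvPolynomial.algebraMap_eq, AlgHom.commutes,
      IsScalarTower.algebraMap_apply ℚ PolyP, PowerSeries.algebraMap_apply, PowerSeries.coeff_C]
    split_ifs <;> simp
  | add p q hp hq => simp only [map_add, hp, hq]
  | mul_X p x hp =>
    rw [Derivation.leibniz, map_add, map_add, smul_eq_mul, smul_eq_mul, map_mul toUSeries,
      map_mul toUSeries, map_mul toUSeries]
    cases x with
    | u =>
      rw [MvPolynomial.pderiv_X, Pi.single_eq_of_ne (by simp), map_zero, mul_zero, map_zero,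
        toUSeries_u, zero_add, mul_comm]
      cases j with
      | zero => simp
      | succ j => rw [PowerSeries.coeff_succ_mul_X, PowerSeries.coeff_succ_mul_X, hp]
    | p l =>
      rw [toUSeries_p, mul_comm (PowerSeries.C _), PowerSeries.coeff_mul_C, PowerSeries.coeff_mul_C,
        Derivation.leibniz, hp, smul_eq_mul, smul_eq_mul]
      congr 1
      · rw [MvPolynomial.pderiv_X, MvPolynomial.pderiv_X]
        by_cases h : l = ω
        · subst h
          simp
        · rw [Pi.single_eq_of_ne (fun h' => h (Var.p.inj h')), Pi.single_eq_of_ne h]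
          simp
      · ring

/-! ### The partial differential equation -/

section

variable {k : ℕ}

theorem map_toUSeries_pderiv_Phi (hk : 2 ≤ k) (ω : ℕ) :
    PowerSeries.map (toUSeries : Coeffs →+* PowerSeries PolyP)
      ((ω : ℚ) • partialDeriv (Var.p ω) (Phi k)) = pointedSeries k ω := by
  ext1 m
  rw [PowerSeries.coeff_map, map_rat_smul, partialDeriv, PowerSeries.coeff_mk, pointedSeries,
    PowerSeries.coeff_mk, RingHom.coe_coe, map_smul]
  ext1 j
  rw [map_rat_smul, map_rat_smul, coeff_toUSeries_pderiv_p, coeff_toUSeries_Phi hk, Derivation.map_smul,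
    smul_comm, smul_pderiv_planarSum, pointedUSeries, PowerSeries.coeff_mk, smul_smul,
    one_div_mul_one_div]

theorem pointedSum_eq_zero {E : Type} [Fintype E] [DecidableEq E] {ω j : ℕ}
    (h : Fintype.card E < ω) : pointedSum k ω E j = 0 := by
  refine Finset.sum_eq_zero fun L _ => ?_
  rw [pointedWeight]
  split_ifs
  · refine Finset.sum_eq_zero fun x _ => if_neg fun hx => ?_
    have := Finset.card_le_univ (cycleClass (word L).prod x)
    omega
  · rfl

theorem X_pow_dvd_pderiv_Phi (hk : 2 ≤ k) (ω : ℕ) :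
    (PowerSeries.X : Series) ^ ω ∣ (ω : ℚ) • partialDeriv (Var.p ω) (Phi k) := by
  refine PowerSeries.X_pow_dvd_iff.2 fun m hm => toUSeries_injective ?_
  have h := congrArg (PowerSeries.coeff m) (map_toUSeries_pderiv_Phi hk ω)
  rw [PowerSeries.coeff_map] at h
  rw [map_zero]
  refine h.trans ?_
  rw [pointedSeries, PowerSeries.coeff_mk]
  have h0 : pointedUSeries k ω m = 0 := by
    ext1 j
    rw [pointedUSeries, PowerSeries.coeff_mk, pointedSum_eq_zero (by simpa using hm), smul_zero,
      map_zero]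
  rw [h0, smul_zero]

/-- Only index tuples with entries at most `n` contribute to the coefficient of `z ^ n`. -/
theorem coeff_treeTerm_eq_zero (hk : 2 ≤ k) (t : LabelledPlaneTree k) {i : Fin k → ℕ+} {n : ℕ}
    {e : Fin k} (h : n < i e) : PowerSeries.coeff n (treeTerm (Phi k) t i) = 0 := by
  classical
  have h1 : (i e : ℕ) ≤ omega i (⟦e⟧ : Cycles t.white) := by
    rw [omega]
    exact Finset.single_le_sum (f := fun e => (i e : ℕ)) (fun _ _ => Nat.zero_le _)
      (Finset.mem_filter.2 ⟨Finset.mem_univ _, rfl⟩)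
  have h2 : (PowerSeries.X : Series) ^ omega i (⟦e⟧ : Cycles t.white) ∣ treeTerm (Phi k) t i :=
    ((X_pow_dvd_pderiv_Phi hk _).trans
      (Finset.dvd_prod_of_mem (fun w : Cycles t.white => (omega i w : ℚ) •
        partialDeriv (Var.p (omega i w)) (Phi k)) (Finset.mem_univ ⟦e⟧))).trans
      (dvd_mul_left _ _)
  exact PowerSeries.X_pow_dvd_iff.1 h2 n (h.trans_le h1)

theorem coeff_toUSeries_treeTerm (hk : 2 ≤ k) (t : LabelledPlaneTree k) (i : Fin k → ℕ+)
    (n J : ℕ) :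
    PowerSeries.coeff J (toUSeries (PowerSeries.coeff n (treeTerm (Phi k) t i))) =
      (∏ v : Cycles t.black, (MvPolynomial.X (omega i v) : PolyP)) *
        PowerSeries.coeff J (PowerSeries.coeff n
          (∏ v : Cycles t.white, pointedSeries k (omega i v))) := by
  rw [treeTerm, ← map_prod PowerSeries.C, PowerSeries.coeff_C_mul, map_mul toUSeries,
    map_prod toUSeries]
  simp only [toUSeries_p]
  rw [← map_prod PowerSeries.C, PowerSeries.coeff_C_mul]
  congr 2
  simp only [← map_toUSeries_pderiv_Phi hk]
  rw [← map_prod, PowerSeries.coeff_map]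
  rfl

/-- The index tuples with all entries at most `n`. -/
def boundedTuples (k n : ℕ) : Finset (Fin k → ℕ+) :=
  Fintype.piFinset fun _ => (Finset.range n).image Nat.succPNat

theorem mem_boundedTuples {n : ℕ} {i : Fin k → ℕ+} :
    i ∈ boundedTuples k n ↔ ∀ e, (i e : ℕ) ≤ n := by
  rw [boundedTuples, Fintype.mem_piFinset]
  refine forall_congr' fun e => ?_
  rw [Finset.mem_image]
  constructor
  · rintro ⟨a, ha, h⟩
    have := Finset.mem_range.1 ha
    rw [← h, Nat.succPNat_coe]
    omega
  · intro h
    have hpos := (i e).pos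
    exact ⟨i e - 1, Finset.mem_range.2 (by omega), PNat.eq (by rw [Nat.succPNat_coe]; omega)⟩

theorem sum_coeff_treeTerm_eq (n : ℕ) (Ψ : Series) {s t : LabelledPlaneTree k} (h : s ≈ t) :
    ∑ i ∈ boundedTuples k n, PowerSeries.coeff n (treeTerm Ψ s i) =
      ∑ i ∈ boundedTuples k n, PowerSeries.coeff n (treeTerm Ψ t i) := by
  obtain ⟨g, hb, hw⟩ := h
  refine (Finset.sum_equiv (g.arrowCongr (Equiv.refl ℕ+)).symm (fun i => ?_) fun i _ => ?_).symm
  · rw [mem_boundedTuples, mem_boundedTuples]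
    exact (g.forall_congr_right (q := fun e => (i e : ℕ) ≤ n)).symm
  · rw [treeTerm_conj Ψ g hb hw]
    rfl

theorem sum_planeTree_coeff (hk : 2 ≤ k) (n : ℕ) :
    ∑ T : PlaneTree k, (1 / (Nat.card T.out.aut : ℚ)) •
        ∑ i ∈ boundedTuples k n, PowerSeries.coeff n (treeTerm (Phi k) T.out i) =
      PowerSeries.coeff n (partialDeriv Var.u (Phi k)) := by
  classical
  let _ : Fintype (LabelledPlaneTree k) := Fintype.ofFinite _
  have hk0 : (k.factorial : ℚ) ≠ 0 := Nat.cast_ne_zero.2 k.factorial_ne_zero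
  refine smul_right_injective Coeffs hk0 ?_
  simp only
  rw [sum_planeTree (fun t => ∑ i ∈ boundedTuples k n, PowerSeries.coeff n (treeTerm (Phi k) t i))
    fun s t h => sum_coeff_treeTerm_eq n _ h]
  refine toUSeries_injective ?_
  ext1 J
  have h := factorial_smul_planarSum hk n J (boundedTuples k n) fun i hi => mem_boundedTuples.2 hi
  have hn : ((n.factorial : ℚ) * (J.factorial : ℚ)) ≠ 0 := by positivity
  have hJ : ((J : ℚ) + 1) * (1 / ((n.factorial : ℚ) * ((J + 1).factorial : ℚ))) =
      1 / ((n.factorial : ℚ) * (J.factorial : ℚ)) := by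
    rw [Nat.factorial_succ]
    push_cast
    field_simp
  rw [map_smul, map_rat_smul, partialDeriv, PowerSeries.coeff_mk, coeff_toUSeries_pderiv_u,
    coeff_toUSeries_Phi hk, smul_smul ((J : ℚ) + 1), hJ, smul_comm, Nat.cast_smul_eq_nsmul, h,
    map_sum, map_sum, Finset.smul_sum]
  refine Finset.sum_congr rfl fun t _ => ?_
  rw [map_sum, map_sum, Finset.smul_sum]
  refine Finset.sum_congr rfl fun i _ => ?_
  rw [coeff_toUSeries_treeTerm hk, mul_smul_comm, smul_smul, one_div_mul_cancel hn, one_smul]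

end

end CycleFactorisation

open CycleFactorisation in
theorem theorem2p3 (k : ℕ) (hk : 2 ≤ k) :
    HasFormalSum
      (fun i : Fin k → ℕ+ =>
        ∑ t : PlaneTree k, (1 / (Nat.card t.out.aut : ℚ)) • treeTerm (Phi k) t.out i)
      (partialDeriv Var.u (Phi k)) := by
  intro n
  have hsub : (Function.support fun i : Fin k → ℕ+ => PowerSeries.coeff n
      (∑ t : PlaneTree k, (1 / (Nat.card t.out.aut : ℚ)) • treeTerm (Phi k) t.out i)) ⊆
      (boundedTuples k n : Set (Fin k → ℕ+)) := by
    intro i hi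
    rw [Finset.mem_coe, mem_boundedTuples]
    by_contra! ⟨e, he⟩
    refine hi ?_
    simp only
    rw [map_sum]
    refine Finset.sum_eq_zero fun t _ => ?_
    rw [map_rat_smul, coeff_treeTerm_eq_zero hk _ he, smul_zero]
  refine ⟨(Finset.finite_toSet _).subset hsub, ?_⟩
  rw [finsum_eq_sum_of_support_subset _ hsub, ← sum_planeTree_coeff hk]
  simp only [map_sum, map_rat_smul]
  rw [Finset.sum_comm]
  simp only [Finset.smul_sum]
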